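/- **Notation.** Let $\kappa\in\mathbb{C}^*$ and let $n,d$ be natural numbers. Put $S(n,d)=\mathrm{Mat}_{n\times d}(\mathbb{C})\times \mathrm{Mat}_{d\times n}(\mathbb{C})$, with elements $(A,B)$. For $\ell\ge 1$ let $E_{jk}$ be the elementary $\ell\times\ell$ matrices, and $$r^\ell=\tfrac12\sum_{j<k}(E_{jk}\otimes E_{kj}-E_{kj}\otimes E_{jk}),\qquad r^\ell_\pm=r^\ell\pm\tfrac12\sum_{j,k}E_{jk}\otimes E_{kj},\qquad C_{12}^{n\times d}=\sum_{i=1}^n\sum_{\alpha=1}^d E_{i\alpha}^{n\times d}\otimes E_{\alpha i}^{d\times n}.$$ With the usual tensor notation ($X_1=X\otimes 1$, $X_2=1\otimes X$), consider the following two brackets of holomorphic functions on $S(n,d)$: $$\{A_1,A_2\}_\kappa=-\kappa(r^nA_1A_2+A_1A_2r^d),\quad \{B_1,B_2\}_\kappa=-\kappa(B_1B_2r^n+r^dB_1B_2),\quad \{A_1,B_2\}_\kappa=\kappa(B_2r^n_+A_1+A_1r^d_+B_2+C_{12}^{n\times d}),$$ and $$\{A_1,A_2\}'_\kappa=\kappa(r^nA_1A_2-A_1A_2r^d),\quad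 \{B_1,B_2\}'_\kappa=\kappa(B_1B_2r^n-r^dB_1B_2),\quad \{A_1,B_2\}'_\kappa=\kappa(-B_2r^n_+A_1+A_1r^d_-B_2+C_{12}^{n\times d}).$$ For $(a,b)\in S(n,1)$ let $G_j=1+\sum_{k=j}^n a_kb_k$ for $1\le j\le n$, and $G_{n+1}=1$. Where the $G_j$ do not vanish, and for continuous local branches of the functions $\sqrt{G_j}$ (with $\sqrt{G_j/G_{j+1}}=\sqrt{G_j}/\sqrt{G_{j+1}}$ and $\sqrt{G_jG_{j+1}}=\sqrt{G_j}\sqrt{G_{j+1}}$), let $g_+$ be the upper triangular and $g_-^{-1}$ the lower triangular $n\times n$ matrix with $$(g_+)_{jj}=(g_-^{-1})_{jj}=\sqrt{G_j/G_{j+1}},\qquad (g_+)_{jk}=\frac{a_jb_k}{\sqrt{G_kG_{k+1}}}\ (j<k),\qquad (g_-^{-1})_{jk}=\frac{a_jb_k}{\sqrt{G_jG_{j+1}}}\ (j>k).$$ Let $\mathrm{GL}(n,\mathbb{C})^*$ be the set of pairs $(h_+,h_-)$ of an invertible upper triangular and an invertible lower triangular $n\times n$ matrix with $(h_-)_{jj}=1/(h_+)_{jj}$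 for all $j$. **Theorem.** The bracket $\{\ ,\ \}_\kappa$ on $S(n,1)$, its product on $S(n,1)^{\times d}$ (different factors commute), and the bracket $\{\ ,\ \}'_\kappa$ on $S(n,d)$ are holomorphic Poisson structures. For $(a,b)=((a^1,b^1),\dots,(a^d,b^d))\in S(n,1)^{\times d}$ let $F(a,b)=(\hat A,\hat B)\in S(n,d)$ have the columns and rows $$\hat A^\alpha=g_+^{-1}(a^d,b^d)\cdots g_+^{-1}(a^\alpha,b^\alpha)\,a^\alpha,\qquad \hat B^\alpha=b^\alpha\, g_-(a^\alpha,b^\alpha)\cdots g_-(a^d,b^d)\qquad(1\le\alpha\le d).$$ 1. On every product of $d$ open subsets of $S(n,1)$ on which the $G_j$ do not vanish and continuous branches of the $\sqrt{G_j}$ are chosen, $F:(S(n,1),\{\ ,\ \}_\kappa)^{\times d}\to(S(n,d),\{\ ,\ \}'_\kappa)$ is a local holomorphic Poisson diffeomorphism: it is holomorphic, it is a Poisson map, and around each point it restricts to a biholomorphic map between open sets. 2. With the principal branches (so that $\sqrt{G_j}=1$ at zero), $F$ restricts to a biholomorphic Poisson map from an open neighbourhood of $0$, on which all $G_j(a^\alpha,b^\alpha)$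 have positive real part, onto a connected open neighbourhood $V$ of $0$ in $S(n,d)$, with $F(0)=0$ and with the following inverse. There are continuous maps $(\hat g_{+,\alpha},\hat g_{-,\alpha}):V\to \mathrm{GL}(n,\mathbb{C})^*$, $1\le\alpha\le d$, with value $(\boldsymbol 1_n,\boldsymbol 1_n)$ at $0$, that solve $$\boldsymbol 1_n-\hat g_{+,\alpha+1}\cdots\hat g_{+,d}\,\hat A^\alpha\hat B^\alpha\,\hat g_{-,d}^{-1}\cdots\hat g_{-,\alpha+1}^{-1}=\hat g_{+,\alpha}^{-1}\,\hat g_{-,\alpha},\qquad \alpha=d,\dots,1$$ (for $\alpha=d$ the left-hand side is $\boldsymbol 1_n-\hat A^d\hat B^d$). They are unique, also on each connected subset of $V$ that contains $0$. The inverse of $F$ on $V$ is $$a^\alpha=\hat g_{+,\alpha}\hat g_{+,\alpha+1}\cdots\hat g_{+,d}\,\hat A^\alpha,\qquad b^\alpha=\hat B^\alpha\,\hat g_{-,d}^{-1}\cdots\hat g_{-,\alpha+1}^{-1}\hat g_{-,\alpha}^{-1}.$$ -/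

import Mathlib

open scoped Matrix Kronecker BigOperators

noncomputable section

namespace SpinPoisson

/-! ### Poisson brackets of holomorphic functions -/

/-- A (not necessarily antisymmetric) 2-tensor on `E`: at each point a pairing of covectors.
It encodes the biderivation `(f, g) ↦ (x ↦ π x (df_x) (dg_x))`. -/
abbrev TwoTensor (E : Type*) [NormedAddCommGroup E] [NormedSpace ℂ E] :=
  E → (E →L[ℂ] ℂ) → (E →L[ℂ] ℂ) → ℂ

section General

variable {E E' : Type*} [NormedAddCommGroup E] [NormedSpace ℂ E]
  [NormedAddCommGroup E'] [NormedSpace ℂ E']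

/-- The bracket `{f, g}(x) = π x (df_x) (dg_x)`. -/
def bracket (π : TwoTensor E) (f g : E → ℂ) (x : E) : ℂ :=
  π x (fderiv ℂ f x) (fderiv ℂ g x)

/-- `π` defines a holomorphic Poisson structure: on the holomorphic functions of every open set
its bracket takes holomorphic values, and is bilinear, antisymmetric, a derivation in each argument
(in the second one, hence by antisymmetry in both), and satisfies the Jacobi identity. -/
structure IsHolomorphicPoisson (π : TwoTensor E) : Prop where
  holomorphic : ∀ (O : Set E) (f g : E → ℂ), IsOpen O →
    AnalyticOnNhd ℂ f O → AnalyticOnNhd ℂ g O → AnalyticOnNhd ℂ (bracket π f g) O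
  linear : ∀ (O : Set E) (c : ℂ) (f g h : E → ℂ), IsOpen O →
    AnalyticOnNhd ℂ f O → AnalyticOnNhd ℂ g O → AnalyticOnNhd ℂ h O →
    ∀ x ∈ O, bracket π f (fun y => c * g y + h y) x = c * bracket π f g x + bracket π f h x
  antisymm : ∀ (O : Set E) (f g : E → ℂ), IsOpen O →
    AnalyticOnNhd ℂ f O → AnalyticOnNhd ℂ g O →
    ∀ x ∈ O, bracket π f g x = - bracket π g f x
  leibniz : ∀ (O : Set E) (f g h : E → ℂ), IsOpen O →
    AnalyticOnNhd ℂ f O → AnalyticOnNhd ℂ g O → AnalyticOnNhd ℂ h O →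
    ∀ x ∈ O, bracket π f (fun y => g y * h y) x = bracket π f g x * h x + g x * bracket π f h x
  jacobi : ∀ (O : Set E) (f g h : E → ℂ), IsOpen O →
    AnalyticOnNhd ℂ f O → AnalyticOnNhd ℂ g O → AnalyticOnNhd ℂ h O →
    ∀ x ∈ O, bracket π f (bracket π g h) x + bracket π g (bracket π h f) x
      + bracket π h (bracket π f g) x = 0

/-- `Φ` is a Poisson map on `Ω`: `{f ∘ Φ, g ∘ Φ} = {f, g} ∘ Φ` on `Ω`, for all functions `f`, `g`
holomorphic on some open set of the target, at the points of `Ω` sent into that set. -/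
def IsPoissonMapOn (π : TwoTensor E) (π' : TwoTensor E') (Φ : E → E') (Ω : Set E) : Prop :=
  ∀ (O : Set E') (f g : E' → ℂ), IsOpen O → AnalyticOnNhd ℂ f O → AnalyticOnNhd ℂ g O →
    ∀ x ∈ Ω, Φ x ∈ O → bracket π (f ∘ Φ) (g ∘ Φ) x = bracket π' f g (Φ x)

/-- `e` is a biholomorphism from its (open) source onto its (open) target. -/
def IsBiholomorphism (e : OpenPartialHomeomorph E E') : Prop :=
  AnalyticOnNhd ℂ e e.source ∧ AnalyticOnNhd ℂ e.symm e.target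

/-- `Φ` is a local holomorphic Poisson diffeomorphism on `Ω`: it is holomorphic and Poisson on `Ω`,
and around every point of `Ω` it restricts to a biholomorphism between open sets. -/
def IsLocalPoissonDiffeoOn (π : TwoTensor E) (π' : TwoTensor E') (Φ : E → E') (Ω : Set E) : Prop :=
  AnalyticOnNhd ℂ Φ Ω ∧ IsPoissonMapOn π π' Φ Ω ∧
    ∀ x ∈ Ω, ∃ e : OpenPartialHomeomorph E E', x ∈ e.source ∧ e.source ⊆ Ω ∧
      Set.EqOn e Φ e.source ∧ IsBiholomorphism e

/-- The product of `d` copies of `(E, π)`: functions of different factors commute. -/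
def prodTensor (d : ℕ) (π : TwoTensor E) : TwoTensor (Fin d → E) :=
  fun x φ ψ => ∑ α : Fin d, π (x α)
    (φ.comp (ContinuousLinearMap.single ℂ (fun _ : Fin d => E) α))
    (ψ.comp (ContinuousLinearMap.single ℂ (fun _ : Fin d => E) α))

end General

/-! ### The `r`-matrix and the two brackets on `S(n,d)` -/

/-- `S(n,d)`: pairs of an `n × d` and a `d × n` complex matrix (as normed space of entries). -/
abbrev S (n d : ℕ) := (Fin n → Fin d → ℂ) × (Fin d → Fin n → ℂ)

/-- The matrix `A` of a point `(A, B)` of `S(n,d)`. -/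
def matA {n d : ℕ} (x : S n d) : Matrix (Fin n) (Fin d) ℂ := Matrix.of x.1

/-- The matrix `B` of a point `(A, B)` of `S(n,d)`. -/
def matB {n d : ℕ} (x : S n d) : Matrix (Fin d) (Fin n) ℂ := Matrix.of x.2

/-- The elementary matrix `E_{jk}(l)`. -/
abbrev elem (l : ℕ) (j k : Fin l) : Matrix (Fin l) (Fin l) ℂ := Matrix.single j k 1

/-- `r^l = (1/2) ∑_{j<k} (E_{jk} ⊗ E_{kj} - E_{kj} ⊗ E_{jk})`. -/
def rMat (l : ℕ) : Matrix (Fin l × Fin l) (Fin l × Fin l) ℂ :=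
  (1 / 2 : ℂ) • ∑ j : Fin l, ∑ k : Fin l,
    if j < k then elem l j k ⊗ₖ elem l k j - elem l k j ⊗ₖ elem l j k else 0

/-- `I^l = ∑_{j,k} E_{jk} ⊗ E_{kj}`. -/
def permMat (l : ℕ) : Matrix (Fin l × Fin l) (Fin l × Fin l) ℂ :=
  ∑ j : Fin l, ∑ k : Fin l, elem l j k ⊗ₖ elem l k j

/-- `r^l_+ = r^l + I^l / 2`. -/
def rPlus (l : ℕ) : Matrix (Fin l × Fin l) (Fin l × Fin l) ℂ := rMat l + (1 / 2 : ℂ) • permMat l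

/-- `r^l_- = r^l - I^l / 2`. -/
def rMinus (l : ℕ) : Matrix (Fin l × Fin l) (Fin l × Fin l) ℂ := rMat l - (1 / 2 : ℂ) • permMat l

/-- `C_{12} = ∑_{i,α} E_{iα} ⊗ E_{αi}`. -/
def cMat (n d : ℕ) : Matrix (Fin n × Fin d) (Fin d × Fin n) ℂ :=
  ∑ i : Fin n, ∑ α : Fin d, Matrix.single i α (1 : ℂ) ⊗ₖ Matrix.single α i (1 : ℂ)

/-- `B_2 R A_1 = (1 ⊗ B) R (A ⊗ 1)`, for `R` acting on `ℂⁿ ⊗ ℂⁿ`. -/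
def sandwichN {n d : ℕ} (R : Matrix (Fin n × Fin n) (Fin n × Fin n) ℂ)
    (A : Matrix (Fin n) (Fin d) ℂ) (B : Matrix (Fin d) (Fin n) ℂ) :
    Matrix (Fin n × Fin d) (Fin d × Fin n) ℂ :=
  ((1 : Matrix (Fin n) (Fin n) ℂ) ⊗ₖ B) * R * (A ⊗ₖ (1 : Matrix (Fin n) (Fin n) ℂ))

/-- `A_1 R B_2 = (A ⊗ 1) R (1 ⊗ B)`, for `R` acting on `ℂᵈ ⊗ ℂᵈ`. -/
def sandwichD {n d : ℕ} (R : Matrix (Fin d × Fin d) (Fin d × Fin d) ℂ)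
    (A : Matrix (Fin n) (Fin d) ℂ) (B : Matrix (Fin d) (Fin n) ℂ) :
    Matrix (Fin n × Fin d) (Fin d × Fin n) ℂ :=
  (A ⊗ₖ (1 : Matrix (Fin d) (Fin d) ℂ)) * R * ((1 : Matrix (Fin d) (Fin d) ℂ) ⊗ₖ B)

/-- The 2-tensor on `S(n,d)` with prescribed brackets of the matrix entries in tensor notation:
the matrices `AA`, `BB`, `AB` collect the brackets `{A_1, A_2}`, `{B_1, B_2}`, `{A_1, B_2}`, that is
`{A_{iα}, A_{jβ}} = AA (i,j) (α,β)`, `{B_{αi}, B_{βj}} = BB (α,β) (i,j)`,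
`{A_{iα}, B_{βj}} = AB (i,β) (α,j)`, and `{B_{βj}, A_{iα}} = - {A_{iα}, B_{βj}}`.
Here `φ` and `ψ` are covectors, and the covector `φ` has the components `φ (∂/∂A_{iα})` and
`φ (∂/∂B_{αi})`. -/
def tensorOf {n d : ℕ} (AA : S n d → Matrix (Fin n × Fin n) (Fin d × Fin d) ℂ)
    (BB : S n d → Matrix (Fin d × Fin d) (Fin n × Fin n) ℂ)
    (AB : S n d → Matrix (Fin n × Fin d) (Fin d × Fin n) ℂ) : TwoTensor (S n d) :=
  fun x φ ψ =>
    let eA : Fin n → Fin d → S n d := fun i α => (Pi.single i (Pi.single α 1), 0)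
    let eB : Fin d → Fin n → S n d := fun α i => (0, Pi.single α (Pi.single i 1))
    ∑ i : Fin n, ∑ j : Fin n, ∑ α : Fin d, ∑ β : Fin d,
      (AA x (i, j) (α, β) * φ (eA i α) * ψ (eA j β)
        + BB x (α, β) (i, j) * φ (eB α i) * ψ (eB β j)
        + AB x (i, β) (α, j) * (φ (eA i α) * ψ (eB β j) - φ (eB β j) * ψ (eA i α)))

/-- The bracket `{ , }_κ` on `S(n,d)`:
`{A_1, A_2} = -κ (rⁿ A_1 A_2 + A_1 A_2 rᵈ)`, `{B_1, B_2} = -κ (B_1 B_2 rⁿ + rᵈ B_1 B_2)`,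
`{A_1, B_2} = κ (B_2 rⁿ_+ A_1 + A_1 rᵈ_+ B_2 + C_{12})`. -/
def tensorK (κ : ℂ) (n d : ℕ) : TwoTensor (S n d) :=
  tensorOf
    (fun x => (-κ) • (rMat n * (matA x ⊗ₖ matA x) + (matA x ⊗ₖ matA x) * rMat d))
    (fun x => (-κ) • ((matB x ⊗ₖ matB x) * rMat n + rMat d * (matB x ⊗ₖ matB x)))
    (fun x => κ • (sandwichN (rPlus n) (matA x) (matB x) + sandwichD (rPlus d) (matA x) (matB x)
      + cMat n d))

/-- The bracket `{ , }'_κ` on `S(n,d)`: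
`{A_1, A_2} = κ (rⁿ A_1 A_2 - A_1 A_2 rᵈ)`, `{B_1, B_2} = κ (B_1 B_2 rⁿ - rᵈ B_1 B_2)`,
`{A_1, B_2} = κ (-B_2 rⁿ_+ A_1 + A_1 rᵈ_- B_2 + C_{12})`. -/
def tensorK' (κ : ℂ) (n d : ℕ) : TwoTensor (S n d) :=
  tensorOf
    (fun x => κ • (rMat n * (matA x ⊗ₖ matA x) - (matA x ⊗ₖ matA x) * rMat d))
    (fun x => κ • ((matB x ⊗ₖ matB x) * rMat n - rMat d * (matB x ⊗ₖ matB x)))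
    (fun x => κ • (-sandwichN (rPlus n) (matA x) (matB x) + sandwichD (rMinus d) (matA x) (matB x)
      + cMat n d))

/-! ### The map `(g_+, g_-)` and the map `F` -/

/-- `G_j = 1 + ∑_{k ≥ j} a_k b_k`, with 0-based `j`, so that `G_n = 1` and `j` stands for the
1-based index `j + 1`. -/
def G {n : ℕ} (j : ℕ) (x : S n 1) : ℂ :=
  1 + ∑ k : Fin n, if j ≤ (k : ℕ) then x.1 k 0 * x.2 0 k else 0

/-- Continuous nowhere vanishing branches `s j` on `U` of the square roots of `G_0, …, G_n`. -/
def IsRootBranch {n : ℕ} (U : Set (S n 1)) (s : ℕ → S n 1 → ℂ) : Prop :=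
  ∀ j ≤ n, ContinuousOn (s j) U ∧ ∀ x ∈ U, s j x ≠ 0 ∧ s j x ^ 2 = G j x

/-- The principal branches of the square roots of the `G_j`. -/
def principalRoot {n : ℕ} (j : ℕ) (x : S n 1) : ℂ := Complex.sqrt (G j x)

/-- `g_+`, where `√(G_j / G_{j+1})` is `s_j / s_{j+1}` and `√(G_k G_{k+1})` is `s_k s_{k+1}`. -/
def gPlus {n : ℕ} (s : ℕ → S n 1 → ℂ) (x : S n 1) : Matrix (Fin n) (Fin n) ℂ :=
  Matrix.of fun j k =>
    if j = k then s j x / s (j + 1) x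
    else if j < k then x.1 j 0 * x.2 0 k / (s k x * s (k + 1) x)
    else 0

/-- The inverse of `g_-`. -/
def gMinusInv {n : ℕ} (s : ℕ → S n 1 → ℂ) (x : S n 1) : Matrix (Fin n) (Fin n) ℂ :=
  Matrix.of fun j k =>
    if j = k then s j x / s (j + 1) x
    else if k < j then x.1 j 0 * x.2 0 k / (s j x * s (j + 1) x)
    else 0

/-- `g_-`. -/
def gMinus {n : ℕ} (s : ℕ → S n 1 → ℂ) (x : S n 1) : Matrix (Fin n) (Fin n) ℂ :=
  (gMinusInv s x)⁻¹

/-- `M_k M_{k+1} ⋯ M_{d-1}` (indices 0-based; the empty product is `1`). -/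
def ascProd {n d : ℕ} (M : Fin d → Matrix (Fin n) (Fin n) ℂ) (k : ℕ) : Matrix (Fin n) (Fin n) ℂ :=
  (((List.finRange d).drop k).map M).prod

/-- `M_{d-1} ⋯ M_{k+1} M_k` (indices 0-based; the empty product is `1`). -/
def descProd {n d : ℕ} (M : Fin d → Matrix (Fin n) (Fin n) ℂ) (k : ℕ) : Matrix (Fin n) (Fin n) ℂ :=
  (((List.finRange d).drop k).map M).reverse.prod

/-- The map `F : (a, b) ↦ (Â, B̂)`, with columns `Â^α = g_+⁻¹(a^d,b^d) ⋯ g_+⁻¹(a^α,b^α) a^α` and rows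
`B̂^α = b^α g_-(a^α,b^α) ⋯ g_-(a^d,b^d)`. The functions `g_±` on the copy number `α` of `S(n,1)` are
formed with the branches `s α`. -/
def mapF {n d : ℕ} (s : Fin d → ℕ → S n 1 → ℂ) (x : Fin d → S n 1) : S n d :=
  (fun i α => (descProd (fun β => (gPlus (s β) (x β))⁻¹) α * matA (x α)) i 0,
   fun α i => (matB (x α) * ascProd (fun β => gMinus (s β) (x β)) α) 0 i)

/-! ### The iterated factorization problem -/

/-- `(h_+, h_-) ∈ GL(n)^*`: `h_+` is invertible upper triangular, `h_-` invertible lower triangular,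
and `(h_-)_{jj} = 1 / (h_+)_{jj}`. (A triangular matrix is invertible iff its diagonal entries are
nonzero, which is what the last equation says.) -/
def InDualGroup {n : ℕ} (hp hm : Matrix (Fin n) (Fin n) ℂ) : Prop :=
  (∀ j k, k < j → hp j k = 0) ∧ (∀ j k, j < k → hm j k = 0) ∧ ∀ j, hm j j * hp j j = 1

/-- The column `Â^α` of `y = (Â, B̂)`, as an `n × 1` matrix. -/
def colA {n d : ℕ} (y : S n d) (α : Fin d) : Matrix (Fin n) (Fin 1) ℂ := Matrix.of fun i _ => y.1 i α

/-- The row `B̂^α` of `y = (Â, B̂)`, as a `1 × n` matrix. -/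
def rowB {n d : ℕ} (y : S n d) (α : Fin d) : Matrix (Fin 1) (Fin n) ℂ := Matrix.of fun _ i => y.2 α i

/-- `ĝ_{±,α} : W → GL(n)^*` are continuous, equal to `1` at zero, and solve on `W` the equations
`1 - ĝ_{+,α+1} ⋯ ĝ_{+,d} Â^α B̂^α ĝ_{-,d}⁻¹ ⋯ ĝ_{-,α+1}⁻¹ = ĝ_{+,α}⁻¹ ĝ_{-,α}` for all `α`. -/
def SolvesFactorization {n d : ℕ} (W : Set (S n d))
    (gp gm : Fin d → S n d → Matrix (Fin n) (Fin n) ℂ) : Prop :=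
  ∀ α : Fin d, ContinuousOn (gp α) W ∧ ContinuousOn (gm α) W ∧ gp α 0 = 1 ∧ gm α 0 = 1 ∧
    ∀ y ∈ W, InDualGroup (gp α y) (gm α y) ∧
      1 - ascProd (fun β => gp β y) (α + 1) * (colA y α * rowB y α) *
        descProd (fun β => (gm β y)⁻¹) (α + 1) = (gp α y)⁻¹ * gm α y

/-- `(Â, B̂) ↦ (a, b)`, with `a^α = ĝ_{+,α} ⋯ ĝ_{+,d} Â^α` and
`b^α = B̂^α ĝ_{-,d}⁻¹ ⋯ ĝ_{-,α}⁻¹`. -/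
def reconstruct {n d : ℕ} (gp gm : Fin d → S n d → Matrix (Fin n) (Fin n) ℂ) (y : S n d) :
    Fin d → S n 1 :=
  fun α => (fun i _ => (ascProd (fun β => gp β y) α * colA y α) i 0,
    fun _ i => (rowB y α * descProd (fun β => (gm β y)⁻¹) α) 0 i)

end SpinPoisson

end

open SpinPoisson

/-! The map `F` is assembled one copy at a time. Let h = g_+⁻¹ and k = g_-ᵀ be formed from the last
copy (a, b). Passing from d to d + 1 copies multiplies the old columns by h and the old rows, read
as column vectors, by k, and appends â = h a and b̂ = k b. So the Poisson property reduces to the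
brackets of h, k, â, b̂ inside one copy, and to the check that appending such a copy turns the
relations of { , }'_κ on S(n,d) into those on S(n,d+1) (`SpinRel.snoc`, `spinRel_dressed`).

Inside one copy the G_j commute with each other and are log-canonical with the coordinates, so the
brackets of â, b̂ and those of h with â, b̂ are explicit. The brackets h–h and h–k are obtained
indirectly. One has h kᵀ = 1 - â b̂ᵀ (`one_sub_hat`), with h upper and kᵀ lower triangular with the
same diagonal. Applying {h_ip, ·} gives a linear equation for the unknown brackets; it has at most
one triangular solution with equal diagonals (`triangular_unique`), and the r-matrix expressions
solve it (`h_h_and_h_k`).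

All this concerns ℂ-valued biderivations on a commutative ring. It is applied to the ring of
one-jets at a point, because a bracket sees only values and differentials. The same formalism shows
that dF is injective: a derivation that kills all entries of F kills the last copy, then the one
before it, and so on (`kill_of_dressed`). Source and target have the same dimension, so the inverse
function theorem applies.

The Jacobi identity for { , }_κ on S(n,1) is checked on coordinates and passes to the product. For {
, }'_κ no r-matrix computation is made: F is Poisson and open near 0, so the Jacobiator vanishes on
an open set, and being analytic it vanishes everywhere (`compK'_jacobi`).

Finally, h kᵀ = 1 - â b̂ᵀ for the copy α, with the dressing by the later copies undone, is the
factorization problem of the theorem. Two factorizations of one matrix have diagonals that agree up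
to signs, and on a connected set containing 0 continuity fixes the signs
(`SolvesFactorization.unique`). -/

noncomputable section

namespace SpinPoisson

/-! ### Derivations and biderivations along a ring homomorphism -/

section Algebra

variable {R : Type*} [CommRing R]

/-- `D` is a derivation of `R` with values in `ℂ`, on which `R` acts through `ev`. -/
structure IsDer (ev : R →+* ℂ) (D : R → ℂ) : Prop where
  add : ∀ u v, D (u + v) = D u + D v
  mul : ∀ u v, D (u * v) = ev u * D v + ev v * D u

namespace IsDer

variable {ev : R →+* ℂ} {D : R → ℂ}

theorem zero (h : IsDer ev D) : D 0 = 0 := by simpa using h.add 0 0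

theorem one (h : IsDer ev D) : D 1 = 0 := by simpa using h.mul 1 1

theorem neg (h : IsDer ev D) (u : R) : D (-u) = -D u := by
  have := h.add u (-u)
  rw [add_neg_cancel, h.zero] at this
  linear_combination -this

theorem sub (h : IsDer ev D) (u v : R) : D (u - v) = D u - D v := by
  rw [sub_eq_add_neg, h.add, h.neg, sub_eq_add_neg]

theorem sum (h : IsDer ev D) {ι : Type*} (s : Finset ι) (f : ι → R) :
    D (∑ i ∈ s, f i) = ∑ i ∈ s, D (f i) := by
  classical
  induction s using Finset.induction_on with
  | empty => simpa using h.zero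
  | insert i s hi ih => rw [Finset.sum_insert hi, Finset.sum_insert hi, h.add, ih]

theorem sq (h : IsDer ev D) (u : R) : D (u ^ 2) = 2 * ev u * D u := by
  rw [pow_two, h.mul]; ring

theorem of_mul_eq_one (h : IsDer ev D) {u v : R} (huv : u * v = 1) :
    D v = -(ev v ^ 2 * D u) := by
  have h1 := h.mul u v
  rw [huv, h.one] at h1
  have h2 : ev u * ev v = 1 := by rw [← map_mul, huv, map_one]
  linear_combination (-ev v) * h1 - D v * h2

end IsDer

/-- `P` is an antisymmetric biderivation of `R` with values in `ℂ`. -/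
structure IsBider (ev : R →+* ℂ) (P : R → R → ℂ) : Prop where
  der_left : ∀ w, IsDer ev (fun u => P u w)
  anti : ∀ u v, P u v = -P v u

namespace IsBider

variable {ev : R →+* ℂ} {P : R → R → ℂ}

theorem der_right (h : IsBider ev P) (w : R) : IsDer ev (P w) where
  add u v := by
    rw [h.anti w, h.anti w u, h.anti w v, (h.der_left w).add]; ring
  mul u v := by
    rw [h.anti w, h.anti w u, h.anti w v, (h.der_left w).mul]; ring

end IsBider

/-- The sign of `j - i`. -/
def sg {l : ℕ} (i j : Fin l) : ℂ := if i < j then 1 else if j < i then -1 else 0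

/-- The coefficients of `r_+`: `1`, `1/2` or `0` as `i < j`, `i = j` or `j < i`. -/
def rho {l : ℕ} (i j : Fin l) : ℂ := if i < j then 1 else if j < i then 0 else 1 / 2

theorem sg_anti {l : ℕ} (i j : Fin l) : sg i j = -sg j i := by
  unfold sg
  rcases lt_trichotomy i j with h | h | h
  · simp [h, h.not_gt]
  · simp [h]
  · simp [h, h.not_gt]

theorem sg_eq_rho {l : ℕ} (i j : Fin l) : sg i j = rho i j - rho j i := by
  unfold sg rho
  rcases lt_trichotomy i j with h | h | h
  · simp [h, h.not_gt]
  · simp [h]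
  · simp [h, h.not_gt]

theorem rho_add {l : ℕ} (i j : Fin l) : rho i j + rho j i = 1 := by
  unfold rho
  rcases lt_trichotomy i j with h | h | h
  · simp [h, h.not_gt]
  · simp [h]; norm_num
  · simp [h, h.not_gt]

/-- Brackets of the coordinates `a_i`, `b_i` on `S(n,1)`, with `g j` in the role of `G_j`. -/
structure CopyRel (ev : R →+* ℂ) (P : R → R → ℂ) (κ : ℂ) {n : ℕ} (a b : Fin n → R)
    (g : ℕ → R) : Prop where
  last : g n = 1
  step : ∀ i : Fin n, g i = g (i + 1) + a i * b i
  aa : ∀ i j, P (a i) (a j) = -κ / 2 * sg i j * (ev (a i) * ev (a j))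
  bb : ∀ i j, P (b i) (b j) = κ / 2 * sg i j * (ev (b i) * ev (b j))
  ab : ∀ i j, P (a i) (b j) = κ / 2 * (ev (a i) * ev (b j))
    + if i = j then κ / 2 * (ev (g i) + ev (g (i + 1))) else 0

/-! ### Brackets of the functions G_j with the coordinates of one copy -/

namespace CopyRel

variable {ev : R →+* ℂ} {P : R → R → ℂ} {κ : ℂ} {n : ℕ} {a b : Fin n → R} {g : ℕ → R}

/-- The symmetry that halves the work: results about `b` and about rows are those about `a` and
columns, read for the swapped copy. -/
theorem swap (hP : IsBider ev P) (h : CopyRel ev P κ a b g) : CopyRel ev P (-κ) b a g where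
  last := h.last
  step i := by rw [h.step, mul_comm]
  aa i j := by rw [h.bb]; ring
  bb i j := by rw [h.aa]
  ab i j := by
    rw [hP.anti, h.ab]
    by_cases hij : i = j
    · subst hij; simp; ring
    · simp [hij, Ne.symm hij]; ring

/-- Descending induction from G_n = 1, adding a_k b_k at each step. For k < i the brackets of a_k
and of b_k with a_i add up, for k > i they cancel, and for k = i the inhomogeneous term of {a_i,
b_i} combines with a_i b_i = G_i - G_{i+1} to a multiple of G_i. -/
theorem g_a (hP : IsBider ev P) (h : CopyRel ev P κ a b g) (i : Fin n) (j : ℕ) (hj : j ≤ n) :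
    P (g j) (a i) = -κ * (if j ≤ i then 1 else 0) * (ev (g j) * ev (a i)) := by
  have hD := hP.der_left (a i)
  induction hj using Nat.decreasingInduction with
  | self => rw [h.last, hD.one]; simp
  | of_succ k hk ih =>
    have hs := h.step ⟨k, hk⟩
    simp only at hs
    have e := congrArg ev hs
    rw [map_add, map_mul] at e
    rw [hs, hD.add, hD.mul, ih, h.aa, hP.anti (b _), h.ab]
    rcases lt_trichotomy k (i : ℕ) with hki | hki | hki
    · have h1 : (⟨k, hk⟩ : Fin n) < i := hki
      have h2 : k + 1 ≤ (i : ℕ) := hki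
      have h3 : k ≤ (i : ℕ) := hki.le
      simp [sg, h1, h2, h3, h1.ne']
      ring
    · have h1 : (⟨k, hk⟩ : Fin n) = i := Fin.ext hki
      subst h1
      simp [sg]
      rw [e]; ring
    · have h1 : i < (⟨k, hk⟩ : Fin n) := hki
      have h2 : ¬ k + 1 ≤ (i : ℕ) := by omega
      have h3 : ¬ k ≤ (i : ℕ) := by omega
      simp [sg, h1, h2, h3, h1.ne, h1.not_gt]
      ring

theorem g_b (hP : IsBider ev P) (h : CopyRel ev P κ a b g) (i : Fin n) (j : ℕ) (hj : j ≤ n) :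
    P (g j) (b i) = κ * (if j ≤ i then 1 else 0) * (ev (g j) * ev (b i)) := by
  simpa using (h.swap hP).g_a hP i j hj

/-- The factors produced by a_k and b_k are opposite, so G_i commutes with each product a_k b_k. -/
theorem g_g (hP : IsBider ev P) (h : CopyRel ev P κ a b g) (i j : ℕ) (hi : i ≤ n) (hj : j ≤ n) :
    P (g i) (g j) = 0 := by
  have hD := hP.der_right (g i)
  induction hj using Nat.decreasingInduction with
  | self => rw [h.last, hD.one]
  | of_succ k hk ih =>
    rw [show g k = _ from h.step ⟨k, hk⟩, hD.add, ih, hD.mul, h.g_a hP _ _ hi, h.g_b hP _ _ hi]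
    ring

end CopyRel

/-- The relations of one copy of `S(n,1)`, with `s j` a square root of `G_j` and `t j` its inverse. -/
structure RootRel (ev : R →+* ℂ) (P : R → R → ℂ) (κ : ℂ) {n : ℕ} (a b : Fin n → R)
    (s t : ℕ → R) : Prop extends CopyRel ev P κ a b (fun j => s j ^ 2) where
  st : ∀ j ≤ n, s j * t j = 1

/-- The algebraic part of `RootRel`. -/
structure RootData {n : ℕ} (a b : Fin n → R) (s t : ℕ → R) : Prop where
  last : s n ^ 2 = 1
  step : ∀ i : Fin n, s i ^ 2 = s (i + 1) ^ 2 + a i * b i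
  st : ∀ j ≤ n, s j * t j = 1

theorem RootData.swap {n : ℕ} {a b : Fin n → R} {s t : ℕ → R} (h : RootData a b s t) :
    RootData b a s t :=
  ⟨h.last, fun i => by rw [h.step, mul_comm], h.st⟩

/-- `a_i / √(G_i G_{i+1})`. -/
def hat {n : ℕ} (a : Fin n → R) (t : ℕ → R) (i : Fin n) : R := a i * (t i * t (i + 1))

/-- The inverse of `g_+`; the inverse of `g_-ᵀ` is obtained by exchanging `a` and `b`. -/
def hMat {n : ℕ} (a b : Fin n → R) (s t : ℕ → R) : Matrix (Fin n) (Fin n) R :=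
  Matrix.of fun i p => if i = p then s (i + 1) * t i else if i < p then -(hat a t i * b p) else 0

namespace RootRel

variable {ev : R →+* ℂ} {P : R → R → ℂ} {κ : ℂ} {n : ℕ} {a b : Fin n → R} {s t : ℕ → R}

theorem data (h : RootRel ev P κ a b s t) : RootData a b s t := ⟨h.last, h.step, h.st⟩

theorem swap (hP : IsBider ev P) (h : RootRel ev P κ a b s t) : RootRel ev P (-κ) b a s t :=
  ⟨h.toCopyRel.swap hP, h.st⟩

theorem ev_st (h : RootRel ev P κ a b s t) {j : ℕ} (hj : j ≤ n) : ev (s j) * ev (t j) = 1 := by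
  rw [← map_mul, h.st j hj, map_one]

theorem ev_s_ne (h : RootRel ev P κ a b s t) {j : ℕ} (hj : j ≤ n) : ev (s j) ≠ 0 :=
  left_ne_zero_of_mul_eq_one (h.ev_st hj)

theorem ev_t (h : RootRel ev P κ a b s t) {j : ℕ} (hj : j ≤ n) : ev (t j) = (ev (s j))⁻¹ :=
  eq_inv_of_mul_eq_one_right (h.ev_st hj)

theorem ev_step (h : RootRel ev P κ a b s t) (i : Fin n) :
    ev (s i) ^ 2 = ev (s (i + 1)) ^ 2 + ev (a i) * ev (b i) := by
  have := congrArg ev (h.data.step i)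
  simpa using this

/-- Taking a square root halves a logarithmic derivative; the division is allowed because s_j is
invertible. -/
theorem s_of_sq (h : RootRel ev P κ a b s t) {D : R → ℂ} (hD : IsDer ev D) {j : ℕ} (hj : j ≤ n)
    {c : ℂ} (hc : D (s j ^ 2) = c * ev (s j) ^ 2) : D (s j) = c / 2 * ev (s j) := by
  rw [hD.sq] at hc
  have := h.ev_s_ne hj
  refine mul_left_cancel₀ (mul_ne_zero two_ne_zero this) ?_
  rw [hc]; ring

theorem s_a (hP : IsBider ev P) (h : RootRel ev P κ a b s t) (i : Fin n) {j : ℕ} (hj : j ≤ n) :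
    P (s j) (a i) = -κ / 2 * (if j ≤ i then 1 else 0) * (ev (s j) * ev (a i)) := by
  rw [h.s_of_sq (hP.der_left (a i)) hj (c := -κ * (if j ≤ i then 1 else 0) * ev (a i))]
  · ring
  · rw [h.toCopyRel.g_a hP i j hj, map_pow]; ring

theorem s_s (hP : IsBider ev P) (h : RootRel ev P κ a b s t) {i j : ℕ} (hi : i ≤ n) (hj : j ≤ n) :
    P (s i) (s j) = 0 := by
  have h1 : ∀ k ≤ n, P (s i ^ 2) (s k) = 0 := fun k hk => by
    rw [h.s_of_sq (hP.der_right _) hk (c := 0)]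
    · simp
    · rw [zero_mul]; exact h.toCopyRel.g_g hP i k hi hk
  rw [h.s_of_sq (hP.der_left _) hi (c := 0)]
  · simp
  · rw [h1 j hj]; simp

theorem t_der (h : RootRel ev P κ a b s t) {D : R → ℂ} (hD : IsDer ev D) {j : ℕ} (hj : j ≤ n) :
    D (t j) = -((ev (s j))⁻¹ ^ 2 * D (s j)) := by
  rw [hD.of_mul_eq_one (h.st j hj), h.ev_t hj]

theorem t_a (hP : IsBider ev P) (h : RootRel ev P κ a b s t) (i : Fin n) {j : ℕ} (hj : j ≤ n) :
    P (t j) (a i) = κ / 2 * (if j ≤ i then 1 else 0) * (ev (t j) * ev (a i)) := by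
  rw [h.t_der (hP.der_left (a i)) hj, h.s_a hP i hj, h.ev_t hj]
  field_simp [h.ev_s_ne hj]

theorem t_s (hP : IsBider ev P) (h : RootRel ev P κ a b s t) {i j : ℕ} (hi : i ≤ n) (hj : j ≤ n) :
    P (t i) (s j) = 0 := by
  rw [h.t_der (hP.der_left _) hi, h.s_s hP hi hj]; simp

theorem t_t (hP : IsBider ev P) (h : RootRel ev P κ a b s t) {i j : ℕ} (hi : i ≤ n) (hj : j ≤ n) :
    P (t i) (t j) = 0 := by
  rw [h.t_der (hP.der_right _) hj, h.t_s hP hi hj]; simp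

end RootRel

end Algebra

end SpinPoisson

end

noncomputable section

namespace SpinPoisson

section Algebra

/-! ### Tail sums -/

section Tail

variable {R : Type*} [CommRing R] {n : ℕ}

/-- `∑_{l ≥ i} x_l`. -/
def tail (x : Fin n → R) (i : ℕ) : R := ∑ l : Fin n, if i ≤ (l : ℕ) then x l else 0

theorem tail_last (x : Fin n → R) : tail x n = 0 :=
  Finset.sum_eq_zero fun l _ => if_neg (by omega)

theorem tail_step (x : Fin n → R) (i : Fin n) : tail x i = tail x (i + 1) + x i := by
  unfold tail
  rw [← Finset.sum_erase_add _ _ (Finset.mem_univ i),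
    ← Finset.sum_erase_add Finset.univ (fun l : Fin n => if (i : ℕ) + 1 ≤ l then x l else 0)
      (Finset.mem_univ i)]
  simp only [le_refl, if_true, Nat.not_succ_le_self, if_false, add_zero]
  congr 1
  refine Finset.sum_congr rfl fun l hl => ?_
  have : (l : ℕ) ≠ i := fun h => (Finset.mem_erase.1 hl).1 (Fin.ext h)
  by_cases h : (i : ℕ) ≤ l
  · rw [if_pos h, if_pos (by omega)]
  · rw [if_neg h, if_neg (by omega)]

theorem sum_eq_tail (x : Fin n → R) (i : ℕ) (h : ∀ l : Fin n, (l : ℕ) < i → x l = 0) :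
    ∑ l, x l = tail x i := by
  refine Finset.sum_congr rfl fun l _ => ?_
  split_ifs with hl
  · rfl
  · exact h l (not_le.1 hl)

theorem tail_congr {x y : Fin n → R} (i : ℕ) (h : ∀ l : Fin n, i ≤ l → x l = y l) :
    tail x i = tail y i := by
  refine Finset.sum_congr rfl fun l _ => ?_
  split_ifs with hl
  · exact h l hl
  · rfl

theorem tail_mul_left (c : R) (x : Fin n → R) (i : ℕ) :
    tail (fun l => c * x l) i = c * tail x i := by
  simp [tail, Finset.mul_sum]

/-- The weight 1/2 at l = i makes the sum an average of two consecutive tails. This is how r_+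
produces expressions such as G_i + G_{i+1}. -/
theorem rho_sum (x : Fin n → ℂ) (i : Fin n) :
    ∑ l, rho i l * x l = (tail x i + tail x (i + 1)) / 2 := by
  rw [tail_step, sum_eq_tail _ i, tail_step, tail_congr (y := x) (i + 1)]
  · simp [rho]; ring
  · intro l hl
    have : i < l := hl
    simp [rho, this]
  · intro l hl
    have : l < i := hl
    simp [rho, this, this.not_gt]

end Tail

section

variable {R : Type*} [CommRing R]

/-- The matrix `g_+`; `g_-⁻¹` is obtained by exchanging `a` and `b` and transposing. -/
def gMat {n : ℕ} (a b : Fin n → R) (s t : ℕ → R) : Matrix (Fin n) (Fin n) R :=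
  Matrix.of fun i p => if i = p then s i * t (i + 1) else if i < p then a i * hat b t p else 0

end

/-! ### Matrix identities of one copy: g_+⁻¹ a, the triangular factorization, the inverse of g_+ -/

namespace RootData

variable {R : Type*} [CommRing R] {n : ℕ} {a b : Fin n → R} {s t : ℕ → R}

theorem tail_ab (h : RootData a b s t) {j : ℕ} (hj : j ≤ n) :
    tail (fun i => a i * b i) j = s j ^ 2 - 1 := by
  induction hj using Nat.decreasingInduction with
  | self => rw [tail_last, h.last, sub_self]
  | of_succ k hk ih =>
    have := h.step ⟨k, hk⟩
    have h2 := tail_step (fun i => a i * b i) ⟨k, hk⟩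
    simp only at this h2
    rw [h2, ih, this]; ring

theorem hat_mul_sq (h : RootData a b s t) (i : Fin n) :
    hat a t i * s (i + 1) ^ 2 = s (i + 1) * t i * a i := by
  have := h.st (i + 1) i.2
  unfold hat
  linear_combination (a i * t i * s (i + 1)) * this

theorem hMat_diag (a b : Fin n → R) (s t : ℕ → R) (i : Fin n) :
    hMat a b s t i i = s (i + 1) * t i := by simp [hMat]

theorem hMat_upper (a b : Fin n → R) (s t : ℕ → R) {i p : Fin n} (hip : i < p) :
    hMat a b s t i p = -(hat a t i * b p) := by simp [hMat, hip.ne, hip]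

theorem hMat_lower (a b : Fin n → R) (s t : ℕ → R) {i p : Fin n} (hip : p < i) :
    hMat a b s t i p = 0 := by simp [hMat, hip.ne', hip.not_gt]

/-- Beyond the diagonal the row is a multiple of b, so the sum is a tail of a_l b_l, namely G_{i+1}
- 1; the diagonal term cancels the G_{i+1} part by `hat_mul_sq`. -/
theorem hMat_mulVec (h : RootData a b s t) (i : Fin n) :
    ∑ p, hMat a b s t i p * a p = hat a t i := by
  rw [sum_eq_tail _ i, tail_step, tail_congr (y := fun p => -hat a t i * (a p * b p)) (i + 1),
    tail_mul_left, h.tail_ab i.2, hMat_diag]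
  · linear_combination -h.hat_mul_sq i
  · intro l hl
    rw [hMat_upper _ _ _ _ (show i < l from hl)]; ring
  · intro l hl
    rw [hMat_lower _ _ _ _ (show l < i from hl), zero_mul]

/-- Only l ≥ j contributes. For l > j the summands are multiples of a_l b_l and sum to a multiple of
G_{j+1} - 1; the term l = j supplies what is missing. The case i > j follows by exchanging a and b.
-/
theorem one_sub_hat_aux (h : RootData a b s t) {i j : Fin n} (hij : i ≤ j) :
    ∑ l, hMat a b s t i l * hMat b a s t j l
      = (if i = j then 1 else 0) - hat a t i * hat b t j := by
  rw [sum_eq_tail _ j, tail_step,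
    tail_congr (y := fun p => (hat a t i * hat b t j) * (a p * b p)) (j + 1),
    tail_mul_left, h.tail_ab j.2, hMat_diag]
  · rcases hij.eq_or_lt with rfl | hij
    · rw [hMat_diag]
      simp only [if_true]
      have h1 := h.st (i + 1) i.2
      have h2 := h.st i i.2.le
      have h3 := h.step i
      have h4 : t i ^ 2 * s i ^ 2 = 1 := by linear_combination (s i * t i + 1) * h2
      have h5 : t (i+1) ^ 2 * s (i+1) ^ 2 = 1 := by
        linear_combination (s (i+1) * t (i+1) + 1) * h1
      unfold hat
      linear_combination h4 - t i ^ 2 * h3 + (t i ^ 2 * (a i * b i)) * h5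
    · rw [hMat_upper _ _ _ _ hij, if_neg hij.ne]
      linear_combination (hat a t i) * h.swap.hat_mul_sq j
  · intro l hl
    have hl : j < l := hl
    rw [hMat_upper _ _ _ _ hl, hMat_upper _ _ _ _ (hij.trans_lt hl)]; ring
  · intro l hl
    rw [hMat_lower (i := j) _ _ _ _ (show l < j from hl), mul_zero]

theorem one_sub_hat (h : RootData a b s t) (i j : Fin n) :
    ∑ l, hMat a b s t i l * hMat b a s t j l
      = (if i = j then 1 else 0) - hat a t i * hat b t j := by
  rcases le_total i j with hij | hij
  · exact h.one_sub_hat_aux hij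
  · have := h.swap.one_sub_hat_aux hij
    simp only [mul_comm (hMat b a s t _ _), mul_comm (hat b t _), eq_comm (a := j)] at this
    exact this

/-- The partial sums telescope, since above the diagonal each step adds b_p (1/G_k - 1/G_{k+1}).
They give both the inverse of g_+ and the sums weighted by `rho` in the brackets of h with b̂. -/
theorem tail_hat_hMat (h : RootData a b s t) (p : Fin n) {i : ℕ} (hi : i ≤ n) :
    tail (fun l => hat b t l * hMat a b s t l p) i = if i ≤ p then b p * t i ^ 2 else 0 := by
  induction hi using Nat.decreasingInduction with
  | self => rw [tail_last, if_neg (by omega)]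
  | of_succ k hk ih =>
    have h2 := tail_step (fun l => hat b t l * hMat a b s t l p) ⟨k, hk⟩
    simp only at h2
    rw [h2, ih]
    rcases lt_trichotomy k (p : ℕ) with hkp | hkp | hkp
    · rw [if_pos (show k + 1 ≤ (p : ℕ) from hkp), if_pos hkp.le, hMat_upper _ _ _ _ (show (⟨k, hk⟩ : Fin n) < p from hkp)]
      have h0 := h.st k hk.le
      have h1 := h.st (k + 1) hk
      have h3 := h.step ⟨k, hk⟩
      simp only at h3
      have h4 : t k ^ 2 * s k ^ 2 = 1 := by linear_combination (s k * t k + 1) * h0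
      have h5 : t (k+1) ^ 2 * s (k+1) ^ 2 = 1 := by
        linear_combination (s (k+1) * t (k+1) + 1) * h1
      unfold hat
      simp only
      linear_combination (b p * t k ^ 2) * h5 - (b p * t (k+1) ^ 2) * h4
        + (b p * t k ^ 2 * t (k+1) ^ 2) * h3
    · have : (⟨k, hk⟩ : Fin n) = p := Fin.ext hkp
      subst this
      simp only at *
      rw [if_neg (by simp), if_pos le_rfl, hMat_diag]
      have h1 := h.st (k + 1) hk
      unfold hat
      simp only
      linear_combination (b ⟨k, hk⟩ * t k ^ 2) * h1
    · rw [if_neg (by omega), if_neg (by omega), hMat_lower _ _ _ _ (show p < ⟨k, hk⟩ from hkp)]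
      simp

/-- Right of the diagonal, row i of g_+ is a_i times b̂, so the product reduces to a diagonal term
and one tail from `tail_hat_hMat`. -/
theorem gMat_mul_hMat (h : RootData a b s t) : gMat a b s t * hMat a b s t = 1 := by
  ext i p
  rw [Matrix.mul_apply, sum_eq_tail _ i, tail_step,
    tail_congr (y := fun l => a i * (hat b t l * hMat a b s t l p)) (i + 1), tail_mul_left,
    h.tail_hat_hMat p i.2]
  · have hg : gMat a b s t i i = s i * t (i + 1) := by simp [gMat]
    rw [hg]
    rcases lt_trichotomy i p with hip | rfl | hip
    · rw [if_pos (show (i : ℕ) + 1 ≤ p from hip), hMat_upper _ _ _ _ hip,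
        Matrix.one_apply_ne hip.ne]
      have h0 := h.st i i.2.le
      unfold hat
      linear_combination (-a i * b p * t (i + 1) ^ 2) * h0
    · rw [if_neg (by simp), hMat_diag, Matrix.one_apply_eq]
      have h0 := h.st i i.2.le
      have h1 := h.st (i + 1) i.2
      linear_combination (s i * t i) * h1 + h0
    · rw [if_neg (by have : (p : ℕ) < i := hip
                     omega), hMat_lower _ _ _ _ hip, Matrix.one_apply_ne hip.ne']
      simp
  · intro l hl
    have : i < l := hl
    simp [gMat, this, this.ne, mul_assoc]
  · intro l hl
    have : l < i := hl
    simp [gMat, this.not_gt, this.ne']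

end RootData

/-! ### Uniqueness of infinitesimal and of global triangular factorizations -/

section Triangular

variable {n : ℕ}

theorem diag_mul_upper {M N : Matrix (Fin n) (Fin n) ℂ} (hM : ∀ j k, k < j → M j k = 0)
    (hN : ∀ j k, k < j → N j k = 0) (j : Fin n) : (M * N) j j = M j j * N j j := by
  rw [Matrix.mul_apply, Finset.sum_eq_single j]
  · intro k _ hk
    rcases lt_or_gt_of_ne hk with h | h
    · rw [hM _ _ h, zero_mul]
    · rw [hN _ _ h, mul_zero]
  · simp

theorem upper_mul {M N : Matrix (Fin n) (Fin n) ℂ} (hM : ∀ j k, k < j → M j k = 0)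
    (hN : ∀ j k, k < j → N j k = 0) : ∀ j k, k < j → (M * N) j k = 0 := by
  intro j k hkj
  rw [Matrix.mul_apply]
  refine Finset.sum_eq_zero fun l _ => ?_
  rcases lt_or_ge l j with h | h
  · rw [hM _ _ h, zero_mul]
  · rw [hN _ _ (hkj.trans_le h), mul_zero]

theorem det_upper {M : Matrix (Fin n) (Fin n) ℂ} (hM : ∀ j k, k < j → M j k = 0) :
    M.det = ∏ j, M j j :=
  Matrix.det_of_isUpperTriangular fun j k h => hM j k h

theorem isUnit_det_upper {M : Matrix (Fin n) (Fin n) ℂ} (hM : ∀ j k, k < j → M j k = 0)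
    (hd : ∀ j, M j j ≠ 0) : IsUnit M.det := by
  rw [det_upper hM, isUnit_iff_ne_zero, Finset.prod_ne_zero_iff]
  exact fun j _ => hd j

theorem upper_inv {M : Matrix (Fin n) (Fin n) ℂ} (hM : ∀ j k, k < j → M j k = 0)
    (hd : ∀ j, M j j ≠ 0) : ∀ j k, k < j → M⁻¹ j k = 0 := by
  have : Invertible M := M.invertibleOfIsUnitDet (isUnit_det_upper hM hd)
  have h := Matrix.blockTriangular_inv_of_blockTriangular (M := M) (b := id)
    (fun j k h => hM j k h)
  exact fun j k hkj => h hkj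

theorem diag_inv_upper {M : Matrix (Fin n) (Fin n) ℂ} (hM : ∀ j k, k < j → M j k = 0)
    (hd : ∀ j, M j j ≠ 0) (j : Fin n) : M⁻¹ j j = (M j j)⁻¹ := by
  have h1 := Matrix.mul_nonsing_inv M (isUnit_det_upper hM hd)
  have h2 := diag_mul_upper hM (upper_inv hM hd) j
  rw [h1, Matrix.one_apply_eq] at h2
  exact eq_inv_of_mul_eq_one_right h2.symm

/-- The linearization of the triangular factorization with equal diagonals is injective. -/
theorem triangular_unique {h k X Y : Matrix (Fin n) (Fin n) ℂ}
    (hh : ∀ i j, j < i → h i j = 0) (hk : ∀ i j, i < j → k i j = 0)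
    (hX : ∀ i j, j < i → X i j = 0) (hY : ∀ i j, i < j → Y i j = 0)
    (hhk : ∀ i, h i i = k i i) (hd : ∀ i, h i i ≠ 0) (hXY : ∀ i, X i i = Y i i)
    (e : X * k + h * Y = 0) : X = 0 ∧ Y = 0 := by
  have uh := isUnit_det_upper hh hd
  have hkt : ∀ i j, j < i → kᵀ i j = 0 := fun i j hij => hk j i hij
  have hdt : ∀ i, kᵀ i i ≠ 0 := fun i => by rw [Matrix.transpose_apply, ← hhk]; exact hd i
  have uk : IsUnit k.det := by rw [← Matrix.det_transpose]; exact isUnit_det_upper hkt hdt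
  have hki : ∀ i j, j < i → (k⁻¹)ᵀ i j = 0 := by
    rw [Matrix.transpose_nonsing_inv]; exact upper_inv hkt hdt
  -- The left side is upper and the right side lower triangular, so both are diagonal. On the
  -- diagonal, equality of the entries of h and k and of X and Y makes the two sides opposite to
  -- each other, hence zero.
  have e1 : h⁻¹ * X = -(Y * k⁻¹) := by
    have h1 : X * k = -(h * Y) := eq_neg_of_add_eq_zero_left e
    have h2 : X = -(h * Y) * k⁻¹ := by
      rw [← h1, Matrix.mul_assoc, Matrix.mul_nonsing_inv _ uk, Matrix.mul_one]
    rw [h2, Matrix.neg_mul, Matrix.mul_neg, Matrix.mul_assoc, ← Matrix.mul_assoc h⁻¹,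
      Matrix.nonsing_inv_mul _ uh, Matrix.one_mul]
  have up := upper_mul (upper_inv hh hd) hX
  have lo : ∀ i j, j < i → ((k⁻¹)ᵀ * Yᵀ) i j = 0 := upper_mul hki (fun i j hij => hY j i hij)
  rw [← Matrix.transpose_mul] at lo
  have z : h⁻¹ * X = 0 := by
    ext i j
    rcases lt_trichotomy i j with hij | rfl | hij
    · rw [e1]; simpa using lo j i hij
    · have h1 := congrFun (congrFun e1 i) i
      have h2 := diag_mul_upper hki (fun i j hij => hY j i hij) (N := Yᵀ) i
      rw [← Matrix.transpose_mul] at h2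
      simp only [Matrix.transpose_apply, Matrix.neg_apply] at h1 h2
      have h3 := diag_inv_upper hkt hdt i
      rw [← Matrix.transpose_nonsing_inv] at h3
      simp only [Matrix.transpose_apply] at h3
      rw [h2, h3, diag_mul_upper (upper_inv hh hd) hX, diag_inv_upper hh hd, hXY, ← hhk] at h1
      have h4 : (h i i)⁻¹ * Y i i = 0 := by linear_combination h1 / 2
      rw [diag_mul_upper (upper_inv hh hd) hX, diag_inv_upper hh hd, hXY, h4]; rfl
    · simpa using up i j hij
  have X0 : X = 0 := by
    have := congrArg (fun M => h * M) z
    simpa [← Matrix.mul_assoc, Matrix.mul_nonsing_inv _ uh] using this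
  refine ⟨X0, ?_⟩
  rw [X0, Matrix.zero_mul, zero_add] at e
  have := congrArg (fun M => h⁻¹ * M) e
  simpa [← Matrix.mul_assoc, Matrix.nonsing_inv_mul _ uh] using this

end Triangular

end Algebra

end SpinPoisson

end

/-! ### Brackets of â, b̂ and of the entries of g_+⁻¹ and g_-ᵀ within one copy -/

noncomputable section

namespace SpinPoisson

section Algebra

variable {R : Type*} [CommRing R]

/-- G_i and G_{i+1} carry the consecutive cutoffs i ≤ j and i + 1 ≤ j in their brackets with a_j.
The product √G_i √G_{i+1} sees the sum of the cutoffs, the ratio on the diagonal of g_+ sees their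
difference. -/
theorem leib_ite {l : ℕ} (i j : Fin l) :
    (if (i : ℕ) ≤ j then (1 : ℂ) else 0) + (if (i : ℕ) + 1 ≤ j then 1 else 0) = sg i j + 1 := by
  unfold sg
  rcases lt_trichotomy i j with h | h | h
  · have h1 : (i : ℕ) + 1 ≤ j := h
    have h2 : (i : ℕ) ≤ j := h.le
    rw [if_pos h1, if_pos h2, if_pos h]
  · subst h; simp
  · have h1 : ¬ (i : ℕ) + 1 ≤ j := by have : (j : ℕ) < i := h; omega
    have h2 : ¬ (i : ℕ) ≤ j := by have : (j : ℕ) < i := h; omega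
    rw [if_neg h1, if_neg h2, if_neg h.not_gt, if_pos h]; ring

theorem leib_ite_sub {l : ℕ} (i j : Fin l) :
    (if (i : ℕ) ≤ j then (1 : ℂ) else 0) - (if (i : ℕ) + 1 ≤ j then 1 else 0)
      = if i = j then 1 else 0 := by
  rcases lt_trichotomy i j with h | h | h
  · have h1 : (i : ℕ) + 1 ≤ j := h
    have h2 : (i : ℕ) ≤ j := h.le
    rw [if_pos h1, if_pos h2, if_neg h.ne]; ring
  · subst h; simp
  · have h1 : ¬ (i : ℕ) + 1 ≤ j := by have : (j : ℕ) < i := h; omega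
    have h2 : ¬ (i : ℕ) ≤ j := by have : (j : ℕ) < i := h; omega
    rw [if_neg h1, if_neg h2, if_neg h.ne']; ring

namespace RootRel

variable {ev : R →+* ℂ} {P : R → R → ℂ} {κ : ℂ} {n : ℕ} {a b : Fin n → R} {s t : ℕ → R}

theorem w_a (hP : IsBider ev P) (h : RootRel ev P κ a b s t) (i j : Fin n) :
    P (t i * t (i + 1)) (a j) = κ / 2 * (sg i j + 1) * (ev (t i) * ev (t (i + 1)) * ev (a j)) := by
  rw [(hP.der_left _).mul, h.t_a hP j i.2.le, h.t_a hP j i.2, ← leib_ite]; ring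

theorem w_b (hP : IsBider ev P) (h : RootRel ev P κ a b s t) (i j : Fin n) :
    P (t i * t (i + 1)) (b j)
      = -κ / 2 * (sg i j + 1) * (ev (t i) * ev (t (i + 1)) * ev (b j)) := by
  rw [(h.swap hP).w_a hP]

theorem w_w (hP : IsBider ev P) (h : RootRel ev P κ a b s t) (i j : Fin n) :
    P (t i * t (i + 1)) (t j * t (j + 1)) = 0 := by
  rw [(hP.der_left _).mul, (hP.der_right _).mul, (hP.der_right _).mul, h.t_t hP i.2.le j.2.le,
    h.t_t hP i.2.le j.2, h.t_t hP i.2 j.2.le, h.t_t hP i.2 j.2]; ring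

/-- The sign in {a_i, a_j} is cancelled by the one coming from the factor 1/√(G_i G_{i+1}). -/
theorem hat_a (hP : IsBider ev P) (h : RootRel ev P κ a b s t) (i j : Fin n) :
    P (hat a t i) (a j) = κ / 2 * (ev (hat a t i) * ev (a j)) := by
  unfold hat
  rw [(hP.der_left _).mul, h.w_a hP, h.aa]; simp only [map_mul]; ring

theorem hatb_b (hP : IsBider ev P) (h : RootRel ev P κ a b s t) (i j : Fin n) :
    P (hat b t i) (b j) = -κ / 2 * (ev (hat b t i) * ev (b j)) := by
  rw [(h.swap hP).hat_a hP]

theorem hat_w (hP : IsBider ev P) (h : RootRel ev P κ a b s t) (i j : Fin n) :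
    P (hat a t i) (t j * t (j + 1)) = -κ / 2 * (sg j i + 1) *
      (ev (hat a t i) * (ev (t j) * ev (t (j + 1)))) := by
  conv_lhs => unfold hat
  rw [(hP.der_left _).mul, h.w_w hP, hP.anti, h.w_a hP]; unfold hat; simp only [map_mul]; ring

/-- The sign is opposite to that of {a_i, a_j}: this is the change from -r in { , }_κ to +r in { ,
}'_κ. -/
theorem hat_hat (hP : IsBider ev P) (h : RootRel ev P κ a b s t) (i j : Fin n) :
    P (hat a t i) (hat a t j) = κ / 2 * sg i j * (ev (hat a t j) * ev (hat a t i)) := by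
  conv_lhs => arg 2; unfold hat
  rw [(hP.der_right _).mul, h.hat_w hP, h.hat_a hP, sg_anti j i]
  unfold hat; simp only [map_mul]; ring

theorem hat_b (hP : IsBider ev P) (h : RootRel ev P κ a b s t) (i j : Fin n) :
    P (hat a t i) (b j) = -κ / 2 * sg i j * (ev (hat a t i) * ev (b j)) +
      if i = j then κ / 2 * (ev (t i) * ev (t (i + 1)) * (ev (s i) ^ 2 + ev (s (i + 1)) ^ 2))
      else 0 := by
  unfold hat
  rw [(hP.der_left _).mul, h.w_b hP, h.ab]
  simp only [map_mul, map_pow]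
  split_ifs with hij <;> ring

theorem hat_hatb (hP : IsBider ev P) (h : RootRel ev P κ a b s t) (i j : Fin n) :
    P (hat a t i) (hat b t j) = -κ / 2 * (ev (hat a t i) * ev (hat b t j)) +
      if i = j then κ / 2 * (ev (t i) ^ 2 + ev (t (i + 1)) ^ 2) else 0 := by
  conv_lhs => arg 2; unfold hat
  rw [(hP.der_right _).mul, h.hat_w hP, h.hat_b hP, sg_anti j i]
  unfold hat; simp only [map_mul]
  split_ifs with hij
  · subst hij
    have h0 := h.ev_st i.2.le
    have h1 := h.ev_st (j := i + 1) i.2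
    linear_combination (κ / 2 * ev (t (i + 1)) ^ 2) * (ev (s i) * ev (t i) + 1) * h0
      + (κ / 2 * ev (t i) ^ 2) * (ev (s (i + 1)) * ev (t (i + 1)) + 1) * h1
  · ring

theorem diag_a (hP : IsBider ev P) (h : RootRel ev P κ a b s t) (i j : Fin n) :
    P (s (i + 1) * t i) (a j)
      = κ / 2 * (if i = j then 1 else 0) * (ev (s (i + 1) * t i) * ev (a j)) := by
  rw [(hP.der_left _).mul, h.t_a hP j i.2.le, h.s_a hP j i.2, ← leib_ite_sub, map_mul]; ring

theorem diag_hat (hP : IsBider ev P) (h : RootRel ev P κ a b s t) (i j : Fin n) :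
    P (s (i + 1) * t i) (hat a t j)
      = κ / 2 * (if i = j then 1 else 0) * (ev (s (i + 1) * t i) * ev (hat a t j)) := by
  have h1 : P (s (i + 1) * t i) (t j * t (j + 1)) = 0 := by
    rw [(hP.der_left _).mul, (hP.der_right _).mul, (hP.der_right _).mul, h.t_t hP i.2.le j.2.le,
      h.t_t hP i.2.le j.2, hP.anti (s _) (t j), h.t_s hP j.2.le (show (i : ℕ) + 1 ≤ n from i.2),
      hP.anti (s _) (t _),
      h.t_s hP (show (j : ℕ) + 1 ≤ n from j.2) (show (i : ℕ) + 1 ≤ n from i.2)]; ring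
  unfold hat
  rw [(hP.der_right _).mul, h.diag_a hP, h1]; simp only [map_mul]; ring

/-- With `h_hatb`, this is the explicit input from which `h_h_and_h_k` deduces the brackets among
the matrix entries themselves. The delicate case is i < p = j, where the inhomogeneous term of {â_j,
b_j} produces the diagonal entry of h. -/
theorem h_hat (hP : IsBider ev P) (h : RootRel ev P κ a b s t) (i p j : Fin n) :
    P (hMat a b s t i p) (hat a t j)
      = κ * rho i j * (ev (hMat a b s t j p) * ev (hat a t i)) := by
  rcases lt_trichotomy i p with hip | rfl | hip
  · rw [RootData.hMat_upper _ _ _ _ hip, (hP.der_left _).neg, (hP.der_left _).mul, h.hat_hat hP,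
      hP.anti (b p), h.hat_b hP]
    rcases lt_trichotomy j p with hjp | rfl | hjp
    · rw [RootData.hMat_upper _ _ _ _ hjp, if_neg hjp.ne, sg_eq_rho i j,
        show sg j p = 1 by simp [sg, hjp]]
      have := rho_add i j
      simp only [map_neg, map_mul]
      linear_combination (κ / 2 * ev (hat a t i) * ev (hat a t j) * ev (b p)) * this
    · rw [RootData.hMat_diag]
      have h0 := h.ev_st j.2.le
      have h1 := h.ev_st (j := j + 1) j.2
      have h2 := h.ev_step j
      simp only [sg, rho, hip, lt_irrefl, if_true, if_false]
      unfold hat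
      simp only [map_mul]
      linear_combination (κ * ev (t i) * ev (t (i + 1)) * ev (a i)) * (
        (1 / 2) * ev (t j) * ev (t (j+1)) * h2 + ev (t j) * ev (s (j+1)) * h1)
    · rw [RootData.hMat_lower _ _ _ _ hjp, if_neg hjp.ne']
      simp only [sg, hip.trans hjp, hjp, hjp.not_gt, if_true, if_false, map_zero]
      ring
  · rw [RootData.hMat_diag, h.diag_hat hP]
    rcases lt_trichotomy i j with hij | rfl | hij
    · rw [RootData.hMat_lower _ _ _ _ hij, if_neg hij.ne]; simp
    · rw [RootData.hMat_diag, if_pos rfl]; simp only [rho, lt_irrefl, if_false]; ring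
    · simp [rho, hij, hij.ne', hij.not_gt]
  · rw [RootData.hMat_lower _ _ _ _ hip, (hP.der_left _).zero]
    rcases lt_or_ge j i with hji | hji
    · simp [rho, hji, hji.not_gt]
    · rw [RootData.hMat_lower _ _ _ _ (hip.trans_le hji)]; simp

/-- `rho_sum` turns the weighted sum into an average of two tails, each known from `tail_hat_hMat`;
the closed form lets `h_hatb` be settled by cases. -/
theorem rho_hatb_h (h : RootRel ev P κ a b s t) (i p : Fin n) :
    ∑ l, rho i l * (ev (hat b t l) * ev (hMat a b s t l p)) =
      ((if (i : ℕ) ≤ p then ev (b p) * ev (t i) ^ 2 else 0)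
        + (if (i : ℕ) + 1 ≤ p then ev (b p) * ev (t (i + 1)) ^ 2 else 0)) / 2 := by
  have key : ∀ j ≤ n, tail (fun l => ev (hat b t l) * ev (hMat a b s t l p)) j
      = if j ≤ p then ev (b p) * ev (t j) ^ 2 else 0 := by
    intro j hj
    have := congrArg ev (h.data.tail_hat_hMat p hj)
    simp only [tail, map_sum, apply_ite ev, map_mul, map_zero, map_pow] at this
    exact this
  rw [rho_sum (fun l => ev (hat b t l) * ev (hMat a b s t l p)), key _ i.2.le, key _ i.2]

theorem h_hatb (hP : IsBider ev P) (h : RootRel ev P κ a b s t) (i p j : Fin n) :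
    P (hMat a b s t i p) (hat b t j)
      = -κ * (if i = j then ∑ l, rho i l * (ev (hat b t l) * ev (hMat a b s t l p)) else 0) := by
  rw [h.rho_hatb_h]
  rcases lt_trichotomy i p with hip | rfl | hip
  · rw [RootData.hMat_upper _ _ _ _ hip, (hP.der_left _).neg, (hP.der_left _).mul, h.hat_hatb hP,
      hP.anti (b p), h.hatb_b hP, if_pos (show (i : ℕ) ≤ p from hip.le),
      if_pos (show (i : ℕ) + 1 ≤ p from hip)]
    split_ifs <;> ring
  · rw [RootData.hMat_diag, (h.swap hP).diag_hat hP, if_pos le_rfl,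
      if_neg (show ¬ (i : ℕ) + 1 ≤ i by omega)]
    by_cases hij : i = j
    · subst hij
      rw [if_pos rfl, if_pos rfl]
      have h1 := h.ev_st (j := i + 1) i.2
      unfold hat
      simp only [map_mul]
      linear_combination (-κ / 2 * ev (b i) * ev (t i) ^ 2) * h1
    · rw [if_neg hij, if_neg hij]; ring
  · have h1 : ¬ (i : ℕ) ≤ p := not_le.2 hip
    have h2 : ¬ (i : ℕ) + 1 ≤ p := by omega
    rw [RootData.hMat_lower _ _ _ _ hip, (hP.der_left _).zero, if_neg h1, if_neg h2]
    simp

theorem ev_one_sub (h : RootRel ev P κ a b s t) (i j : Fin n) :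
    ∑ l, ev (hMat a b s t i l) * ev (hMat b a s t j l)
      = (if i = j then 1 else 0) - ev (hat a t i) * ev (hat b t j) := by
  have := congrArg ev (h.data.one_sub_hat i j)
  simp only [map_sum, map_mul, map_sub, apply_ite ev, map_one, map_zero] at this
  exact this

/-- Let D = {h_ip, ·}. Applying D to h kᵀ = 1 - â b̂ᵀ gives (Dh) kᵀ + h D(kᵀ) in terms of brackets
already known. The claimed expressions satisfy the same equation, so the errors `X` in Dh and `Y` in
D(kᵀ) solve the homogeneous one; both are triangular with equal diagonals and vanish by
`triangular_unique`. -/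
theorem h_h_and_h_k (hP : IsBider ev P) (h : RootRel ev P κ a b s t) (i p : Fin n) :
    (∀ j q, P (hMat a b s t i p) (hMat a b s t j q) = κ / 2 * (sg i j + sg p q) *
      (ev (hMat a b s t j p) * ev (hMat a b s t i q))) ∧
    ∀ q j, P (hMat a b s t i p) (hMat b a s t j q) = κ * (
      (if p = q then ∑ r, ev (hMat a b s t i r) * rho r p * ev (hMat b a s t j r) else 0)
      - (if i = j then ∑ r, ev (hMat b a s t r q) * rho i r * ev (hMat a b s t r p) else 0)) := by
  set H : Matrix (Fin n) (Fin n) ℂ := Matrix.of fun i p => ev (hMat a b s t i p) with hH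
  set K : Matrix (Fin n) (Fin n) ℂ := Matrix.of fun q j => ev (hMat b a s t j q) with hK
  set X : Matrix (Fin n) (Fin n) ℂ := Matrix.of fun j q => P (hMat a b s t i p) (hMat a b s t j q)
    - κ / 2 * (sg i j + sg p q) * (H j p * H i q) with hX
  set Y : Matrix (Fin n) (Fin n) ℂ := Matrix.of fun q j => P (hMat a b s t i p) (hMat b a s t j q)
    - κ * ((if p = q then ∑ r, H i r * rho r p * K r j else 0)
      - (if i = j then ∑ r, K q r * rho i r * H r p else 0)) with hY
  have hD := hP.der_right (hMat a b s t i p)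
  have Hlow : ∀ i j, j < i → H i j = 0 := fun i j hij => by
    simp [hH, RootData.hMat_lower _ _ _ _ hij]
  have Kup : ∀ i j, i < j → K i j = 0 := fun i j hij => by
    simp [hK, RootData.hMat_lower _ _ _ _ hij]
  have HK : ∀ i, H i i = K i i := fun i => by simp [hH, hK, RootData.hMat_diag]
  have Hne : ∀ i, H i i ≠ 0 := fun i => by
    simp only [hH, Matrix.of_apply, RootData.hMat_diag, map_mul, h.ev_t i.2.le]
    exact mul_ne_zero (h.ev_s_ne i.2) (inv_ne_zero (h.ev_s_ne i.2.le))
  have key : X = 0 ∧ Y = 0 := by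
    refine triangular_unique Hlow Kup ?_ ?_ HK Hne ?_ ?_
    · intro j q hqj
      simp only [hX, Matrix.of_apply, RootData.hMat_lower _ _ _ _ hqj, hD.zero]
      -- The product of entries of h is nonzero only if j ≤ p and i ≤ q; with q < j this forces i <
      -- j and q < p, and then the two signs cancel.
      by_cases h1 : j ≤ p
      · by_cases h2 : i ≤ q
        · have h3 : i < j := h2.trans_lt hqj
          have h4 : q < p := hqj.trans_le h1
          simp [sg, h3, h4, h4.not_gt]
        · rw [Hlow i q (not_le.1 h2)]; ring
      · rw [Hlow j p (not_le.1 h1)]; ring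
    · intro q j hqj
      simp only [hY, Matrix.of_apply, RootData.hMat_lower _ _ _ _ hqj, hD.zero]
      have e1 : (if p = q then ∑ r, H i r * rho r p * K r j else 0) = 0 := by
        split_ifs with hpq
        · subst hpq
          refine Finset.sum_eq_zero fun r _ => ?_
          rcases lt_or_ge r j with h1 | h1
          · rw [Kup r j h1, mul_zero]
          · have h2 : p < r := hqj.trans_le h1
            simp [rho, h2, h2.not_gt]
        · rfl
      have e2 : (if i = j then ∑ r, K q r * rho i r * H r p else 0) = 0 := by
        split_ifs with hij
        · subst hij
          refine Finset.sum_eq_zero fun r _ => ?_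
          rcases lt_or_ge q r with h1 | h1
          · rw [Kup q r h1, zero_mul, zero_mul]
          · have h2 : r < i := h1.trans_lt hqj
            simp [rho, h2, h2.not_gt]
        · rfl
      rw [e1, e2]; ring
    · intro j
      -- The diagonal entries of h and k are the same ring elements, so only the claimed expressions
      -- have to be compared. Triangularity leaves one term in each of the two sums.
      simp only [hX, hY, Matrix.of_apply, RootData.hMat_diag]
      congr 1
      have e1 : ∑ r, H i r * rho r p * K r p = H i p * (1 / 2) * K p p := by
        refine (Finset.sum_eq_single p (fun r _ hr => ?_) (by simp)).trans (by simp [rho])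
        rcases lt_or_gt_of_ne hr with h1 | h1
        · rw [Kup r p h1, mul_zero]
        · simp [rho, h1, h1.not_gt]
      have e2 : ∑ r, K i r * rho i r * H r p = K i i * (1 / 2) * H i p := by
        refine (Finset.sum_eq_single i (fun r _ hr => ?_) (by simp)).trans (by simp [rho])
        rcases lt_or_gt_of_ne hr with h1 | h1
        · simp [rho, h1, h1.not_gt]
        · rw [Kup i r h1, zero_mul, zero_mul]
      by_cases hpj : p = j
      · subst hpj
        rw [if_pos rfl, e1]
        by_cases hip : i = p
        · subst hip
          rw [if_pos rfl, e2, HK]; simp [sg]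
        · rw [if_neg hip, ← HK]
          rcases lt_or_gt_of_ne hip with h1 | h1
          · simp [sg, h1]; ring
          · simp [Hlow i p h1]
      · rw [if_neg hpj]
        by_cases hij : i = j
        · subst hij
          rw [if_pos rfl, e2, ← HK]
          rcases lt_or_gt_of_ne hpj with h1 | h1
          · simp [Hlow i p h1]
          · simp [sg, h1, h1.not_gt]; ring
        · rw [if_neg hij]
          rcases lt_or_gt_of_ne hij with h1 | h1
          · rcases lt_or_gt_of_ne hpj with h2 | h2
            · simp [Hlow j p h2]
            · simp [sg, h1, h2, h2.not_gt]
          · simp [Hlow i j h1]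
    · ext j m
      have M : ∀ x y, ∑ l, H x l * K l y = (if x = y then 1 else 0)
          - ev (hat a t x) * ev (hat b t y) := fun x y => h.ev_one_sub x y
      -- The differentiated factorization identity; `c1`, `c2` and `c4` evaluate what the claimed
      -- brackets contribute to it.
      have d1 : ∑ l, (H j l * P (hMat a b s t i p) (hMat b a s t m l)
          + K l m * P (hMat a b s t i p) (hMat a b s t j l))
          = -(ev (hat a t j) * P (hMat a b s t i p) (hat b t m)
            + ev (hat b t m) * P (hMat a b s t i p) (hat a t j)) := by
        have := congrArg (P (hMat a b s t i p)) (h.data.one_sub_hat j m)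
        rw [hD.sum, hD.sub, hD.mul] at this
        simp only [hD.mul] at this
        rw [show P (hMat a b s t i p) (if j = m then 1 else 0) = 0 by
          split_ifs; exacts [hD.one, hD.zero], zero_sub] at this
        exact this
      rw [h.h_hat hP, h.h_hatb hP] at d1
      have c1 : ∑ l, κ / 2 * (sg i j + sg p l) * (H j p * H i l) * K l m
          = κ / 2 * H j p * (sg i j * ∑ l, H i l * K l m)
            + κ / 2 * H j p * ∑ l, sg p l * (H i l * K l m) := by
        simp only [Finset.mul_sum, ← Finset.sum_add_distrib]
        exact Finset.sum_congr rfl fun l _ => by ring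
      have c2 : ∑ l, H j l * (κ * ((if p = l then ∑ r, H i r * rho r p * K r m else 0)
          - (if i = m then ∑ r, K l r * rho i r * H r p else 0)))
          = κ * H j p * ∑ r, rho r p * (H i r * K r m)
            - κ * if i = m then ∑ r, rho i r * ((∑ l, H j l * K l r) * H r p) else 0 := by
        have : ∀ l, H j l * (κ * ((if p = l then ∑ r, H i r * rho r p * K r m else 0)
          - (if i = m then ∑ r, K l r * rho i r * H r p else 0)))
          = (if p = l then κ * H j l * ∑ r, H i r * rho r p * K r m else 0)
          - κ * if i = m then ∑ r, H j l * (K l r * rho i r * H r p) else 0 := by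
          intro l
          rw [← Finset.mul_sum]
          split_ifs <;> ring
        simp only [this]
        rw [Finset.sum_sub_distrib, Finset.sum_ite_eq, if_pos (Finset.mem_univ _),
          ← Finset.mul_sum]
        congr 1
        · congr 1
          exact Finset.sum_congr rfl fun r _ => by ring
        · congr 1
          split_ifs with him
          · rw [Finset.sum_comm]
            refine Finset.sum_congr rfl fun r _ => ?_
            rw [Finset.sum_mul, Finset.mul_sum]
            exact Finset.sum_congr rfl fun l _ => by ring
          · simp
      -- The weights combine to 1/2 because sg_pl / 2 + rho_lp = 1/2, so the sum becomes an entry of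
      -- h kᵀ.
      have c3 : κ / 2 * H j p * ∑ l, sg p l * (H i l * K l m)
          + κ * H j p * ∑ r, rho r p * (H i r * K r m)
          = κ / 2 * H j p * ∑ l, H i l * K l m := by
        simp only [Finset.mul_sum, ← Finset.sum_add_distrib]
        refine Finset.sum_congr rfl fun l _ => ?_
        have := rho_add p l
        rw [sg_eq_rho]
        linear_combination (κ / 2 * H j p * (H i l * K l m)) * this
      have c4 : ∑ r, rho i r * ((∑ l, H j l * K l r) * H r p)
          = rho i j * H j p - ev (hat a t j) * ∑ r, rho i r * (ev (hat b t r) * H r p) := by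
        simp only [M, sub_mul, mul_sub, Finset.sum_sub_distrib]
        congr 1
        · simp
        · rw [Finset.mul_sum]
          exact Finset.sum_congr rfl fun l _ => by ring
      have lhs : (X * K + H * Y) j m = ∑ l, (H j l * P (hMat a b s t i p) (hMat b a s t m l)
          + K l m * P (hMat a b s t i p) (hMat a b s t j l))
          - ∑ l, κ / 2 * (sg i j + sg p l) * (H j p * H i l) * K l m
          - ∑ l, H j l * (κ * ((if p = l then ∑ r, H i r * rho r p * K r m else 0)
          - (if i = m then ∑ r, K l r * rho i r * H r p else 0))) := by
        simp only [Matrix.add_apply, Matrix.mul_apply, ← Finset.sum_add_distrib,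
          ← Finset.sum_sub_distrib]
        refine Finset.sum_congr rfl fun l _ => ?_
        simp only [hX, hY, Matrix.of_apply]
        ring
      rw [lhs, d1, c1, c2, c4]
      rw [M] at c3 ⊢
      have hHjp : ev (hMat a b s t j p) = H j p := rfl
      have hHr : ∀ r, ev (hMat a b s t r p) = H r p := fun _ => rfl
      simp only [hHr]
      have hs : sg i j + 1 = 2 * rho i j := by
        rw [sg_eq_rho]; linear_combination -rho_add i j
      rw [Matrix.zero_apply]
      by_cases him : i = m
      · subst him
        simp only [if_true] at c3 ⊢
        linear_combination -c3 - κ / 2 * H j p * (1 - ev (hat a t i) * ev (hat b t i)) * hs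
      · simp only [if_neg him] at c3 ⊢
        linear_combination -c3 + κ / 2 * H j p * (ev (hat a t i) * ev (hat b t m)) * hs
  constructor
  · intro j q
    have := congrFun (congrFun key.1 j) q
    exact sub_eq_zero.1 this
  · intro q j
    have := congrFun (congrFun key.2 q) j
    exact sub_eq_zero.1 this

end RootRel

end Algebra

end SpinPoisson

end

/-! ### The induction step: appending one copy -/

noncomputable section

namespace SpinPoisson

section Algebra

variable {R : Type*} [CommRing R]

/-- The brackets `{ , }'_κ` of the entries `A_{iα}` and `B_{αi}`, for matrices `A`, `B` over `R`
given by the columns of `A` and the rows of `B`. -/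
structure SpinRel (ev : R →+* ℂ) (P : R → R → ℂ) (κ : ℂ) {n d : ℕ} (A B : Fin d → Fin n → R) :
    Prop where
  aa : ∀ α β i j, P (A α i) (A β j)
    = κ / 2 * (sg i j + sg α β) * (ev (A α j) * ev (A β i))
  bb : ∀ α β i j, P (B α i) (B β j)
    = -κ / 2 * (sg i j + sg α β) * (ev (B α j) * ev (B β i))
  ab : ∀ α β i j, P (A α i) (B β j) = κ * (
    -(if i = j then ∑ l, rho i l * (ev (A α l) * ev (B β l)) else 0)
    - (if α = β then ∑ γ, rho α γ * (ev (A γ i) * ev (B γ j)) else 0)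
    + if i = j then if α = β then 1 else 0 else 0)

section Kill

variable {ev : R →+* ℂ} {D : R → ℂ} {n : ℕ} {a b : Fin n → R} {s t : ℕ → R}

namespace RootData

theorem ev_st (h : RootData a b s t) (ev : R →+* ℂ) {j : ℕ} (hj : j ≤ n) :
    ev (s j) * ev (t j) = 1 := by rw [← map_mul, h.st j hj, map_one]

theorem der_s_eq_zero (h : RootData a b s t) (hD : IsDer ev D)
    {j : ℕ} (hj : j ≤ n) (h0 : D (s j ^ 2) = 0) : D (s j) = 0 := by
  rw [hD.sq] at h0
  have := left_ne_zero_of_mul_eq_one (h.ev_st ev hj)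
  exact (mul_eq_zero.1 h0).resolve_left (mul_ne_zero two_ne_zero this)

theorem der_t_eq_zero (h : RootData a b s t) (hD : IsDer ev D)
    {j : ℕ} (hj : j ≤ n) (h0 : D (s j) = 0) : D (t j) = 0 := by
  rw [hD.of_mul_eq_one (h.st j hj), h0]; simp

/-- A derivation that kills a and b kills G_j, hence its root because 2 s_j is nonzero. The
consequences below show that everything formed from one copy commutes with the other copies. -/
theorem kill_s (h : RootData a b s t) (hD : IsDer ev D) (ha : ∀ i, D (a i) = 0)
    (hb : ∀ i, D (b i) = 0) {j : ℕ} (hj : j ≤ n) : D (s j) = 0 := by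
  refine h.der_s_eq_zero hD hj ?_
  induction hj using Nat.decreasingInduction with
  | self => rw [h.last, hD.one]
  | of_succ k hk ih =>
    rw [show s k ^ 2 = _ from h.step ⟨k, hk⟩, hD.add, ih, hD.mul, ha, hb]; simp

theorem kill_t (h : RootData a b s t) (hD : IsDer ev D) (ha : ∀ i, D (a i) = 0)
    (hb : ∀ i, D (b i) = 0) {j : ℕ} (hj : j ≤ n) : D (t j) = 0 :=
  h.der_t_eq_zero hD hj (h.kill_s hD ha hb hj)

theorem kill_hat (h : RootData a b s t) (hD : IsDer ev D) (ha : ∀ i, D (a i) = 0)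
    (hb : ∀ i, D (b i) = 0) (i : Fin n) : D (hat a t i) = 0 := by
  unfold hat
  rw [hD.mul, hD.mul, ha, h.kill_t hD ha hb i.2.le, h.kill_t hD ha hb i.2]; simp

theorem kill_hMat (h : RootData a b s t) (hD : IsDer ev D) (ha : ∀ i, D (a i) = 0)
    (hb : ∀ i, D (b i) = 0) (i p : Fin n) : D (hMat a b s t i p) = 0 := by
  rcases lt_trichotomy i p with hip | rfl | hip
  · rw [hMat_upper _ _ _ _ hip, hD.neg, hD.mul, hb, h.kill_hat hD ha hb]; simp
  · rw [hMat_diag, hD.mul, h.kill_t hD ha hb i.2.le, h.kill_s hD ha hb i.2]; simp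
  · rw [hMat_lower _ _ _ _ hip, hD.zero]

theorem step_hat (h : RootData a b s t) (i : Fin n) :
    t i ^ 2 + hat a t i * hat b t i = t (i + 1) ^ 2 := by
  have h0 := h.st i i.2.le
  have h1 := h.st (i + 1) i.2
  have h3 := h.step i
  have h4 : t i ^ 2 * s i ^ 2 = 1 := by linear_combination (s i * t i + 1) * h0
  have h5 : t (i+1) ^ 2 * s (i+1) ^ 2 = 1 := by
    linear_combination (s (i+1) * t (i+1) + 1) * h1
  unfold hat
  linear_combination (t (i + 1) ^ 2) * h4 - (t i ^ 2) * h5 - (t i ^ 2 * t (i + 1) ^ 2) * h3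

theorem last_t (h : RootData a b s t) : t n ^ 2 = 1 := by
  have h0 := h.st n le_rfl
  linear_combination (s n * t n + 1) * h0 - (t n ^ 2) * h.last

/-- By `step_hat` the products â_i b̂_i are the increments of 1/G_j, and 1/G_n = 1. -/
theorem tail_hat_hat (h : RootData a b s t) {j : ℕ} (hj : j ≤ n) :
    tail (fun i => hat a t i * hat b t i) j = 1 - t j ^ 2 := by
  induction hj using Nat.decreasingInduction with
  | self => rw [tail_last, h.last_t, sub_self]
  | of_succ k hk ih =>
    have := h.step_hat ⟨k, hk⟩
    have h2 := tail_step (fun i => hat a t i * hat b t i) ⟨k, hk⟩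
    simp only at this h2
    rw [h2, ih]; linear_combination this

end RootData

end Kill

section Step

variable {ev : R →+* ℂ} {P : R → R → ℂ} {κ : ℂ} {n d : ℕ}

theorem SpinRel.swap (hP : IsBider ev P) {A B : Fin d → Fin n → R} (h : SpinRel ev P κ A B) :
    SpinRel ev P (-κ) B A where
  aa := h.bb
  bb α β i j := by rw [h.aa, neg_neg]
  ab α β i j := by
    rw [hP.anti, h.ab]
    simp only [eq_comm (a := j), eq_comm (a := β), mul_comm (ev (A _ _))]
    by_cases hij : i = j
    · subst hij
      by_cases hαβ : α = β
      · subst hαβ; simp only [if_true]; ring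
      · simp only [if_true, if_neg hαβ]; ring
    · by_cases hαβ : α = β
      · subst hαβ; simp only [if_true, if_neg hij]; ring
      · simp only [if_neg hij, if_neg hαβ]; ring

/-- The vanishing brackets are those between the new copy and the old vectors, so no mixed terms
survive. -/
theorem IsBider.sum_mul_sum (hP : IsBider ev P) {u v x y : Fin n → R}
    (huy : ∀ p q, P (u p) (y q) = 0) (hvx : ∀ p q, P (v p) (x q) = 0) :
    P (∑ p, u p * v p) (∑ q, x q * y q) = ∑ p, ∑ q,
      (P (u p) (x q) * (ev (v p) * ev (y q)) + ev (u p) * ev (x q) * P (v p) (y q)) := by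
  rw [(hP.der_left _).sum]
  refine Finset.sum_congr rfl fun p _ => ?_
  rw [(hP.der_right _).sum]
  refine Finset.sum_congr rfl fun q _ => ?_
  rw [(hP.der_left _).mul, (hP.der_right _).mul, (hP.der_right _).mul, huy, hvx]; ring

/-- Left multiplication of the vectors `A α` by the matrix `h`. -/
def act (h : Matrix (Fin n) (Fin n) R) (A : Fin d → Fin n → R) (α : Fin d) (i : Fin n) : R :=
  ∑ p, h i p * A α p

theorem ev_act (ev : R →+* ℂ) (h : Matrix (Fin n) (Fin n) R) (A : Fin d → Fin n → R)
    (α : Fin d) (i : Fin n) : ev (act h A α i) = ∑ p, ev (h i p) * ev (A α p) := by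
  simp [act]

variable {a b : Fin n → R} {s t : ℕ → R}

/-- Multiplication by h is compatible with the brackets because the sign sg_pq of the column indices
in {h, h} cancels the sign of the component indices in {A, A}. What remains is sg_ij from h and
sg_αβ from A. -/
theorem step_aa (hP : IsBider ev P) (h : RootRel ev P κ a b s t) {A B : Fin d → Fin n → R}
    (hAB : SpinRel ev P κ A B) (hAa : ∀ α i j, P (A α i) (a j) = 0)
    (hAb : ∀ α i j, P (A α i) (b j) = 0) (α β : Fin d) (i j : Fin n) :
    P (act (hMat a b s t) A α i) (act (hMat a b s t) A β j)
      = κ / 2 * (sg i j + sg α β) *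
        (ev (act (hMat a b s t) A α j) * ev (act (hMat a b s t) A β i)) := by
  have hAh : ∀ α q i p, P (A α q) (hMat a b s t i p) = 0 := fun α q i p =>
    h.data.kill_hMat (hP.der_right _) (hAa α q) (hAb α q) i p
  rw [ev_act, ev_act]
  unfold act
  rw [hP.sum_mul_sum (fun p q => by rw [hP.anti, hAh, neg_zero]) (fun p q => hAh _ _ _ _)]
  simp only [(h.h_h_and_h_k hP _ _).1, hAB.aa, Finset.sum_add_distrib]
  -- The names p and q are exchanged in one of the two sums, so that the same product of entries
  -- stands in both and the signs sg_pq and sg_qp meet.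
  rw [← add_comm, Finset.sum_comm, ← Finset.sum_add_distrib, Finset.sum_mul_sum, Finset.mul_sum]
  refine Finset.sum_congr rfl fun p _ => ?_
  rw [← Finset.sum_add_distrib, Finset.mul_sum]
  refine Finset.sum_congr rfl fun q _ => ?_
  rw [sg_anti q p]; ring

/-- The coefficient sg_ij + 1 is the one required of an old column against the new one, since the
new index is the largest. -/
theorem step_a_hat (hP : IsBider ev P) (h : RootRel ev P κ a b s t) {A : Fin d → Fin n → R}
    (hAa : ∀ α i j, P (A α i) (a j) = 0)
    (hAb : ∀ α i j, P (A α i) (b j) = 0) (α : Fin d) (i j : Fin n) :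
    P (act (hMat a b s t) A α i) (hat a t j)
      = κ / 2 * (sg i j + 1) * (ev (act (hMat a b s t) A α j) * ev (hat a t i)) := by
  rw [ev_act]
  unfold act
  rw [(hP.der_left _).sum, Finset.sum_mul, Finset.mul_sum]
  refine Finset.sum_congr rfl fun p _ => ?_
  rw [(hP.der_left _).mul, h.data.kill_hat (hP.der_right _) (hAa α p) (hAb α p), h.h_hat hP,
    sg_eq_rho]
  have := rho_add i j
  linear_combination (κ / 2 * ev (A α p) * ev (hMat a b s t j p) * ev (hat a t i)) * this

theorem step_a_hatb (hP : IsBider ev P) (h : RootRel ev P κ a b s t) {A : Fin d → Fin n → R}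
    (hAa : ∀ α i j, P (A α i) (a j) = 0)
    (hAb : ∀ α i j, P (A α i) (b j) = 0) (α : Fin d) (i j : Fin n) :
    P (act (hMat a b s t) A α i) (hat b t j) = -κ * (if i = j then
      ∑ l, rho i l * (ev (act (hMat a b s t) A α l) * ev (hat b t l)) else 0) := by
  simp only [ev_act]
  unfold act
  rw [(hP.der_left _).sum]
  have : ∀ p, P (hMat a b s t i p * A α p) (hat b t j) = -κ * (if i = j then
      ∑ l, rho i l * (ev (hat b t l) * ev (hMat a b s t l p)) * ev (A α p) else 0) := fun p => by
    rw [(hP.der_left _).mul, h.data.swap.kill_hat (hP.der_right _) (hAb α p) (hAa α p),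
      h.h_hatb hP, ← Finset.sum_mul]
    split_ifs <;> ring
  simp only [this]
  split_ifs with hij
  · rw [← Finset.mul_sum, Finset.sum_comm]
    congr 1
    refine Finset.sum_congr rfl fun l _ => ?_
    rw [Finset.sum_mul, Finset.mul_sum]
    exact Finset.sum_congr rfl fun p _ => by ring
  · simp

/-- Two effects combine. The first sum in {h, k} cancels the sum over components in {A, B} (`e1`),
and the constant term of {A, B} becomes an entry of h kᵀ = 1 - â b̂ᵀ. The resulting -â b̂ᵀ is the
contribution of the new copy to the sum over column indices. -/
theorem step_ab (hP : IsBider ev P) (h : RootRel ev P κ a b s t) {A B : Fin d → Fin n → R}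
    (hAB : SpinRel ev P κ A B) (hAa : ∀ α i j, P (A α i) (a j) = 0)
    (hAb : ∀ α i j, P (A α i) (b j) = 0) (hBa : ∀ α i j, P (B α i) (a j) = 0)
    (hBb : ∀ α i j, P (B α i) (b j) = 0) (α β : Fin d) (i j : Fin n) :
    P (act (hMat a b s t) A α i) (act (hMat b a s t) B β j) = κ * (
      -(if i = j then ∑ l, rho i l *
        (ev (act (hMat a b s t) A α l) * ev (act (hMat b a s t) B β l)) else 0)
      - (if α = β then ∑ γ, rho α γ *
        (ev (act (hMat a b s t) A γ i) * ev (act (hMat b a s t) B γ j)) else 0)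
      + if α = β then (if i = j then 1 else 0) - ev (hat a t i) * ev (hat b t j) else 0) := by
  have hAk : ∀ α q i p, P (A α q) (hMat b a s t i p) = 0 := fun α q i p =>
    h.data.swap.kill_hMat (hP.der_right _) (hAb α q) (hAa α q) i p
  have hBh : ∀ α q i p, P (B α q) (hMat a b s t i p) = 0 := fun α q i p =>
    h.data.kill_hMat (hP.der_right _) (hBa α q) (hBb α q) i p
  rw [← h.ev_one_sub]
  simp only [ev_act]
  unfold act
  rw [hP.sum_mul_sum (fun p q => by rw [hP.anti, hBh, neg_zero]) (fun p q => hAk _ _ _ _)]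
  simp only [(h.h_h_and_h_k hP _ _).2, hAB.ab]
  set H : Fin n → Fin n → ℂ := fun i p => ev (hMat a b s t i p) with hH
  set K : Fin n → Fin n → ℂ := fun i p => ev (hMat b a s t i p) with hK
  have hHe : ∀ i p, ev (hMat a b s t i p) = H i p := fun _ _ => rfl
  have hKe : ∀ i p, ev (hMat b a s t i p) = K i p := fun _ _ => rfl
  simp only [hHe, hKe]
  have e1 : ∑ p, ∑ q, (if p = q then ∑ r, H i r * rho r p * K j r else 0)
      * (ev (A α p) * ev (B β q))
      = ∑ p, ∑ q, H i p * K j q * (if p = q then ∑ l, rho p l * (ev (A α l) * ev (B β l)) else 0) := by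
    simp only [ite_mul, mul_ite, zero_mul, mul_zero, Finset.sum_ite_eq, Finset.mem_univ, if_true,
      Finset.sum_mul, Finset.mul_sum]
    rw [Finset.sum_comm]
    exact Finset.sum_congr rfl fun p _ => Finset.sum_congr rfl fun q _ => by ring
  have e2 : ∑ p, ∑ q, (if i = j then ∑ r, K r q * rho i r * H r p else 0)
      * (ev (A α p) * ev (B β q))
      = if i = j then ∑ l, rho i l * ((∑ p, H l p * ev (A α p)) * ∑ q, K l q * ev (B β q))
        else 0 := by
    split_ifs with hij
    · symm
      simp_rw [Finset.sum_mul_sum, Finset.mul_sum]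
      rw [Finset.sum_comm]
      refine Finset.sum_congr rfl fun p _ => ?_
      rw [Finset.sum_comm]
      refine Finset.sum_congr rfl fun q _ => ?_
      rw [Finset.sum_mul]
      exact Finset.sum_congr rfl fun r _ => by ring
    · simp
  have e3 : ∑ p, ∑ q, H i p * K j q * (if α = β then ∑ γ, rho α γ * (ev (A γ p) * ev (B γ q)) else 0)
      = if α = β then ∑ γ, rho α γ * ((∑ p, H i p * ev (A γ p)) * ∑ q, K j q * ev (B γ q))
        else 0 := by
    split_ifs with hij
    · symm
      simp_rw [Finset.sum_mul_sum, Finset.mul_sum]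
      rw [Finset.sum_comm]
      refine Finset.sum_congr rfl fun p _ => ?_
      rw [Finset.sum_comm]
      refine Finset.sum_congr rfl fun q _ => ?_
      exact Finset.sum_congr rfl fun r _ => by ring
    · simp
  have e4 : ∑ p, ∑ q, H i p * K j q * (if p = q then if α = β then 1 else 0 else 0)
      = if α = β then ∑ l, H i l * K j l else 0 := by
    split_ifs with hij <;> simp
  rw [← e2, ← e3, ← e4]
  have : ∀ x y z w u X : ℂ, x = y → X = κ * x - κ * z - κ * y - κ * w + κ * u →
    X = κ * (-z - w + u) := by
    intro x y z w u X h1 h2; rw [h2, h1]; ring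
  refine this _ _ _ _ _ _ e1 ?_
  simp only [Finset.mul_sum, ← Finset.sum_add_distrib, ← Finset.sum_sub_distrib]
  refine Finset.sum_congr rfl fun p _ => Finset.sum_congr rfl fun q _ => ?_
  ring

/-- By `tail_hat_hat` the diagonal term (1/G_i + 1/G_{i+1})/2 of `hat_hatb` equals 1 minus a sum
weighted by `rho`, which is the form in `SpinRel`. -/
theorem hat_hatb_ab (hP : IsBider ev P) (h : RootRel ev P κ a b s t) (i j : Fin n) :
    P (hat a t i) (hat b t j) = κ * (
      -(if i = j then ∑ l, rho i l * (ev (hat a t l) * ev (hat b t l)) else 0)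
      - 1 / 2 * (ev (hat a t i) * ev (hat b t j)) + if i = j then 1 else 0) := by
  have key : ∀ j ≤ n, tail (fun l => ev (hat a t l) * ev (hat b t l)) j = 1 - ev (t j) ^ 2 := by
    intro j hj
    have := congrArg ev (h.data.tail_hat_hat hj)
    simp only [tail, map_sum, apply_ite ev, map_mul, map_zero, map_pow, map_sub, map_one] at this
    exact this
  rw [h.hat_hatb hP, rho_sum (fun l => ev (hat a t l) * ev (hat b t l)), key _ i.2.le, key _ i.2]
  split_ifs <;> ring

theorem sg_castSucc (α β : Fin d) : sg α.castSucc β.castSucc = sg α β := by simp [sg]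

theorem rho_castSucc (α β : Fin d) : rho α.castSucc β.castSucc = rho α β := by simp [rho]

theorem sg_castSucc_last (α : Fin d) : sg α.castSucc (Fin.last d) = 1 := by
  simp [sg, Fin.castSucc_lt_last]

theorem sg_last_castSucc (α : Fin d) : sg (Fin.last d) α.castSucc = -1 := by
  rw [sg_anti, sg_castSucc_last]

theorem sg_self (α : Fin d) : sg α α = 0 := by simp [sg]

theorem rho_castSucc_last (α : Fin d) : rho α.castSucc (Fin.last d) = 1 := by
  simp [rho, Fin.castSucc_lt_last]

theorem rho_last_castSucc (α : Fin d) : rho (Fin.last d) α.castSucc = 0 := by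
  simp [rho, Fin.castSucc_lt_last, (Fin.castSucc_lt_last α).not_gt]

theorem rho_self (α : Fin d) : rho α α = 1 / 2 := by simp [rho]

theorem snoc_aa (hP : IsBider ev P) (h : RootRel ev P κ a b s t) {A B : Fin d → Fin n → R}
    (hAB : SpinRel ev P κ A B) (hAa : ∀ α i j, P (A α i) (a j) = 0)
    (hAb : ∀ α i j, P (A α i) (b j) = 0) {A' : Fin (d + 1) → Fin n → R}
    (hA' : ∀ α, A' α.castSucc = act (hMat a b s t) A α) (hl : A' (Fin.last d) = hat a t)
    (α β : Fin (d + 1)) (i j : Fin n) :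
    P (A' α i) (A' β j) = κ / 2 * (sg i j + sg α β) * (ev (A' α j) * ev (A' β i)) := by
  induction α using Fin.lastCases with
  | last =>
    induction β using Fin.lastCases with
    | last => rw [hl, h.hat_hat hP, sg_self]; ring
    | cast β =>
      rw [hl, hA', hP.anti, step_a_hat hP h hAa hAb, sg_last_castSucc, sg_anti i j]; ring
  | cast α =>
    induction β using Fin.lastCases with
    | last => rw [hl, hA', step_a_hat hP h hAa hAb, sg_castSucc_last]
    | cast β => rw [hA', hA', step_aa hP h hAB hAa hAb, sg_castSucc]

/-- Adding one copy of `S(n,1)`: the bracket `{ , }'_κ` on `S(n,d+1)` from that on `S(n,d)`. -/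
theorem SpinRel.snoc (hP : IsBider ev P) (h : RootRel ev P κ a b s t) {A B : Fin d → Fin n → R}
    (hAB : SpinRel ev P κ A B) (hAa : ∀ α i j, P (A α i) (a j) = 0)
    (hAb : ∀ α i j, P (A α i) (b j) = 0) (hBa : ∀ α i j, P (B α i) (a j) = 0)
    (hBb : ∀ α i j, P (B α i) (b j) = 0) {A' B' : Fin (d + 1) → Fin n → R}
    (hA' : ∀ α, A' α.castSucc = act (hMat a b s t) A α) (hAl : A' (Fin.last d) = hat a t)
    (hB' : ∀ α, B' α.castSucc = act (hMat b a s t) B α) (hBl : B' (Fin.last d) = hat b t) :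
    SpinRel ev P κ A' B' where
  aa := snoc_aa hP h hAB hAa hAb hA' hAl
  bb := snoc_aa hP (h.swap hP) (hAB.swap hP) hBb hBa hB' hBl
  ab α β i j := by
    induction α using Fin.lastCases with
    | last =>
      induction β using Fin.lastCases with
      | last =>
        rw [hAl, hBl, hat_hatb_ab hP h, if_pos rfl, if_pos rfl, Fin.sum_univ_castSucc]
        simp [rho_last_castSucc, rho_self, hAl, hBl]
      | cast β =>
        have h1 : Fin.last d ≠ β.castSucc := (Fin.castSucc_lt_last β).ne'
        rw [hAl, hB', hP.anti, step_a_hatb hP (h.swap hP) hBb hBa, if_neg h1, if_neg h1]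
        by_cases hij : i = j
        · subst hij; simp [mul_comm (ev (hat a t _))]
        · simp [hij, Ne.symm hij]
    | cast α =>
      induction β using Fin.lastCases with
      | last =>
        have h1 : α.castSucc ≠ Fin.last d := (Fin.castSucc_lt_last α).ne
        rw [hBl, hA', step_a_hatb hP h hAa hAb, if_neg h1, if_neg h1]
        by_cases hij : i = j
        · subst hij; simp
        · simp [hij]
      | cast β =>
        -- In the sum over the d + 1 columns the last one has weight `rho` equal to 1, which matches
        -- the term -â b̂ᵀ of `step_ab`.
        rw [hA', hB', step_ab hP h hAB hAa hAb hBa hBb, Fin.sum_univ_castSucc]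
        simp only [hA', hB', hAl, hBl, rho_castSucc, rho_castSucc_last, Fin.castSucc_inj]
        by_cases hij : i = j
        · subst hij
          by_cases hαβ : α = β
          · subst hαβ; simp only [if_true]; ring
          · simp only [if_true, if_neg hαβ]
        · by_cases hαβ : α = β
          · subst hαβ; simp only [if_true, if_neg hij]; ring
          · simp only [if_neg hij, if_neg hαβ]

end Step

end Algebra

end SpinPoisson

end

/-! ### The columns and rows of F, and the induction on the number of copies -/

noncomputable section

namespace SpinPoisson

section Algebra

variable {R : Type*} [CommRing R] {n d : ℕ}

/-- `M_{d-1} ⋯ M_{k+1} M_k` over an arbitrary ring. -/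
def revProd (M : Fin d → Matrix (Fin n) (Fin n) R) (k : ℕ) : Matrix (Fin n) (Fin n) R :=
  (((List.finRange d).drop k).map M).reverse.prod

theorem revProd_castSucc (M : Fin (d + 1) → Matrix (Fin n) (Fin n) R) (k : ℕ) (hk : k ≤ d) :
    revProd M k = M (Fin.last d) * revProd (fun β : Fin d => M β.castSucc) k := by
  unfold revProd
  rw [List.finRange_succ_last, List.drop_append_of_le_length (by simpa using hk), List.map_append,
    List.reverse_append, List.prod_append, ← List.map_drop, List.map_map]
  simp [Function.comp_def]

theorem revProd_length (M : Fin d → Matrix (Fin n) (Fin n) R) : revProd M d = 1 := by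
  unfold revProd
  rw [List.drop_of_length_le (by simp)]; simp

/-- The columns `h_d ⋯ h_α a^α`, with `h = g_+⁻¹`. -/
def dressed (a b : Fin d → Fin n → R) (s t : Fin d → ℕ → R) (α : Fin d) (i : Fin n) : R :=
  ∑ p, revProd (fun β => hMat (a β) (b β) (s β) (t β)) α i p * a α p

/-- The leftmost factor belongs to the last copy; splitting it off leaves the dressed vectors of the
first d copies. This recursion drives every induction on the number of copies. -/
theorem dressed_castSucc (a b : Fin (d + 1) → Fin n → R) (s t : Fin (d + 1) → ℕ → R) (α : Fin d) :
    dressed a b s t α.castSucc = act (hMat (a (Fin.last d)) (b (Fin.last d)) (s (Fin.last d))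
      (t (Fin.last d))) (dressed (fun β => a β.castSucc) (fun β => b β.castSucc)
      (fun β => s β.castSucc) (fun β => t β.castSucc)) α := by
  funext i
  unfold dressed act
  rw [Fin.val_castSucc, revProd_castSucc _ _ α.2.le]
  simp only [Matrix.mul_apply, Finset.sum_mul, Finset.mul_sum]
  rw [Finset.sum_comm]
  exact Finset.sum_congr rfl fun p _ => Finset.sum_congr rfl fun q _ => by ring

theorem dressed_last (a b : Fin (d + 1) → Fin n → R) (s t : Fin (d + 1) → ℕ → R)
    (h : RootData (a (Fin.last d)) (b (Fin.last d)) (s (Fin.last d)) (t (Fin.last d))) :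
    dressed a b s t (Fin.last d) = hat (a (Fin.last d)) (t (Fin.last d)) := by
  funext i
  unfold dressed
  rw [Fin.val_last, revProd_castSucc _ _ le_rfl, revProd_length, mul_one]
  exact h.hMat_mulVec i

theorem map_hMat {S : Type*} [CommRing S] (f : R →+* S) (a b : Fin n → R) (s t : ℕ → R)
    (i p : Fin n) :
    f (hMat a b s t i p) = hMat (fun i => f (a i)) (fun i => f (b i)) (fun j => f (s j))
      (fun j => f (t j)) i p := by
  simp only [hMat, hat, Matrix.of_apply]
  split_ifs <;> simp

theorem map_revProd {S : Type*} [CommRing S] (f : R →+* S) (M : Fin d → Matrix (Fin n) (Fin n) R)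
    (k : ℕ) : (revProd M k).map f = revProd (fun β => (M β).map f) k := by
  unfold revProd
  rw [← RingHom.mapMatrix_apply, map_list_prod, List.map_reverse, List.map_map]
  rfl

/-- The dressed vectors are polynomial in a, b, the roots and their inverses, so they commute with
ring homomorphisms. The homomorphisms needed are evaluation at a point and the one-jet. -/
theorem map_dressed {S : Type*} [CommRing S] (f : R →+* S) (a b : Fin d → Fin n → R)
    (s t : Fin d → ℕ → R) (α : Fin d) (i : Fin n) :
    f (dressed a b s t α i) = dressed (fun α i => f (a α i)) (fun α i => f (b α i))
      (fun α j => f (s α j)) (fun α j => f (t α j)) α i := by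
  unfold dressed
  rw [map_sum]
  refine Finset.sum_congr rfl fun p _ => ?_
  have h1 := congrFun (congrFun (map_revProd f
    (fun β => hMat (a β) (b β) (s β) (t β)) α) i) p
  rw [Matrix.map_apply] at h1
  have h2 : (fun β => (hMat (a β) (b β) (s β) (t β)).map f) = fun β =>
      hMat (fun i => f (a β i)) (fun i => f (b β i)) (fun j => f (s β j)) (fun j => f (t β j)) := by
    funext β; ext i p; exact map_hMat f _ _ _ _ i p
  rw [map_mul, h1, h2]

section Der

variable {ev : R →+* ℂ} {D : R → ℂ}

theorem IsDer.act_eq_zero (hD : IsDer ev D) {h : Matrix (Fin n) (Fin n) R} {A : Fin d → Fin n → R}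
    (hh : ∀ i p, D (h i p) = 0) (hA : ∀ α p, D (A α p) = 0) (α : Fin d) (i : Fin n) :
    D (act h A α i) = 0 := by
  unfold act
  rw [hD.sum]
  exact Finset.sum_eq_zero fun p _ => by rw [hD.mul, hh, hA]; simp

theorem kill_dressed (hD : IsDer ev D) : ∀ {d : ℕ} (a b : Fin d → Fin n → R)
    (s t : Fin d → ℕ → R), (∀ α, RootData (a α) (b α) (s α) (t α)) →
    (∀ α i, D (a α i) = 0) → (∀ α i, D (b α i) = 0) → ∀ α i, D (dressed a b s t α i) = 0
  | 0, _, _, _, _, _, _, _, α, _ => α.elim0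
  | d + 1, a, b, s, t, h, ha, hb, α, i => by
    induction α using Fin.lastCases with
    | last => rw [dressed_last _ _ _ _ (h _)]; exact (h _).kill_hat hD (ha _) (hb _) i
    | cast α =>
      rw [dressed_castSucc]
      exact hD.act_eq_zero (fun i p => (h _).kill_hMat hD (ha _) (hb _) i p)
        (kill_dressed hD _ _ _ _ (fun α => h α.castSucc) (fun α => ha α.castSucc)
          (fun α => hb α.castSucc)) α i

/-- A derivation that kills `a_i / √(G_i G_{i+1})` and `b_i / √(G_i G_{i+1})` kills `a` and `b`. -/
theorem RootData.kill_of_hat {a b : Fin n → R} {s t : ℕ → R} (h : RootData a b s t)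
    (hD : IsDer ev D) (ha : ∀ i, D (hat a t i) = 0) (hb : ∀ i, D (hat b t i) = 0) (i : Fin n) :
    D (a i) = 0 := by
  -- The functions 1/G_j are recovered from the products â_i b̂_i, starting from 1/G_n = 1; then
  -- come the roots, and then a_i = â_i √G_i √G_{i+1}.
  have ht2 : ∀ j ≤ n, D (t j ^ 2) = 0 := by
    intro j hj
    induction hj using Nat.decreasingInduction with
    | self => rw [h.last_t, hD.one]
    | of_succ k hk ih =>
      have := h.step_hat ⟨k, hk⟩
      simp only at this
      rw [← this, hD.add, hD.mul, ha, hb] at ih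
      simpa using ih
  have hs : ∀ j ≤ n, D (s j) = 0 := by
    intro j hj
    have h1 : D (t j) = 0 := by
      have h0 := ht2 j hj
      rw [hD.sq] at h0
      have := right_ne_zero_of_mul_eq_one (h.ev_st ev hj)
      exact (mul_eq_zero.1 h0).resolve_left (mul_ne_zero two_ne_zero this)
    rw [hD.of_mul_eq_one (u := t j) (by rw [mul_comm]; exact h.st j hj), h1]; simp
  have e : a i = hat a t i * (s i * s (i + 1)) := by
    have h0 := h.st i i.2.le
    have h1 := h.st (i + 1) i.2
    unfold hat
    linear_combination -a i * h0 - (a i * s i * t i) * h1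
  rw [e, hD.mul, hD.mul, ha, hs _ i.2.le, hs _ i.2]; simp

/-- The injectivity of dF in algebraic form. The last column and row are â and b̂ of the last copy,
so that copy is killed; its matrices h and k are then killed too and can be stripped off the
remaining vectors, which reduces d by one. -/
theorem kill_of_dressed (hD : IsDer ev D) : ∀ {d : ℕ} (a b : Fin d → Fin n → R)
    (s t : Fin d → ℕ → R), (∀ α, RootData (a α) (b α) (s α) (t α)) →
    (∀ α i, D (dressed a b s t α i) = 0) → (∀ α i, D (dressed b a s t α i) = 0) →
    ∀ α, (∀ i, D (a α i) = 0) ∧ ∀ i, D (b α i) = 0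
  | 0, _, _, _, _, _, _, _, α => α.elim0
  | d + 1, a, b, s, t, h, ha, hb, α => by
    have hl := h (Fin.last d)
    have ha0 := ha (Fin.last d)
    have hb0 := hb (Fin.last d)
    rw [dressed_last _ _ _ _ hl] at ha0
    rw [dressed_last _ _ _ _ hl.swap] at hb0
    have hal := hl.kill_of_hat hD ha0 hb0
    have hbl := hl.swap.kill_of_hat hD hb0 ha0
    -- Once D kills h, it commutes with multiplication by h; multiplying by g_+ evaluated at the
    -- point removes h.
    have inv : ∀ {a b : Fin n → R} {s t : ℕ → R} (_ : RootData a b s t)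
        (_ : ∀ i, D (a i) = 0) (_ : ∀ i, D (b i) = 0) (A : Fin d → Fin n → R),
        (∀ α i, D (act (hMat a b s t) A α i) = 0) → ∀ α i, D (A α i) = 0 := by
      intro a b s t h ha hb A hA α i
      have e : ∀ q, ∑ p, ev (hMat a b s t q p) * D (A α p) = 0 := fun q => by
        rw [← hA α q]
        unfold act
        rw [hD.sum]
        refine Finset.sum_congr rfl fun p _ => ?_
        rw [hD.mul, h.kill_hMat hD ha hb]; ring
      have e2 : ∑ p, (∑ q, ev (gMat a b s t i q) * ev (hMat a b s t q p)) * D (A α p) = 0 := by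
        have : ∑ q, ev (gMat a b s t i q) * ∑ p, ev (hMat a b s t q p) * D (A α p) = 0 := by
          simp [e]
        rw [← this]
        simp only [Finset.sum_mul, Finset.mul_sum]
        rw [Finset.sum_comm]
        exact Finset.sum_congr rfl fun p _ => Finset.sum_congr rfl fun q _ => by ring
      have e3 : ∀ p, ∑ q, ev (gMat a b s t i q) * ev (hMat a b s t q p)
          = if i = p then 1 else 0 := fun p => by
        have := congrArg ev (congrFun (congrFun h.gMat_mul_hMat i) p)
        rw [Matrix.mul_apply, Matrix.one_apply, map_sum] at this
        simpa [apply_ite ev] using this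
      simpa [e3] using e2
    induction α using Fin.lastCases with
    | last => exact ⟨hal, hbl⟩
    | cast α =>
      refine kill_of_dressed hD (fun β => a β.castSucc) (fun β => b β.castSucc)
        (fun β => s β.castSucc) (fun β => t β.castSucc) (fun α => h α.castSucc) ?_ ?_ α
      · refine inv hl hal hbl _ fun α i => ?_
        rw [← dressed_castSucc]; exact ha _ i
      · refine inv hl.swap hbl hal _ fun α i => ?_
        rw [← dressed_castSucc]; exact hb _ i

end Der

/-- The map `F` is Poisson, in terms of the algebra of a biderivation. -/
theorem spinRel_dressed {ev : R →+* ℂ} {P : R → R → ℂ} {κ : ℂ} (hP : IsBider ev P) :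
    ∀ {d : ℕ} (a b : Fin d → Fin n → R) (s t : Fin d → ℕ → R),
    (∀ α, RootRel ev P κ (a α) (b α) (s α) (t α)) →
    (∀ α β, α ≠ β → ∀ i j, P (a α i) (a β j) = 0 ∧ P (a α i) (b β j) = 0 ∧
      P (b α i) (b β j) = 0) →
    SpinRel ev P κ (dressed a b s t) (dressed b a s t)
  | 0, _, _, _, _, _, _ => ⟨fun α => α.elim0, fun α => α.elim0, fun α => α.elim0⟩
  | d + 1, a, b, s, t, h, hc => by
    have ne : ∀ α : Fin d, α.castSucc ≠ Fin.last d := fun α => (Fin.castSucc_lt_last α).ne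
    have ih := spinRel_dressed hP (fun β => a β.castSucc) (fun β => b β.castSucc)
      (fun β => s β.castSucc) (fun β => t β.castSucc) (fun α => h α.castSucc)
      (fun α β hαβ => hc _ _ (by simpa using hαβ))
    have hd := fun α : Fin d => (h α.castSucc).data
    refine ih.snoc hP (h (Fin.last d)) ?_ ?_ ?_ ?_ (dressed_castSucc a b s t)
      (dressed_last _ _ _ _ (h _).data) (dressed_castSucc b a s t)
      (dressed_last _ _ _ _ (h _).data.swap)
    · intro α i j
      exact kill_dressed (hP.der_left _) _ _ _ _ hd (fun α i => (hc _ _ (ne α) i j).1)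
        (fun α i => by rw [hP.anti, (hc _ _ (ne α).symm j i).2.1, neg_zero]) α i
    · intro α i j
      exact kill_dressed (hP.der_left _) _ _ _ _ hd (fun α i => (hc _ _ (ne α) i j).2.1)
        (fun α i => (hc _ _ (ne α) i j).2.2) α i
    · intro α i j
      exact kill_dressed (hP.der_left _) _ _ _ _ (fun α => (hd α).swap)
        (fun α i => by rw [hP.anti, (hc _ _ (ne α).symm j i).2.1, neg_zero])
        (fun α i => (hc _ _ (ne α) i j).1) α i
    · intro α i j
      exact kill_dressed (hP.der_left _) _ _ _ _ (fun α => (hd α).swap)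
        (fun α i => (hc _ _ (ne α) i j).2.2) (fun α i => (hc _ _ (ne α) i j).2.1) α i

end Algebra

end SpinPoisson

end

noncomputable section

namespace SpinPoisson

/-! ### Poisson tensors in coordinates -/

section Coord

variable {E : Type*} [NormedAddCommGroup E] [NormedSpace ℂ E] {ι : Type*} [Fintype ι]

/-- The tensor with components `Λ p q` along the vectors `e p`. -/
def coordTensor (e : ι → E) (Λ : ι → ι → E → ℂ) : TwoTensor E :=
  fun x φ ψ => ∑ p, ∑ q, Λ p q x * φ (e p) * ψ (e q)

/-- The first term of the Jacobi identity for coordinate functions. -/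
def jacTerm (e : ι → E) (Λ : ι → ι → E → ℂ) (x : E) (k p q : ι) : ℂ :=
  ∑ l, Λ k l x * fderiv ℂ (Λ p q) x (e l)

theorem coordTensor_eq (e : ι → E) (Λ : ι → ι → E → ℂ) (x : E) (φ ψ : E →L[ℂ] ℂ) :
    coordTensor e Λ x φ ψ = ∑ l, (∑ k, Λ k l x * φ (e k)) * ψ (e l) := by
  unfold coordTensor
  rw [Finset.sum_comm]
  exact Finset.sum_congr rfl fun l _ => by rw [Finset.sum_mul]

theorem coordTensor_anti {e : ι → E} {Λ : ι → ι → E → ℂ} (hanti : ∀ p q x, Λ p q x = -Λ q p x)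
    (x : E) (φ ψ : E →L[ℂ] ℂ) : coordTensor e Λ x φ ψ = -coordTensor e Λ x ψ φ := by
  unfold coordTensor
  rw [Finset.sum_comm, ← Finset.sum_neg_distrib]
  refine Finset.sum_congr rfl fun p _ => ?_
  rw [← Finset.sum_neg_distrib]
  refine Finset.sum_congr rfl fun q _ => ?_
  rw [hanti]; ring

theorem AnalyticAt.dirDeriv {f : E → ℂ} {x : E} (hf : AnalyticAt ℂ f x) (v : E) :
    AnalyticAt ℂ (fun y => fderiv ℂ f y v) x := by
  have h := hf.fderiv
  exact ((ContinuousLinearMap.apply ℂ ℂ v).analyticAt _).comp h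

theorem dirDeriv_symm {f : E → ℂ} {x : E} (hf : AnalyticAt ℂ f x) (v w : E) :
    fderiv ℂ (fun y => fderiv ℂ f y v) x w = fderiv ℂ (fun y => fderiv ℂ f y w) x v := by
  have hd : DifferentiableAt ℂ (fderiv ℂ f) x := hf.fderiv.differentiableAt
  have h1 : ∀ v w, fderiv ℂ (fun y => fderiv ℂ f y v) x w = fderiv ℂ (fderiv ℂ f) x w v := by
    intro v w
    rw [fderiv_clm_apply hd (differentiableAt_const v)]
    simp
  rw [h1, h1]
  exact (hf.contDiffAt (n := 2)).isSymmSndFDerivAt (by simp) w v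

theorem fderiv_bracket {e : ι → E} {Λ : ι → ι → E → ℂ} (hanti : ∀ p q x, Λ p q x = -Λ q p x)
    {x : E} (hΛ : ∀ p q, AnalyticAt ℂ (Λ p q) x)
    {g h : E → ℂ} (hg : AnalyticAt ℂ g x) (hh : AnalyticAt ℂ h x) (v : E) :
    fderiv ℂ (bracket (coordTensor e Λ) g h) x v =
      ∑ p, ∑ q, fderiv ℂ (Λ p q) x v * (fderiv ℂ g x (e p) * fderiv ℂ h x (e q))
      - ∑ p, (∑ q, Λ q p x * fderiv ℂ h x (e q)) * fderiv ℂ (fun y => fderiv ℂ g y (e p)) x v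
      + ∑ q, (∑ p, Λ p q x * fderiv ℂ g x (e p)) * fderiv ℂ (fun y => fderiv ℂ h y (e q)) x v := by
  have hD : ∀ p q, HasFDerivAt (fun y => Λ p q y * fderiv ℂ g y (e p) * fderiv ℂ h y (e q)) _ x :=
    fun p q => (((hΛ p q).differentiableAt.hasFDerivAt.mul
      (AnalyticAt.dirDeriv hg (e p)).differentiableAt.hasFDerivAt).mul
      (AnalyticAt.dirDeriv hh (e q)).differentiableAt.hasFDerivAt)
  have hS := HasFDerivAt.fun_sum (u := Finset.univ) fun p _ =>
    HasFDerivAt.fun_sum (u := Finset.univ) fun q _ => hD p q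
  have e0 : bracket (coordTensor e Λ) g h
      = fun y => ∑ p, ∑ q, Λ p q y * fderiv ℂ g y (e p) * fderiv ℂ h y (e q) := rfl
  rw [e0, hS.fderiv]
  have c2 : ∑ q, (∑ p, Λ p q x * fderiv ℂ g x (e p)) * fderiv ℂ (fun y => fderiv ℂ h y (e q)) x v
      = ∑ p, ∑ q, (Λ p q x * fderiv ℂ g x (e p)) * fderiv ℂ (fun y => fderiv ℂ h y (e q)) x v := by
    rw [Finset.sum_comm]
    exact Finset.sum_congr rfl fun _ _ => Finset.sum_mul _ _ _
  rw [c2]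
  simp only [Finset.sum_mul, ← Finset.sum_sub_distrib, ← Finset.sum_add_distrib,
    sum_apply]
  refine Finset.sum_congr rfl fun p _ => Finset.sum_congr rfl fun q _ => ?_
  rw [hanti q p]
  simp only [add_apply, smul_apply, smul_eq_mul, Pi.mul_apply]
  ring

/-- The Jacobiator splits into `C`, trilinear in first derivatives, and terms `Q` with one second
derivative. The `Q` cancel in pairs by the symmetry of second derivatives; the cyclic sum of the `C`
has the Jacobiators of the components as coefficients. -/
theorem coordTensor_jacobi {e : ι → E} {Λ : ι → ι → E → ℂ}
    (hanti : ∀ p q x, Λ p q x = -Λ q p x) {x : E} (hΛ : ∀ p q, AnalyticAt ℂ (Λ p q) x)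
    (hjac : ∀ k p q, jacTerm e Λ x k p q + jacTerm e Λ x p q k + jacTerm e Λ x q k p = 0)
    {f g h : E → ℂ} (hf : AnalyticAt ℂ f x) (hg : AnalyticAt ℂ g x) (hh : AnalyticAt ℂ h x) :
    bracket (coordTensor e Λ) f (bracket (coordTensor e Λ) g h) x
      + bracket (coordTensor e Λ) g (bracket (coordTensor e Λ) h f) x
      + bracket (coordTensor e Λ) h (bracket (coordTensor e Λ) f g) x = 0 := by
  set X : (E → ℂ) → ι → ℂ := fun f l => ∑ k, Λ k l x * fderiv ℂ f x (e k) with hX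
  set Q : (E → ℂ) → (E → ℂ) → (E → ℂ) → ℂ := fun f g h =>
    ∑ l, ∑ q, X f l * X g q * fderiv ℂ (fun y => fderiv ℂ h y (e q)) x (e l) with hQ
  set C : (E → ℂ) → (E → ℂ) → (E → ℂ) → ℂ := fun f g h => ∑ k, ∑ p, ∑ q,
    jacTerm e Λ x k p q * (fderiv ℂ f x (e k) * (fderiv ℂ g x (e p) * fderiv ℂ h x (e q))) with hC
  have symm : ∀ f g h, AnalyticAt ℂ h x → Q f g h = Q g f h := by
    intro f g h hh
    simp only [hQ]
    rw [Finset.sum_comm]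
    refine Finset.sum_congr rfl fun p _ => Finset.sum_congr rfl fun q _ => ?_
    rw [dirDeriv_symm hh]; ring
  have key : ∀ f g h, AnalyticAt ℂ g x → AnalyticAt ℂ h x →
      bracket (coordTensor e Λ) f (bracket (coordTensor e Λ) g h) x
        = C f g h - Q f h g + Q f g h := by
    intro f g h hg hh
    have e1 : bracket (coordTensor e Λ) f (bracket (coordTensor e Λ) g h) x
      = ∑ l, X f l * fderiv ℂ (bracket (coordTensor e Λ) g h) x (e l) := coordTensor_eq _ _ _ _ _
    have e2 : C f g h = ∑ l, X f l *
        ∑ p, ∑ q, fderiv ℂ (Λ p q) x (e l) * (fderiv ℂ g x (e p) * fderiv ℂ h x (e q)) := by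
      have e3 : ∀ k, ∑ p, ∑ q, jacTerm e Λ x k p q *
          (fderiv ℂ f x (e k) * (fderiv ℂ g x (e p) * fderiv ℂ h x (e q)))
          = ∑ l, Λ k l x * fderiv ℂ f x (e k) * ∑ p, ∑ q, fderiv ℂ (Λ p q) x (e l) *
            (fderiv ℂ g x (e p) * fderiv ℂ h x (e q)) := by
        intro k
        simp only [Finset.mul_sum]
        symm
        rw [Finset.sum_comm]
        refine Finset.sum_congr rfl fun p _ => ?_
        rw [Finset.sum_comm]
        refine Finset.sum_congr rfl fun q _ => ?_
        unfold jacTerm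
        rw [Finset.sum_mul]
        exact Finset.sum_congr rfl fun l _ => by ring
      simp only [hC, e3]
      rw [Finset.sum_comm]
      exact Finset.sum_congr rfl fun l _ => (Finset.sum_mul _ _ _).symm
    have e3 : ∀ l, fderiv ℂ (bracket (coordTensor e Λ) g h) x (e l) =
      ∑ p, ∑ q, fderiv ℂ (Λ p q) x (e l) * (fderiv ℂ g x (e p) * fderiv ℂ h x (e q))
      - ∑ p, X h p * fderiv ℂ (fun y => fderiv ℂ g y (e p)) x (e l)
      + ∑ q, X g q * fderiv ℂ (fun y => fderiv ℂ h y (e q)) x (e l) := fun l =>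
      fderiv_bracket hanti hΛ hg hh (e l)
    rw [e1, e2]
    simp only [e3, hQ, mul_add, mul_sub, Finset.sum_add_distrib,
      Finset.sum_sub_distrib, Finset.mul_sum, mul_assoc]
  have cyc : C f g h + C g h f + C h f g = 0 := by
    have c2 : C g h f = ∑ k, ∑ p, ∑ q, jacTerm e Λ x p q k *
        (fderiv ℂ f x (e k) * (fderiv ℂ g x (e p) * fderiv ℂ h x (e q))) := by
      simp only [hC]
      symm
      rw [Finset.sum_comm]
      refine Finset.sum_congr rfl fun p _ => ?_
      rw [Finset.sum_comm]
      refine Finset.sum_congr rfl fun q _ => Finset.sum_congr rfl fun k _ => ?_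
      ring
    have c3 : C h f g = ∑ k, ∑ p, ∑ q, jacTerm e Λ x q k p *
        (fderiv ℂ f x (e k) * (fderiv ℂ g x (e p) * fderiv ℂ h x (e q))) := by
      simp only [hC]
      rw [Finset.sum_comm]
      refine Finset.sum_congr rfl fun k _ => ?_
      rw [Finset.sum_comm]
      refine Finset.sum_congr rfl fun p _ => Finset.sum_congr rfl fun q _ => ?_
      ring
    rw [c2, c3]
    simp only [hC, ← Finset.sum_add_distrib]
    refine Finset.sum_eq_zero fun k _ => Finset.sum_eq_zero fun p _ =>
      Finset.sum_eq_zero fun q _ => ?_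
    rw [← add_mul, ← add_mul, hjac, zero_mul]
  rw [key f g h hg hh, key g h f hh hf, key h f g hf hg]
  linear_combination cyc + symm f g h hh - symm f h g hg + symm g h f hf

theorem coordTensor_isHolomorphicPoisson {e : ι → E} {Λ : ι → ι → E → ℂ}
    (hanti : ∀ p q x, Λ p q x = -Λ q p x) (hΛ : ∀ p q x, AnalyticAt ℂ (Λ p q) x)
    (hjac : ∀ x k p q, jacTerm e Λ x k p q + jacTerm e Λ x p q k + jacTerm e Λ x q k p = 0) :
    IsHolomorphicPoisson (coordTensor e Λ) where
  holomorphic O f g _ hf hg x hx := by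
    refine Finset.analyticAt_fun_sum _ fun p _ => Finset.analyticAt_fun_sum _ fun q _ => ?_
    exact ((hΛ p q x).mul (AnalyticAt.dirDeriv (hf x hx) _)).mul
      (AnalyticAt.dirDeriv (hg x hx) _)
  linear O c f g h _ _ hg hh x hx := by
    have h1 := (hg x hx).differentiableAt
    have h2 := (hh x hx).differentiableAt
    have : fderiv ℂ (fun y => c * g y + h y) x = c • fderiv ℂ g x + fderiv ℂ h x :=
      ((h1.hasFDerivAt.const_mul c).add h2.hasFDerivAt).fderiv
    simp only [bracket, this, coordTensor, Finset.mul_sum, ← Finset.sum_add_distrib]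
    refine Finset.sum_congr rfl fun p _ => Finset.sum_congr rfl fun q _ => ?_
    simp only [add_apply, smul_apply, smul_eq_mul]
    ring
  antisymm O f g _ _ _ x _ := coordTensor_anti hanti _ _ _
  leibniz O f g h _ _ hg hh x hx := by
    have h1 := (hg x hx).differentiableAt
    have h2 := (hh x hx).differentiableAt
    have : fderiv ℂ (fun y => g y * h y) x = g x • fderiv ℂ h x + h x • fderiv ℂ g x :=
      (h1.hasFDerivAt.mul h2.hasFDerivAt).fderiv
    simp only [bracket, this, coordTensor, Finset.mul_sum, Finset.sum_mul,
      ← Finset.sum_add_distrib]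
    refine Finset.sum_congr rfl fun p _ => Finset.sum_congr rfl fun q _ => ?_
    simp only [add_apply, smul_apply, smul_eq_mul]
    ring
  jacobi O f g h _ hf hg hh x hx :=
    coordTensor_jacobi hanti (fun p q => hΛ p q x) (hjac x) (hf x hx) (hg x hx) (hh x hx)

end Coord

end SpinPoisson

end

noncomputable section

namespace SpinPoisson

/-! ### Components of the two brackets -/

section Components

variable {n d : ℕ}

theorem elem_apply {l : ℕ} (j k i p : Fin l) :
    elem l j k i p = if j = i ∧ k = p then 1 else 0 := Matrix.single_apply ..

theorem single_kron_apply {l : ℕ} (j k i p i' p' : Fin l) :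
    (elem l j k ⊗ₖ elem l k j) (i, i') (p, p')
      = if j = i then if k = p then if i = p' ∧ i' = p then (1 : ℂ) else 0 else 0 else 0 := by
  rw [Matrix.kroneckerMap_apply]
  simp only [elem_apply]
  by_cases h1 : j = i
  · subst h1
    by_cases h2 : k = p
    · subst h2
      simp only [and_self, if_true, one_mul]
      exact if_congr ⟨fun h => ⟨h.2, h.1.symm⟩, fun h => ⟨h.2.symm, h.1⟩⟩ rfl rfl
    · simp [h2]
  · simp [h1]

theorem permMat_apply {l : ℕ} (i p i' p' : Fin l) :
    permMat l (i, i') (p, p') = if i = p' ∧ i' = p then 1 else 0 := by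
  unfold permMat
  simp only [Matrix.sum_apply, single_kron_apply]
  simp

/-- All of r, r_+ and r_- are the flip of the two tensor factors weighted by an index function: `sg`
/ 2, `rho`, and minus the transpose of `rho`. -/
theorem rMat_apply {l : ℕ} (i p i' p' : Fin l) :
    rMat l (i, i') (p, p') = if i = p' ∧ i' = p then sg i p / 2 else 0 := by
  unfold rMat
  simp only [Matrix.smul_apply, Matrix.sum_apply, smul_eq_mul]
  have h1 : ∀ j k : Fin l, (if j < k then elem l j k ⊗ₖ elem l k j - elem l k j ⊗ₖ elem l j k
      else 0 : Matrix (Fin l × Fin l) (Fin l × Fin l) ℂ) (i, i') (p, p')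
      = (if j = i then if k = p then if i = p' ∧ i' = p then if i < p then 1 else 0
          else 0 else 0 else 0)
        - (if k = i then if j = p then if i = p' ∧ i' = p then if p < i then 1 else 0
          else 0 else 0 else 0) := by
    intro j k
    by_cases hjk : j < k
    · rw [if_pos hjk, Matrix.sub_apply, single_kron_apply, single_kron_apply]
      congr 1
      · split_ifs <;> simp_all
      · split_ifs <;> simp_all
    · rw [if_neg hjk, Matrix.zero_apply]
      split_ifs <;> simp_all <;> omega
  simp only [h1, Finset.sum_sub_distrib]
  simp only [Finset.sum_ite_eq', Finset.mem_univ, if_true]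
  unfold sg
  rcases lt_trichotomy i p with h | h | h
  · simp [h, h.not_gt]
  · simp [h]
  · simp only [h, h.not_gt, if_true, if_false]; split_ifs <;> norm_num

theorem rPlus_apply {l : ℕ} (i p i' p' : Fin l) :
    rPlus l (i, i') (p, p') = if i = p' ∧ i' = p then rho i p else 0 := by
  unfold rPlus
  rw [Matrix.add_apply, Matrix.smul_apply, rMat_apply, permMat_apply, sg_eq_rho]
  split_ifs
  · have := rho_add i p
    simp only [smul_eq_mul]; linear_combination -this / 2
  · simp

theorem rMinus_apply {l : ℕ} (i p i' p' : Fin l) :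
    rMinus l (i, i') (p, p') = if i = p' ∧ i' = p then -rho p i else 0 := by
  unfold rMinus
  rw [Matrix.sub_apply, Matrix.smul_apply, rMat_apply, permMat_apply, sg_eq_rho]
  split_ifs
  · have := rho_add i p
    simp only [smul_eq_mul]; linear_combination this / 2
  · simp

theorem sum_sum_ite_and {m l : ℕ} (i : Fin m) (j : Fin l) (f : Fin l → Fin m → ℂ) :
    ∑ p, ∑ q, (if i = q ∧ j = p then f p q else 0) = f j i := by
  rw [Finset.sum_eq_single j, Finset.sum_eq_single i]
  · simp
  · intro q _ hq; simp [Ne.symm hq]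
  · simp
  · intro p _ hp; simp [Ne.symm hp]
  · simp

theorem rMat_mul_kron (A : Matrix (Fin n) (Fin d) ℂ) (i j : Fin n) (α β : Fin d) :
    (rMat n * (A ⊗ₖ A)) (i, j) (α, β) = sg i j / 2 * (A j α * A i β) := by
  rw [Matrix.mul_apply, Fintype.sum_prod_type]
  simp only [rMat_apply, Matrix.kroneckerMap_apply, ite_mul, zero_mul]
  exact sum_sum_ite_and i j (fun p q => sg i p / 2 * (A p α * A q β))

theorem kron_mul_rMat (A : Matrix (Fin n) (Fin d) ℂ) (i j : Fin n) (α β : Fin d) :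
    ((A ⊗ₖ A) * rMat d) (i, j) (α, β) = -sg α β / 2 * (A j α * A i β) := by
  rw [Matrix.mul_apply, Fintype.sum_prod_type]
  simp only [rMat_apply, Matrix.kroneckerMap_apply, mul_ite, mul_zero]
  have : ∀ p q : Fin d, (if p = β ∧ q = α then A i p * A j q * (sg p α / 2) else 0)
      = if α = q ∧ β = p then A i p * A j q * (sg p α / 2) else 0 := fun p q =>
    if_congr (by rw [and_comm, eq_comm (a := q), eq_comm (a := p)]) rfl rfl
  simp only [this]
  rw [sum_sum_ite_and α β (fun p q => A i p * A j q * (sg p α / 2)), sg_anti β α]; ring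

/-- The flip contained in R forces i = j and leaves one weighted contraction. -/
theorem sandwichN_apply {R : Matrix (Fin n × Fin n) (Fin n × Fin n) ℂ} {c : Fin n → Fin n → ℂ}
    (hR : ∀ i p i' p', R (i, i') (p, p') = if i = p' ∧ i' = p then c i p else 0)
    (A : Matrix (Fin n) (Fin d) ℂ) (B : Matrix (Fin d) (Fin n) ℂ) (i j : Fin n) (α β : Fin d) :
    sandwichN R A B (i, β) (α, j) = if i = j then ∑ l, c i l * (A l α * B β l) else 0 := by
  unfold sandwichN
  rw [Matrix.mul_apply, Fintype.sum_prod_type]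
  have h1 : ∀ p q, (((1 : Matrix (Fin n) (Fin n) ℂ) ⊗ₖ B) * R) (i, β) (p, q)
      = if i = q then B β p * c i p else 0 := by
    intro p q
    rw [Matrix.mul_apply, Fintype.sum_prod_type, Finset.sum_eq_single i]
    · simp only [hR, Matrix.kroneckerMap_apply, Matrix.one_apply_eq, one_mul]
      rw [Finset.sum_eq_single p]
      · simp
      · intro r _ hr; simp [hr]
      · simp
    · intro r _ hr; simp [Matrix.one_apply_ne (Ne.symm hr)]
    · simp
  simp only [h1, Matrix.kroneckerMap_apply, Matrix.one_apply]
  split_ifs with hij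
  · subst hij
    refine Finset.sum_congr rfl fun l _ => ?_
    rw [Finset.sum_eq_single i]
    · simp; ring
    · intro q _ hq; simp [hq]
    · simp
  · refine Finset.sum_eq_zero fun l _ => Finset.sum_eq_zero fun q _ => ?_
    by_cases h : i = q
    · subst h; simp [hij]
    · simp [h]

theorem sandwichD_apply {R : Matrix (Fin d × Fin d) (Fin d × Fin d) ℂ} {c : Fin d → Fin d → ℂ}
    (hR : ∀ i p i' p', R (i, i') (p, p') = if i = p' ∧ i' = p then c i p else 0)
    (A : Matrix (Fin n) (Fin d) ℂ) (B : Matrix (Fin d) (Fin n) ℂ) (i j : Fin n) (α β : Fin d) :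
    sandwichD R A B (i, β) (α, j) = if α = β then ∑ γ, c γ α * (A i γ * B γ j) else 0 := by
  unfold sandwichD
  rw [Matrix.mul_apply, Fintype.sum_prod_type]
  have h1 : ∀ p q, ((A ⊗ₖ (1 : Matrix (Fin d) (Fin d) ℂ)) * R) (i, β) (p, q)
      = if β = p then A i q * c q p else 0 := by
    intro p q
    rw [Matrix.mul_apply, Fintype.sum_prod_type]
    simp only [hR, Matrix.kroneckerMap_apply]
    rw [Finset.sum_eq_single q, Finset.sum_eq_single β]
    · simp
    · intro r _ hr; simp [Matrix.one_apply_ne (Ne.symm hr)]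
    · simp
    · intro r _ hr; simp [hr]
    · simp
  simp only [h1, Matrix.kroneckerMap_apply]
  split_ifs with hαβ
  · subst hαβ
    rw [Finset.sum_eq_single α]
    · exact Finset.sum_congr rfl fun γ _ => by simp; ring
    · intro q _ hq; simp [Ne.symm hq]
    · simp
  · refine Finset.sum_eq_zero fun l _ => Finset.sum_eq_zero fun q _ => ?_
    by_cases h : β = l
    · subst h; simp [Matrix.one_apply_ne (Ne.symm hαβ)]
    · simp [h]

theorem cMat_apply (i j : Fin n) (α β : Fin d) :
    cMat n d (i, β) (α, j) = if i = j then if α = β then 1 else 0 else 0 := by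
  unfold cMat
  simp only [Matrix.sum_apply, Matrix.kroneckerMap_apply, Matrix.single_apply]
  rw [Finset.sum_eq_single i, Finset.sum_eq_single α]
  · by_cases h1 : i = j
    · by_cases h2 : α = β <;> simp [h1, h2]
    · simp [h1]
  · intro r _ hr; simp [hr]
  · simp
  · intro r _ hr; simp [hr]
  · simp

/-- Indices of the entries of a point `(A, B)` of `S(n,d)`. -/
abbrev SIdx (n d : ℕ) := (Fin n × Fin d) ⊕ (Fin d × Fin n)

/-- The basis vectors of `S(n,d)`. -/
def eS : SIdx n d → S n d
  | .inl (i, α) => (Pi.single i (Pi.single α 1), 0)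
  | .inr (α, i) => (0, Pi.single α (Pi.single i 1))

/-- The components of `tensorOf`. -/
def compOf (AA : S n d → Matrix (Fin n × Fin n) (Fin d × Fin d) ℂ)
    (BB : S n d → Matrix (Fin d × Fin d) (Fin n × Fin n) ℂ)
    (AB : S n d → Matrix (Fin n × Fin d) (Fin d × Fin n) ℂ) : SIdx n d → SIdx n d → S n d → ℂ
  | .inl (i, α), .inl (j, β), x => AA x (i, j) (α, β)
  | .inl (i, α), .inr (β, j), x => AB x (i, β) (α, j)
  | .inr (β, j), .inl (i, α), x => -AB x (i, β) (α, j)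
  | .inr (α, i), .inr (β, j), x => BB x (α, β) (i, j)

theorem tensorOf_eq (AA : S n d → Matrix (Fin n × Fin n) (Fin d × Fin d) ℂ)
    (BB : S n d → Matrix (Fin d × Fin d) (Fin n × Fin n) ℂ)
    (AB : S n d → Matrix (Fin n × Fin d) (Fin d × Fin n) ℂ) :
    tensorOf AA BB AB = coordTensor eS (compOf AA BB AB) := by
  funext x φ ψ
  unfold coordTensor tensorOf
  simp only [Fintype.sum_sum_type, Fintype.sum_prod_type, compOf, eS]
  have perm : ∀ F : Fin n → Fin n → Fin d → Fin d → ℂ,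
      ∑ i, ∑ α, ∑ j, ∑ β, F i j α β = ∑ i, ∑ j, ∑ α, ∑ β, F i j α β := fun F =>
    Finset.sum_congr rfl fun i _ => Finset.sum_comm
  have perm2 : ∀ F : Fin n → Fin n → Fin d → Fin d → ℂ,
      ∑ i, ∑ α, ∑ β, ∑ j, F i j α β = ∑ i, ∑ j, ∑ α, ∑ β, F i j α β := fun F => by
    rw [← perm]
    exact Finset.sum_congr rfl fun i _ => Finset.sum_congr rfl fun α _ => Finset.sum_comm
  have perm3 : ∀ F : Fin n → Fin n → Fin d → Fin d → ℂ,
      ∑ β, ∑ j, ∑ i, ∑ α, F i j α β = ∑ i, ∑ j, ∑ α, ∑ β, F i j α β := fun F => by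
    rw [Finset.sum_comm]
    rw [Finset.sum_comm (s := Finset.univ (α := Fin n)) (t := Finset.univ (α := Fin n))
      (f := fun i j => ∑ α, ∑ β, F i j α β)]
    refine Finset.sum_congr rfl fun j _ => ?_
    rw [Finset.sum_comm]
    exact Finset.sum_congr rfl fun i _ => Finset.sum_comm
  have perm4 : ∀ F : Fin n → Fin n → Fin d → Fin d → ℂ,
      ∑ α, ∑ i, ∑ β, ∑ j, F i j α β = ∑ i, ∑ j, ∑ α, ∑ β, F i j α β := fun F => by
    rw [← perm2, Finset.sum_comm]
  simp only [Finset.sum_add_distrib]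
  rw [perm (fun i j α β => AA x (i, j) (α, β) * φ (Pi.single i (Pi.single α 1), 0)
      * ψ (Pi.single j (Pi.single β 1), 0)),
    perm2 (fun i j α β => AB x (i, β) (α, j) * φ (Pi.single i (Pi.single α 1), 0)
      * ψ (0, Pi.single β (Pi.single j 1))),
    perm3 (fun i j α β => -AB x (i, β) (α, j) * φ (0, Pi.single β (Pi.single j 1))
      * ψ (Pi.single i (Pi.single α 1), 0)),
    perm4 (fun i j α β => BB x (α, β) (i, j) * φ (0, Pi.single α (Pi.single i 1))
      * ψ (0, Pi.single β (Pi.single j 1)))]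
  simp only [← Finset.sum_add_distrib]
  refine Finset.sum_congr rfl fun i _ => Finset.sum_congr rfl fun j _ =>
    Finset.sum_congr rfl fun α _ => Finset.sum_congr rfl fun β _ => ?_
  ring

/-- The components of `{ , }_κ` on `S(n,1)`. -/
def compK (κ : ℂ) (n : ℕ) : SIdx n 1 → SIdx n 1 → S n 1 → ℂ
  | .inl (i, _), .inl (j, _), x => -κ / 2 * sg i j * (x.1 i 0 * x.1 j 0)
  | .inl (i, _), .inr (_, j), x => κ / 2 * (x.1 i 0 * x.2 0 j)
      + if i = j then κ / 2 * (G i x + G (i + 1) x) else 0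
  | .inr (_, j), .inl (i, _), x => -(κ / 2 * (x.1 i 0 * x.2 0 j)
      + if i = j then κ / 2 * (G i x + G (i + 1) x) else 0)
  | .inr (_, i), .inr (_, j), x => κ / 2 * sg i j * (x.2 0 i * x.2 0 j)

/-- The components of `{ , }'_κ` on `S(n,d)`. -/
def compK' (κ : ℂ) (n d : ℕ) : SIdx n d → SIdx n d → S n d → ℂ
  | .inl (i, α), .inl (j, β), x => κ / 2 * (sg i j + sg α β) * (x.1 j α * x.1 i β)
  | .inl (i, α), .inr (β, j), x => κ * (
      -(if i = j then ∑ l, rho i l * (x.1 l α * x.2 β l) else 0)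
      - (if α = β then ∑ γ, rho α γ * (x.1 i γ * x.2 γ j) else 0)
      + if i = j then if α = β then 1 else 0 else 0)
  | .inr (β, j), .inl (i, α), x => -(κ * (
      -(if i = j then ∑ l, rho i l * (x.1 l α * x.2 β l) else 0)
      - (if α = β then ∑ γ, rho α γ * (x.1 i γ * x.2 γ j) else 0)
      + if i = j then if α = β then 1 else 0 else 0))
  | .inr (α, i), .inr (β, j), x => -κ / 2 * (sg i j + sg α β) * (x.2 α j * x.2 β i)

theorem G_eq_tail (j : ℕ) (x : S n 1) : G j x = 1 + tail (fun k => x.1 k 0 * x.2 0 k) j := rfl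

theorem G_last (x : S n 1) : G n x = 1 := by rw [G_eq_tail, tail_last, add_zero]

theorem G_step (x : S n 1) (i : Fin n) : G i x = G (i + 1) x + x.1 i 0 * x.2 0 i := by
  rw [G_eq_tail, G_eq_tail, tail_step, add_assoc]

/-- For d = 1 the matrix r^d vanishes and r^d_+ is the scalar 1/2. The contraction with r^n_+ is an
average of tails by `rho_sum`, and the constant C_12 completes it to (G_i + G_{i+1})/2. -/
theorem tensorK_eq (κ : ℂ) (n : ℕ) : tensorK κ n 1 = coordTensor eS (compK κ n) := by
  unfold tensorK
  rw [tensorOf_eq]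
  congr 1
  have hAB : ∀ (x : S n 1) (i j : Fin n) (α β : Fin 1), (κ • (sandwichN (rPlus n) (matA x) (matB x)
      + sandwichD (rPlus 1) (matA x) (matB x) + cMat n 1)) (i, β) (α, j)
      = κ / 2 * (x.1 i 0 * x.2 0 j) + if i = j then κ / 2 * (G i x + G (i + 1) x) else 0 := by
    intro x i j α β
    rw [Matrix.smul_apply, Matrix.add_apply, Matrix.add_apply, sandwichN_apply rPlus_apply,
      sandwichD_apply rPlus_apply, cMat_apply, Subsingleton.elim α 0, Subsingleton.elim β 0]
    simp only [matA, matB, Matrix.of_apply, if_true, Fin.sum_univ_one, rho_self, smul_eq_mul]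
    rw [rho_sum (fun l => x.1 l 0 * x.2 0 l), G_eq_tail, G_eq_tail]
    split_ifs <;> ring
  funext p q x
  rcases p with ⟨i, α⟩ | ⟨α, i⟩ <;> rcases q with ⟨j, β⟩ | ⟨β, j⟩
  · simp only [compOf, compK, Matrix.smul_apply, Matrix.add_apply, rMat_mul_kron, kron_mul_rMat,
      Subsingleton.elim α 0, Subsingleton.elim β 0, sg_self, matA, Matrix.of_apply, smul_eq_mul]
    ring
  · exact hAB x i j α β
  · exact congrArg Neg.neg (hAB x j i β α)
  · simp only [compOf, compK, Matrix.smul_apply, Matrix.add_apply, rMat_mul_kron, kron_mul_rMat,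
      Subsingleton.elim α 0, Subsingleton.elim β 0, sg_self, matB, Matrix.of_apply, smul_eq_mul]
    ring

theorem tensorK'_eq (κ : ℂ) (n d : ℕ) : tensorK' κ n d = coordTensor eS (compK' κ n d) := by
  unfold tensorK'
  rw [tensorOf_eq]
  congr 1
  have hAB : ∀ (x : S n d) (i j : Fin n) (α β : Fin d),
      (κ • (-sandwichN (rPlus n) (matA x) (matB x)
      + sandwichD (rMinus d) (matA x) (matB x) + cMat n d)) (i, β) (α, j)
      = κ * (-(if i = j then ∑ l, rho i l * (x.1 l α * x.2 β l) else 0)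
      - (if α = β then ∑ γ, rho α γ * (x.1 i γ * x.2 γ j) else 0)
      + if i = j then if α = β then 1 else 0 else 0) := by
    intro x i j α β
    rw [Matrix.smul_apply, Matrix.add_apply, Matrix.add_apply, Matrix.neg_apply,
      sandwichN_apply rPlus_apply, sandwichD_apply (c := fun i p => -rho p i) rMinus_apply,
      cMat_apply]
    simp only [matA, matB, Matrix.of_apply, smul_eq_mul, neg_mul, Finset.sum_neg_distrib]
    congr 2
    split_ifs <;> ring
  funext p q x
  rcases p with ⟨i, α⟩ | ⟨α, i⟩ <;> rcases q with ⟨j, β⟩ | ⟨β, j⟩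
  · simp only [compOf, compK', Matrix.smul_apply, Matrix.sub_apply, rMat_mul_kron, kron_mul_rMat,
      matA, Matrix.of_apply, smul_eq_mul]
    ring
  · exact hAB x i j α β
  · exact congrArg Neg.neg (hAB x j i β α)
  · simp only [compOf, compK', Matrix.smul_apply, Matrix.sub_apply, rMat_mul_kron, kron_mul_rMat,
      matB, Matrix.of_apply, smul_eq_mul]
    ring

end Components

end SpinPoisson

end

noncomputable section

namespace SpinPoisson

open Filter Topology

/-! ### One-jets of analytic functions -/

section Jets

variable {E : Type*} [NormedAddCommGroup E] [NormedSpace ℂ E]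

/-- The ring of functions analytic at `x`. -/
def analyticRing (x : E) : Subring (E → ℂ) where
  carrier := {f | AnalyticAt ℂ f x}
  mul_mem' hf hg := AnalyticAt.mul hf hg
  one_mem' := analyticAt_const
  add_mem' hf hg := AnalyticAt.add hf hg
  zero_mem' := analyticAt_const
  neg_mem' hf := AnalyticAt.neg hf

theorem analyticRing_prop {x : E} (f : analyticRing x) : AnalyticAt ℂ (f : E → ℂ) x := f.2

theorem analyticRing_diff {x : E} (f : analyticRing x) : DifferentiableAt ℂ (f : E → ℂ) x :=
  f.2.differentiableAt

/-- Pairs of a value and a differential. -/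
abbrev Jet (E : Type*) [NormedAddCommGroup E] [NormedSpace ℂ E] := TrivSqZeroExt ℂ (E →L[ℂ] ℂ)

/-- The one-jet of a function. -/
def jet (x : E) (f : E → ℂ) : Jet E := (f x, fderiv ℂ f x)

@[simp] theorem jet_fst (x : E) (f : E → ℂ) : (jet x f).fst = f x := rfl

@[simp] theorem jet_snd (x : E) (f : E → ℂ) : (jet x f).snd = fderiv ℂ f x := rfl

/-- Relations such as s_j² = G_j hold only on the domain of the branches, so they are not identities
in `analyticRing`; they become identities between jets. -/
theorem jet_congr {x : E} {f g : E → ℂ} (h : f =ᶠ[𝓝 x] g) : jet x f = jet x g :=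
  TrivSqZeroExt.ext h.eq_of_nhds h.fderiv_eq

theorem fderiv_mul' {x : E} {f g : E → ℂ} (hf : DifferentiableAt ℂ f x)
    (hg : DifferentiableAt ℂ g x) :
    fderiv ℂ (f * g) x = f x • fderiv ℂ g x + g x • fderiv ℂ f x :=
  (hf.hasFDerivAt.mul hg.hasFDerivAt).fderiv

/-- The one-jet, as a ring homomorphism. -/
def jetHom (x : E) : analyticRing x →+* Jet E where
  toFun f := jet x f
  map_one' := TrivSqZeroExt.ext rfl (fderiv_const_apply (1 : ℂ))
  map_zero' := TrivSqZeroExt.ext rfl (fderiv_const_apply (0 : ℂ))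
  map_add' f g := TrivSqZeroExt.ext rfl (fderiv_add (analyticRing_diff f) (analyticRing_diff g))
  map_mul' f g := TrivSqZeroExt.ext rfl <| by
    rw [TrivSqZeroExt.snd_mul]
    simp only [jet_snd, jet_fst, op_smul_eq_smul]
    exact fderiv_mul' (analyticRing_diff f) (analyticRing_diff g)

/-- The value of a jet. -/
def jetEv (E : Type*) [NormedAddCommGroup E] [NormedSpace ℂ E] : Jet E →+* ℂ :=
  (TrivSqZeroExt.fstHom ℂ ℂ (E →L[ℂ] ℂ)).toRingHom

theorem jetEv_jet (x : E) (f : E → ℂ) : jetEv E (jet x f) = f x := rfl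

/-- Any linear functional of the differential is a derivation of the jet ring. Both the bracket with
a fixed function and the directional derivatives arise in this way. -/
theorem isDer_jet (l : (E →L[ℂ] ℂ) → ℂ) (hadd : ∀ φ ψ, l (φ + ψ) = l φ + l ψ)
    (hsmul : ∀ (c : ℂ) φ, l (c • φ) = c * l φ) : IsDer (jetEv E) (fun u : Jet E => l u.snd) where
  add u v := hadd _ _
  mul u v := by
    rw [TrivSqZeroExt.snd_mul, hadd, op_smul_eq_smul, hsmul, hsmul]; rfl

variable {ι : Type*} [Fintype ι]

theorem coordTensor_add_left (e : ι → E) (Λ : ι → ι → E → ℂ) (x : E) (φ φ' ψ : E →L[ℂ] ℂ) :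
    coordTensor e Λ x (φ + φ') ψ = coordTensor e Λ x φ ψ + coordTensor e Λ x φ' ψ := by
  simp only [coordTensor, ← Finset.sum_add_distrib, add_apply]
  exact Finset.sum_congr rfl fun p _ => Finset.sum_congr rfl fun q _ => by ring

theorem coordTensor_smul_left (e : ι → E) (Λ : ι → ι → E → ℂ) (x : E) (c : ℂ)
    (φ ψ : E →L[ℂ] ℂ) : coordTensor e Λ x (c • φ) ψ = c * coordTensor e Λ x φ ψ := by
  simp only [coordTensor, Finset.mul_sum, smul_apply, smul_eq_mul]
  exact Finset.sum_congr rfl fun p _ => Finset.sum_congr rfl fun q _ => by ring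

theorem coordTensor_dual {e : ι → E} {Λ : ι → ι → E → ℂ} [DecidableEq ι] {x : E}
    {φ ψ : E →L[ℂ] ℂ} {p q : ι} (hφ : ∀ r, φ (e r) = if r = p then 1 else 0)
    (hψ : ∀ r, ψ (e r) = if r = q then 1 else 0) : coordTensor e Λ x φ ψ = Λ p q x := by
  simp [coordTensor, hφ, hψ]

theorem isBider_jet {e : ι → E} {Λ : ι → ι → E → ℂ} (hanti : ∀ p q x, Λ p q x = -Λ q p x)
    (x : E) : IsBider (jetEv E) (fun u v : Jet E => coordTensor e Λ x u.snd v.snd) where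
  der_left w := isDer_jet (fun φ => coordTensor e Λ x φ w.snd)
    (fun _ _ => coordTensor_add_left _ _ _ _ _ _) (fun _ _ => coordTensor_smul_left _ _ _ _ _ _)
  anti _ _ := coordTensor_anti hanti _ _ _

end Jets

/-! ### Branches of square roots -/

/-- The branch is compared with the explicit analytic root `g` = s(x) (f / f(x))^{1/2}. Since (s -
g)(s + g) = 0 and s + g is nonzero near x by continuity, the two agree there. -/
theorem analyticAt_sqrt_branch {E : Type*} [NormedAddCommGroup E] [NormedSpace ℂ E]
    {f s : E → ℂ} {x : E} (hf : AnalyticAt ℂ f x) (hs : ContinuousAt s x) (h0 : s x ≠ 0)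
    (hsq : ∀ᶠ y in 𝓝 x, s y ^ 2 = f y) : AnalyticAt ℂ s x := by
  have hfx : f x = s x ^ 2 := hsq.self_of_nhds.symm
  have hfx0 : f x ≠ 0 := by rw [hfx]; exact pow_ne_zero 2 h0
  set g : E → ℂ := fun y => s x * (f y / f x) ^ ((2 : ℕ) : ℂ)⁻¹ with hg
  have hga : AnalyticAt ℂ g x := by
    refine analyticAt_const.mul (AnalyticAt.cpow (hf.div analyticAt_const hfx0) analyticAt_const ?_)
    rw [div_self hfx0]; exact Complex.one_mem_slitPlane
  have hg2 : ∀ y, g y ^ 2 = f y := fun y => by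
    simp only [hg]
    rw [mul_pow, Complex.cpow_nat_inv_pow _ two_ne_zero, ← hfx]
    field_simp
  have hgx : g x = s x := by simp [hg, div_self hfx0]
  have hne : ∀ᶠ y in 𝓝 x, s y + g y ≠ 0 := by
    have hc : ContinuousAt (fun y => s y + g y) x := hs.add hga.continuousAt
    refine hc.eventually_ne ?_
    rw [hgx, ← two_mul]; exact mul_ne_zero two_ne_zero h0
  refine hga.congr ?_
  filter_upwards [hne, hsq] with y h1 h2
  have : (s y - g y) * (s y + g y) = 0 := by linear_combination h2 - hg2 y
  exact (sub_eq_zero.1 ((mul_eq_zero.1 this).resolve_right h1)).symm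

/-! ### Analyticity of the roots; coordinates on S(n,d) and on the product -/

section Copy

variable {n d : ℕ}

theorem analyticAt_fst (i : Fin n) (α : Fin d) (x : S n d) :
    AnalyticAt ℂ (fun y : S n d => y.1 i α) x :=
  ((ContinuousLinearMap.proj (R := ℂ) (φ := fun _ : Fin d => ℂ) α).comp
    ((ContinuousLinearMap.proj (R := ℂ) (φ := fun _ : Fin n => Fin d → ℂ) i).comp
      (ContinuousLinearMap.fst ℂ (Fin n → Fin d → ℂ) (Fin d → Fin n → ℂ)))).analyticAt x

theorem analyticAt_snd (i : Fin n) (α : Fin d) (x : S n d) :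
    AnalyticAt ℂ (fun y : S n d => y.2 α i) x :=
  ((ContinuousLinearMap.proj (R := ℂ) (φ := fun _ : Fin n => ℂ) i).comp
    ((ContinuousLinearMap.proj (R := ℂ) (φ := fun _ : Fin d => Fin n → ℂ) α).comp
      (ContinuousLinearMap.snd ℂ (Fin n → Fin d → ℂ) (Fin d → Fin n → ℂ)))).analyticAt x

theorem analyticAt_G (j : ℕ) (x : S n 1) : AnalyticAt ℂ (G j) x := by
  refine analyticAt_const.add (Finset.analyticAt_fun_sum _ fun k _ => ?_)
  split_ifs
  · exact (analyticAt_fst k 0 x).mul (analyticAt_snd k 0 x)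
  · exact analyticAt_const

theorem IsRootBranch.analyticAt {U : Set (S n 1)} {s : ℕ → S n 1 → ℂ} (hU : IsOpen U)
    (h : IsRootBranch U s) {j : ℕ} (hj : j ≤ n) {x : S n 1} (hx : x ∈ U) :
    AnalyticAt ℂ (s j) x :=
  analyticAt_sqrt_branch (analyticAt_G j x) ((h j hj).1.continuousAt (hU.mem_nhds hx))
    ((h j hj).2 x hx).1
    (by filter_upwards [hU.mem_nhds hx] with y hy using ((h j hj).2 y hy).2)

/-- The coordinate functions of `S(n,d)`, as continuous linear forms. -/
def cS : SIdx n d → S n d →L[ℂ] ℂ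
  | .inl (i, α) => (ContinuousLinearMap.proj (R := ℂ) (φ := fun _ : Fin d => ℂ) α).comp
    ((ContinuousLinearMap.proj (R := ℂ) (φ := fun _ : Fin n => Fin d → ℂ) i).comp
      (ContinuousLinearMap.fst ℂ (Fin n → Fin d → ℂ) (Fin d → Fin n → ℂ)))
  | .inr (α, i) => (ContinuousLinearMap.proj (R := ℂ) (φ := fun _ : Fin n => ℂ) i).comp
    ((ContinuousLinearMap.proj (R := ℂ) (φ := fun _ : Fin d => Fin n → ℂ) α).comp
      (ContinuousLinearMap.snd ℂ (Fin n → Fin d → ℂ) (Fin d → Fin n → ℂ)))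

theorem cS_inl (i : Fin n) (α : Fin d) (x : S n d) : cS (.inl (i, α)) x = x.1 i α := rfl

theorem cS_inr (i : Fin n) (α : Fin d) (x : S n d) : cS (.inr (α, i)) x = x.2 α i := rfl

theorem cS_eS (p q : SIdx n d) : cS p (eS q) = if q = p then 1 else 0 := by
  rcases p with ⟨i, α⟩ | ⟨α, i⟩ <;> rcases q with ⟨j, β⟩ | ⟨β, j⟩
  · simp only [cS_inl, eS, Pi.single_apply, Sum.inl.injEq, Prod.mk.injEq]
    by_cases h1 : i = j
    · subst h1; simp [Pi.single_apply, eq_comm]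
    · simp [h1, Ne.symm h1]
  · simp [cS_inl, eS]
  · simp [cS_inr, eS]
  · simp only [cS_inr, eS, Pi.single_apply, Sum.inr.injEq, Prod.mk.injEq]
    by_cases h1 : α = β
    · subst h1; simp [Pi.single_apply, eq_comm]
    · simp [h1, Ne.symm h1]

theorem ext_cS {x y : S n d} (h : ∀ p, cS p x = cS p y) : x = y :=
  Prod.ext (funext fun i => funext fun α => h (.inl (i, α)))
    (funext fun α => funext fun i => h (.inr (α, i)))

theorem sum_cS (x : S n d) : ∑ p, cS p x • eS p = x := by
  refine ext_cS fun p => ?_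
  rw [map_sum]
  simp [cS_eS]

theorem clm_eq_sum (φ : S n d →L[ℂ] ℂ) (x : S n d) : φ x = ∑ p, φ (eS p) * cS p x := by
  conv_lhs => rw [← sum_cS x]
  rw [map_sum]
  exact Finset.sum_congr rfl fun p _ => by rw [map_smul, smul_eq_mul, mul_comm]

/-! ### The product bracket in coordinates -/

theorem prodTensor_eq {E : Type*} [NormedAddCommGroup E] [NormedSpace ℂ E] {ι : Type*} [Fintype ι]
    (d : ℕ) (e : ι → E) (Λ : ι → ι → E → ℂ) :
    prodTensor d (coordTensor e Λ) = coordTensor (fun p : Fin d × ι => Pi.single p.1 (e p.2))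
      (fun p q x => if p.1 = q.1 then Λ p.2 q.2 (x p.1) else 0) := by
  funext x φ ψ
  simp only [prodTensor, coordTensor, Fintype.sum_prod_type, ContinuousLinearMap.comp_apply,
    ContinuousLinearMap.single_apply]
  refine Finset.sum_congr rfl fun α _ => Finset.sum_congr rfl fun p _ => ?_
  rw [Finset.sum_eq_single α]
  · simp
  · intro β _ hβ; simp [Ne.symm hβ]
  · simp

theorem compK_anti (κ : ℂ) (n : ℕ) (p q : SIdx n 1) (x : S n 1) :
    compK κ n p q x = -compK κ n q p x := by
  rcases p with ⟨i, α⟩ | ⟨α, i⟩ <;> rcases q with ⟨j, β⟩ | ⟨β, j⟩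
  · simp only [compK]; rw [sg_anti]; ring
  · simp only [compK]; ring
  · simp only [compK]
  · simp only [compK]; rw [sg_anti]; ring

theorem compK'_anti (κ : ℂ) (n d : ℕ) (p q : SIdx n d) (x : S n d) :
    compK' κ n d p q x = -compK' κ n d q p x := by
  rcases p with ⟨i, α⟩ | ⟨α, i⟩ <;> rcases q with ⟨j, β⟩ | ⟨β, j⟩
  · simp only [compK']; rw [sg_anti i, sg_anti α]; ring
  · simp only [compK']; ring
  · simp only [compK']
  · simp only [compK']; rw [sg_anti i, sg_anti α]; ring

/-- The components of the product bracket on `S(n,1)^d`. -/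
def compProd (κ : ℂ) (n d : ℕ) (p q : Fin d × SIdx n 1) (x : Fin d → S n 1) : ℂ :=
  if p.1 = q.1 then compK κ n p.2 q.2 (x p.1) else 0

/-- The basis vectors of `S(n,1)^d`. -/
def eProd (p : Fin d × SIdx n 1) : Fin d → S n 1 := Pi.single p.1 (eS p.2)

theorem prodTensorK_eq (κ : ℂ) (n d : ℕ) :
    prodTensor d (tensorK κ n 1) = coordTensor eProd (compProd κ n d) := by
  rw [tensorK_eq, prodTensor_eq]; rfl

theorem compProd_anti (κ : ℂ) (n d : ℕ) (p q : Fin d × SIdx n 1) (x : Fin d → S n 1) :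
    compProd κ n d p q x = -compProd κ n d q p x := by
  unfold compProd
  by_cases h : p.1 = q.1
  · rw [if_pos h, if_pos h.symm, compK_anti, h]
  · rw [if_neg h, if_neg (Ne.symm h), neg_zero]

/-- The coordinate functions of `S(n,1)^d`. -/
def cProd (p : Fin d × SIdx n 1) : (Fin d → S n 1) →L[ℂ] ℂ :=
  (cS p.2).comp (ContinuousLinearMap.proj (R := ℂ) (φ := fun _ : Fin d => S n 1) p.1)

theorem cProd_eProd (p q : Fin d × SIdx n 1) : cProd p (eProd q) = if q = p then 1 else 0 := by
  obtain ⟨α, p⟩ := p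
  obtain ⟨β, q⟩ := q
  simp only [cProd, eProd, ContinuousLinearMap.comp_apply, ContinuousLinearMap.proj_apply,
    Prod.mk.injEq]
  by_cases h : β = α
  · subst h; simp [cS_eS]
  · simp [h]

end Copy

end SpinPoisson

end

noncomputable section

namespace SpinPoisson

open Filter Topology

section Map

variable {n d : ℕ}

/-! ### `F` in terms of the inverses of `g_+` and `g_-` -/

/-- The values `s_j(x)` for `j ≤ n`, continued by `1`. -/
def rootVal (s : ℕ → S n 1 → ℂ) (x : S n 1) (j : ℕ) : ℂ := if j ≤ n then s j x else 1

theorem rootVal_of_le (s : ℕ → S n 1 → ℂ) (x : S n 1) {j : ℕ} (hj : j ≤ n) :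
    rootVal s x j = s j x := if_pos hj

/-- `j ↦ a_j`. -/
def vecA (x : S n 1) (i : Fin n) : ℂ := x.1 i 0

/-- `j ↦ b_j`. -/
def vecB (x : S n 1) (i : Fin n) : ℂ := x.2 0 i

/-- The continuation by 1 beyond n makes this true for every natural j, so that the inverse roots
are analytic for all indices. -/
theorem IsRootBranch.ne_zero {U : Set (S n 1)} {s : ℕ → S n 1 → ℂ} (h : IsRootBranch U s)
    {x : S n 1} (hx : x ∈ U) (j : ℕ) : rootVal s x j ≠ 0 := by
  unfold rootVal
  split_ifs with hj
  · exact ((h j hj).2 x hx).1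
  · exact one_ne_zero

theorem IsRootBranch.sq {U : Set (S n 1)} {s : ℕ → S n 1 → ℂ} (h : IsRootBranch U s)
    {x : S n 1} (hx : x ∈ U) {j : ℕ} (hj : j ≤ n) : rootVal s x j ^ 2 = G j x := by
  rw [rootVal_of_le s x hj]
  exact ((h j hj).2 x hx).2

theorem IsRootBranch.rootData {U : Set (S n 1)} {s : ℕ → S n 1 → ℂ} (h : IsRootBranch U s)
    {x : S n 1} (hx : x ∈ U) :
    RootData (vecA x) (vecB x) (rootVal s x) (fun j => (rootVal s x j)⁻¹) where
  last := by rw [h.sq hx le_rfl, G_last]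
  step i := by rw [h.sq hx i.2.le, h.sq hx i.2]; exact G_step x i
  st j _ := mul_inv_cancel₀ (h.ne_zero hx j)

theorem gPlus_eq (s : ℕ → S n 1 → ℂ) (x : S n 1) :
    gPlus s x = gMat (vecA x) (vecB x) (rootVal s x) (fun j => (rootVal s x j)⁻¹) := by
  ext i p
  simp only [gPlus, gMat, hat, Matrix.of_apply, rootVal_of_le s x i.2.le, vecA, vecB,
    rootVal_of_le s x (show (i : ℕ) + 1 ≤ n from i.2), rootVal_of_le s x p.2.le,
    rootVal_of_le s x (show (p : ℕ) + 1 ≤ n from p.2)]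
  split_ifs
  · rw [div_eq_mul_inv]
  · rw [div_eq_mul_inv, mul_inv]; ring
  · rfl

theorem gMinusInv_eq (s : ℕ → S n 1 → ℂ) (x : S n 1) :
    gMinusInv s x = (gMat (vecB x) (vecA x) (rootVal s x) (fun j => (rootVal s x j)⁻¹))ᵀ := by
  ext i p
  simp only [gMinusInv, gMat, hat, Matrix.transpose_apply, Matrix.of_apply,
    rootVal_of_le s x i.2.le, vecA, vecB, rootVal_of_le s x (show (i : ℕ) + 1 ≤ n from i.2),
    rootVal_of_le s x p.2.le, rootVal_of_le s x (show (p : ℕ) + 1 ≤ n from p.2), eq_comm (a := p)]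
  split_ifs with h
  · rw [div_eq_mul_inv, h]
  · rw [div_eq_mul_inv, mul_inv]; ring
  · rfl

theorem IsRootBranch.gPlus_inv {U : Set (S n 1)} {s : ℕ → S n 1 → ℂ} (h : IsRootBranch U s)
    {x : S n 1} (hx : x ∈ U) : (gPlus s x)⁻¹
      = hMat (vecA x) (vecB x) (rootVal s x) (fun j => (rootVal s x j)⁻¹) := by
  rw [gPlus_eq]
  exact Matrix.inv_eq_right_inv (h.rootData hx).gMat_mul_hMat

theorem IsRootBranch.gMinus_eq {U : Set (S n 1)} {s : ℕ → S n 1 → ℂ} (h : IsRootBranch U s)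
    {x : S n 1} (hx : x ∈ U) : gMinus s x
      = (hMat (vecB x) (vecA x) (rootVal s x) (fun j => (rootVal s x j)⁻¹))ᵀ := by
  unfold gMinus
  rw [gMinusInv_eq, ← Matrix.transpose_nonsing_inv]
  exact congrArg _ (Matrix.inv_eq_right_inv (h.rootData hx).swap.gMat_mul_hMat)

/-- Transposition reverses the order of the product of the g_-, so the rows become dressed columns
with a and b exchanged. -/
theorem ascProd_transpose (N : Fin d → Matrix (Fin n) (Fin n) ℂ) (k : ℕ) :
    ascProd (fun β => (N β)ᵀ) k = (revProd N k)ᵀ := by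
  unfold ascProd revProd
  rw [Matrix.transpose_list_prod, List.map_reverse, List.reverse_reverse, List.map_map]
  rfl

/-- The domain of `F` for given branches. -/
def BranchDomain (U : Fin d → Set (S n 1)) (s : Fin d → ℕ → S n 1 → ℂ) : Prop :=
  ∀ α, IsOpen (U α) ∧ IsRootBranch (U α) (s α)

theorem mapF_fst {U : Fin d → Set (S n 1)} {s : Fin d → ℕ → S n 1 → ℂ} (hU : BranchDomain U s)
    {x : Fin d → S n 1} (hx : x ∈ Set.univ.pi U) (i : Fin n) (α : Fin d) :
    (mapF s x).1 i α = dressed (fun α => vecA (x α)) (fun α => vecB (x α))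
      (fun α => rootVal (s α) (x α)) (fun α j => (rootVal (s α) (x α) j)⁻¹) α i := by
  have : (fun β => (gPlus (s β) (x β))⁻¹) = fun β => hMat (vecA (x β)) (vecB (x β))
      (rootVal (s β) (x β)) (fun j => (rootVal (s β) (x β) j)⁻¹) :=
    funext fun β => (hU β).2.gPlus_inv (hx β (Set.mem_univ _))
  simp only [mapF, this]
  rfl

theorem mapF_snd {U : Fin d → Set (S n 1)} {s : Fin d → ℕ → S n 1 → ℂ} (hU : BranchDomain U s)
    {x : Fin d → S n 1} (hx : x ∈ Set.univ.pi U) (i : Fin n) (α : Fin d) :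
    (mapF s x).2 α i = dressed (fun α => vecB (x α)) (fun α => vecA (x α))
      (fun α => rootVal (s α) (x α)) (fun α j => (rootVal (s α) (x α) j)⁻¹) α i := by
  have : (fun β => gMinus (s β) (x β)) = fun β => (hMat (vecB (x β)) (vecA (x β))
      (rootVal (s β) (x β)) (fun j => (rootVal (s β) (x β) j)⁻¹))ᵀ :=
    funext fun β => (hU β).2.gMinus_eq (hx β (Set.mem_univ _))
  simp only [mapF, this, ascProd_transpose, Matrix.mul_apply, Matrix.transpose_apply]
  exact Finset.sum_congr rfl fun p _ => mul_comm _ _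

theorem isOpen_domain {U : Fin d → Set (S n 1)} {s : Fin d → ℕ → S n 1 → ℂ}
    (hU : BranchDomain U s) : IsOpen (Set.univ.pi U) :=
  isOpen_set_pi Set.finite_univ fun α _ => (hU α).1

theorem analyticAt_copy {f : S n 1 → ℂ} (α : Fin d) {x : Fin d → S n 1}
    (hf : AnalyticAt ℂ f (x α)) : AnalyticAt ℂ (fun y : Fin d → S n 1 => f (y α)) x :=
  AnalyticAt.comp (g := f) (f := fun y : Fin d → S n 1 => y α) hf
    ((ContinuousLinearMap.proj (R := ℂ) (φ := fun _ : Fin d => S n 1) α).analyticAt x)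

theorem analyticAt_rootVal {U : Fin d → Set (S n 1)} {s : Fin d → ℕ → S n 1 → ℂ}
    (hU : BranchDomain U s) {x : Fin d → S n 1} (hx : x ∈ Set.univ.pi U) (α : Fin d) (j : ℕ) :
    AnalyticAt ℂ (fun y : Fin d → S n 1 => rootVal (s α) (y α) j) x := by
  unfold rootVal
  split_ifs with hj
  · exact analyticAt_copy α ((hU α).2.analyticAt (hU α).1 hj (hx α (Set.mem_univ _)))
  · exact analyticAt_const

/-- The one-jets of the entries of `F`. -/
theorem mapF_jets {U : Fin d → Set (S n 1)} {s : Fin d → ℕ → S n 1 → ℂ}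
    (hU : BranchDomain U s) {x : Fin d → S n 1} (hx : x ∈ Set.univ.pi U) :
    ∃ a b : Fin d → Fin n → Jet (Fin d → S n 1), ∃ σ τ : Fin d → ℕ → Jet (Fin d → S n 1),
      (∀ α i, a α i = jet x (fun y => (y α).1 i 0)) ∧ (∀ α i, b α i = jet x (fun y => (y α).2 0 i))
      ∧ (∀ α, RootData (a α) (b α) (σ α) (τ α))
      ∧ (∀ α, ∀ j ≤ n, jetEv _ (σ α j) ^ 2 = G j (x α))
      ∧ (∀ i α, AnalyticAt ℂ (fun y => (mapF s y).1 i α) x ∧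
        jet x (fun y => (mapF s y).1 i α) = dressed a b σ τ α i)
      ∧ (∀ i α, AnalyticAt ℂ (fun y => (mapF s y).2 α i) x ∧
        jet x (fun y => (mapF s y).2 α i) = dressed b a σ τ α i) := by
  set ra : Fin d → Fin n → analyticRing x := fun α i =>
    ⟨fun y => vecA (y α) i, analyticAt_copy α (analyticAt_fst i 0 (x α))⟩ with hra
  set rb : Fin d → Fin n → analyticRing x := fun α i =>
    ⟨fun y => vecB (y α) i, analyticAt_copy α (analyticAt_snd i 0 (x α))⟩ with hrb
  set rs : Fin d → ℕ → analyticRing x := fun α j =>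
    ⟨fun y => rootVal (s α) (y α) j, analyticAt_rootVal hU hx α j⟩ with hrs
  set rt : Fin d → ℕ → analyticRing x := fun α j =>
    ⟨fun y => (rootVal (s α) (y α) j)⁻¹, (analyticAt_rootVal hU hx α j).inv
      ((hU α).2.ne_zero (hx α (Set.mem_univ _)) j)⟩ with hrt
  have nhd : ∀ᶠ y in 𝓝 x, y ∈ Set.univ.pi U := (isOpen_domain hU).mem_nhds hx
  have eval : ∀ (f : analyticRing x) (y : Fin d → S n 1), (f : (Fin d → S n 1) → ℂ) y
      = ((Pi.evalRingHom (fun _ => ℂ) y).comp (analyticRing x).subtype) f := fun _ _ => rfl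
  refine ⟨fun α i => jetHom x (ra α i), fun α i => jetHom x (rb α i),
    fun α j => jetHom x (rs α j), fun α j => jetHom x (rt α j), fun _ _ => rfl, fun _ _ => rfl,
    fun α => ?_, fun α j hj => ?_, fun i α => ?_, fun i α => ?_⟩
  · refine ⟨?_, fun i => ?_, fun j _ => ?_⟩
    · rw [← map_pow, ← map_one (jetHom x)]
      refine jet_congr ?_
      filter_upwards [nhd] with y hy
      exact ((hU α).2.rootData (hy α (Set.mem_univ _))).last
    · rw [← map_pow, ← map_pow, ← map_mul, ← map_add]
      refine jet_congr ?_
      filter_upwards [nhd] with y hy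
      exact ((hU α).2.rootData (hy α (Set.mem_univ _))).step i
    · rw [← map_mul, ← map_one (jetHom x)]
      refine jet_congr ?_
      filter_upwards [nhd] with y hy
      exact mul_inv_cancel₀ ((hU α).2.ne_zero (hy α (Set.mem_univ _)) j)
  · exact (hU α).2.sq (hx α (Set.mem_univ _)) hj
  -- The dressed vector is formed in the ring of analytic functions, compared with the entry of F
  -- near x, and then mapped to jets.
  · have e : ((dressed ra rb rs rt α i : analyticRing x) : (Fin d → S n 1) → ℂ)
        =ᶠ[𝓝 x] fun y => (mapF s y).1 i α := by
      filter_upwards [nhd] with y hy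
      rw [mapF_fst hU hy, eval, map_dressed]; rfl
    refine ⟨(analyticRing_prop _).congr e, ?_⟩
    rw [← map_dressed (jetHom x)]
    exact (jet_congr e).symm
  · have e : ((dressed rb ra rs rt α i : analyticRing x) : (Fin d → S n 1) → ℂ)
        =ᶠ[𝓝 x] fun y => (mapF s y).2 α i := by
      filter_upwards [nhd] with y hy
      rw [mapF_snd hU hy, eval, map_dressed]; rfl
    refine ⟨(analyticRing_prop _).congr e, ?_⟩
    rw [← map_dressed (jetHom x)]
    exact (jet_congr e).symm

theorem analyticAt_mapF {U : Fin d → Set (S n 1)} {s : Fin d → ℕ → S n 1 → ℂ}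
    (hU : BranchDomain U s) {x : Fin d → S n 1} (hx : x ∈ Set.univ.pi U) :
    AnalyticAt ℂ (mapF s) x := by
  obtain ⟨a, b, σ, τ, -, -, -, -, hA, hB⟩ := mapF_jets hU hx
  have h1 : AnalyticAt ℂ (fun y => (mapF s y).1) x :=
    AnalyticAt.pi fun i => AnalyticAt.pi fun α => (hA i α).1
  have h2 : AnalyticAt ℂ (fun y => (mapF s y).2) x :=
    AnalyticAt.pi fun α => AnalyticAt.pi fun i => (hB i α).1
  exact h1.prod h2

theorem fderiv_cS_comp {F : (Fin d → S n 1) → S n d} {x : Fin d → S n 1}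
    (hF : DifferentiableAt ℂ F x) (p : SIdx n d) :
    fderiv ℂ (fun y => cS p (F y)) x = (cS p).comp (fderiv ℂ F x) :=
  ((cS p).hasFDerivAt.comp x hF.hasFDerivAt).fderiv

/-- The derivative of `F` is injective. -/
theorem mapF_fderiv_injective {U : Fin d → Set (S n 1)} {s : Fin d → ℕ → S n 1 → ℂ}
    (hU : BranchDomain U s) {x : Fin d → S n 1} (hx : x ∈ Set.univ.pi U) :
    Function.Injective (fderiv ℂ (mapF s) x) := by
  rw [injective_iff_map_eq_zero]
  intro v hv
  obtain ⟨a, b, σ, τ, ha, hb, hd, -, hA, hB⟩ := mapF_jets hU hx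
  -- Differentiation along a vector `v` in the kernel of dF kills the jets of all entries of F,
  -- hence those of all coordinates, so `v` is zero.
  have hD : IsDer (jetEv (Fin d → S n 1)) (fun u : Jet (Fin d → S n 1) => u.snd v) :=
    isDer_jet (fun φ => φ v) (fun _ _ => rfl) (fun _ _ => rfl)
  have hF := (analyticAt_mapF hU hx).differentiableAt
  have hz : ∀ p, fderiv ℂ (fun y => cS p (mapF s y)) x v = 0 := fun p => by
    rw [fderiv_cS_comp hF, ContinuousLinearMap.comp_apply, hv, map_zero]
  have key := kill_of_dressed hD a b σ τ hd
    (fun α i => by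
      rw [← (hA i α).2, jet_snd]
      exact hz (.inl (i, α)))
    (fun α i => by
      rw [← (hB i α).2, jet_snd]
      exact hz (.inr (α, i)))
  have e : ∀ p : Fin d × SIdx n 1, fderiv ℂ (fun y => cProd p y) x = cProd p :=
    fun p => (cProd p).fderiv
  funext α
  refine Prod.ext (funext fun i => funext fun j => ?_) (funext fun j => funext fun i => ?_)
  · have := (key α).1 i
    rw [ha, jet_snd] at this
    rw [Subsingleton.elim j 0]
    exact (congrArg (fun φ => φ v) (e (α, .inl (i, 0)))).symm.trans this
  · have := (key α).2 i
    rw [hb, jet_snd] at this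
    rw [Subsingleton.elim j 0]
    exact (congrArg (fun φ => φ v) (e (α, .inr (0, i)))).symm.trans this

theorem prod_pairing (κ : ℂ) (x : Fin d → S n 1) (p q : Fin d × SIdx n 1) :
    coordTensor eProd (compProd κ n d) x (jet x (fun y => cProd p y)).snd
      (jet x (fun y => cProd q y)).snd = compProd κ n d p q x := by
  rw [jet_snd, jet_snd, (cProd p).fderiv, (cProd q).fderiv]
  exact coordTensor_dual (fun r => by rw [cProd_eProd]) (fun r => by rw [cProd_eProd])

/-- The entries of `F` have the brackets `{ , }'_κ`. -/
theorem mapF_components {U : Fin d → Set (S n 1)} {s : Fin d → ℕ → S n 1 → ℂ}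
    (hU : BranchDomain U s) (κ : ℂ) {x : Fin d → S n 1} (hx : x ∈ Set.univ.pi U)
    (p q : SIdx n d) :
    coordTensor eProd (compProd κ n d) x (fderiv ℂ (fun y => cS p (mapF s y)) x)
      (fderiv ℂ (fun y => cS q (mapF s y)) x) = compK' κ n d p q (mapF s x) := by
  obtain ⟨a, b, σ, τ, ha, hb, hd, hG, hA, hB⟩ := mapF_jets hU hx
  have hP := isBider_jet (e := eProd) (compProd_anti κ n d) x
  have ha' : ∀ α i, a α i = jet x (fun y => cProd (α, .inl (i, 0)) y) := ha
  have hb' : ∀ α i, b α i = jet x (fun y => cProd (α, .inr (0, i)) y) := hb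
  have hroot : ∀ α, RootRel (jetEv _)
      (fun u v => coordTensor eProd (compProd κ n d) x u.snd v.snd) κ (a α) (b α) (σ α) (τ α) := by
    intro α
    refine ⟨⟨(hd α).last, (hd α).step, fun i j => ?_, fun i j => ?_, fun i j => ?_⟩, (hd α).st⟩
    · simp only [ha', prod_pairing, jetEv_jet]
      simp only [compProd, if_true, compK]
      rfl
    · simp only [hb', prod_pairing, jetEv_jet]
      simp only [compProd, if_true, compK]
      rfl
    · simp only [ha', hb', prod_pairing, jetEv_jet, map_pow, hG α i i.2.le, hG α (i + 1) i.2]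
      simp only [compProd, if_true, compK]
      rfl
  have hcross : ∀ α β, α ≠ β → ∀ p q, compProd κ n d (α, p) (β, q) x = 0 :=
    fun α β h p q => if_neg h
  have rel := spinRel_dressed hP a b σ τ hroot (fun α β hαβ i j => by
    simp only [ha', hb', prod_pairing]
    exact ⟨hcross α β hαβ _ _, hcross α β hαβ _ _, hcross α β hαβ _ _⟩)
  have evA : ∀ α i, jetEv _ (dressed a b σ τ α i) = (mapF s x).1 i α := fun α i => by
    rw [← (hA i α).2, jetEv_jet]
  have evB : ∀ α i, jetEv _ (dressed b a σ τ α i) = (mapF s x).2 α i := fun α i => by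
    rw [← (hB i α).2, jetEv_jet]
  have jA : ∀ i α, fderiv ℂ (fun y => cS (.inl (i, α)) (mapF s y)) x
      = (dressed a b σ τ α i).snd := fun i α => by rw [← (hA i α).2, jet_snd]; rfl
  have jB : ∀ i α, fderiv ℂ (fun y => cS (.inr (α, i)) (mapF s y)) x
      = (dressed b a σ τ α i).snd := fun i α => by rw [← (hB i α).2, jet_snd]; rfl
  rcases p with ⟨i, α⟩ | ⟨α, i⟩ <;> rcases q with ⟨j, β⟩ | ⟨β, j⟩
  · rw [jA, jA, rel.aa]; simp only [evA, compK']
  · rw [jA, jB, rel.ab]; simp only [evA, evB, compK']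
  · rw [jA, jB, hP.anti, rel.ab]; simp only [evA, evB, compK']
  · rw [jB, jB, rel.bb]; simp only [evB, compK']

theorem coordTensor_sum {E : Type*} [NormedAddCommGroup E] [NormedSpace ℂ E] {ι ι' : Type*}
    [Fintype ι] [Fintype ι'] {e : ι → E} {Λ : ι → ι → E → ℂ} (hanti : ∀ p q x, Λ p q x = -Λ q p x)
    (x : E) (u v : ι' → ℂ) (φ : ι' → E →L[ℂ] ℂ) :
    coordTensor e Λ x (∑ p, u p • φ p) (∑ q, v q • φ q)
      = ∑ p, ∑ q, u p * v q * coordTensor e Λ x (φ p) (φ q) := by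
  have left : ∀ (w : ι' → ℂ) ψ, coordTensor e Λ x (∑ p, w p • φ p) ψ
      = ∑ p, w p * coordTensor e Λ x (φ p) ψ := by
    intro w ψ
    let L : (E →L[ℂ] ℂ) →ₗ[ℂ] ℂ :=
      { toFun := fun φ => coordTensor e Λ x φ ψ
        map_add' := fun φ φ' => coordTensor_add_left _ _ _ _ _ _
        map_smul' := fun c φ => coordTensor_smul_left _ _ _ _ _ _ }
    have := map_sum L (fun p => w p • φ p) Finset.univ
    simp only [map_smul, smul_eq_mul] at this
    exact this
  rw [left]
  refine Finset.sum_congr rfl fun p _ => ?_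
  rw [coordTensor_anti hanti, left, ← Finset.sum_neg_distrib, Finset.mul_sum]
  refine Finset.sum_congr rfl fun q _ => ?_
  rw [coordTensor_anti hanti]; ring

/-- By the chain rule the pulled-back differentials are combinations of those of the entries of F,
so the brackets of the entries suffice. -/
theorem mapF_isPoissonMapOn {U : Fin d → Set (S n 1)} {s : Fin d → ℕ → S n 1 → ℂ}
    (hU : BranchDomain U s) (κ : ℂ) :
    IsPoissonMapOn (prodTensor d (tensorK κ n 1)) (tensorK' κ n d) (mapF s) (Set.univ.pi U) := by
  intro O f g _ hf hg x hx hxO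
  have hF := (analyticAt_mapF hU hx).differentiableAt
  rw [prodTensorK_eq, tensorK'_eq]
  have comp : ∀ f : S n d → ℂ, DifferentiableAt ℂ f (mapF s x) → fderiv ℂ (f ∘ mapF s) x
      = ∑ p, fderiv ℂ f (mapF s x) (eS p) • fderiv ℂ (fun y => cS p (mapF s y)) x := by
    intro f hf
    rw [fderiv_comp x hf hF]
    ext v
    rw [ContinuousLinearMap.comp_apply, clm_eq_sum]
    simp only [fderiv_cS_comp hF, sum_apply, smul_apply, smul_eq_mul,
      ContinuousLinearMap.comp_apply]
  unfold bracket
  rw [comp f (hf _ hxO).differentiableAt, comp g (hg _ hxO).differentiableAt,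
    coordTensor_sum (compProd_anti κ n d)]
  unfold coordTensor
  refine Finset.sum_congr rfl fun p _ => Finset.sum_congr rfl fun q _ => ?_
  have := mapF_components hU κ hx p q
  unfold coordTensor at this
  rw [this]; ring

end Map

end SpinPoisson

end

noncomputable section

namespace SpinPoisson

/-! ### The Jacobi identity for `{ , }_κ` and its product -/

section Jacobi

section Algebra

variable {R : Type*} [CommRing R] {ev : R →+* ℂ} {P : R → R → ℂ} {κ : ℂ} {n : ℕ}
  {a b : Fin n → R} {g : ℕ → R} {c : ℂ → R}

theorem IsDer.const_mul {D : R → ℂ} (hD : IsDer ev D) (hc : ∀ z, ev (c z) = z)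
    (hDc : ∀ z, D (c z) = 0) (z : ℂ) (u : R) : D (c z * u) = z * D u := by
  rw [hD.mul, hDc, hc]; ring

/-- The bracket of `a_i` and `b_j`, as an element of the ring. -/
def brAB (c : ℂ → R) (κ : ℂ) (a b : Fin n → R) (g : ℕ → R) (i j : Fin n) : R :=
  c (κ / 2) * (a i * b j) + if i = j then c (κ / 2) * (g i + g (i + 1)) else 0

/-- The bracket of `a_i` and `a_j`, as an element of the ring. -/
def brAA (c : ℂ → R) (κ : ℂ) (a : Fin n → R) (i j : Fin n) : R :=
  c (-κ / 2 * sg i j) * (a i * a j)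

namespace CopyRel

/-- A log-canonical bracket satisfies the Jacobi identity for any antisymmetric coefficients; only
`sg_anti` is needed. -/
theorem jacobi_aaa (hP : IsBider ev P) (h : CopyRel ev P κ a b g) (hc : ∀ z, ev (c z) = z)
    (hPc : ∀ u z, P u (c z) = 0) (i j k : Fin n) :
    P (a i) (brAA c κ a j k) + P (a j) (brAA c κ a k i) + P (a k) (brAA c κ a i j) = 0 := by
  have key : ∀ i j k, P (a i) (brAA c κ a j k) = κ ^ 2 / 4 * (sg j k * (sg i j + sg i k)) *
      (ev (a i) * ev (a j) * ev (a k)) := fun i j k => by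
    unfold brAA
    rw [(hP.der_right _).const_mul hc (hPc _), (hP.der_right _).mul, h.aa, h.aa]; ring
  rw [key, key, key, sg_anti k i, sg_anti j i, sg_anti k j]; ring

/-- The one case with content: the brackets of a_i with the G_j inside {a_j, b_k} are given by
`g_a`. The case of two b's follows by `swap`. -/
theorem jacobi_aab (hP : IsBider ev P) (h : CopyRel ev P κ a b g) (hc : ∀ z, ev (c z) = z)
    (hPc : ∀ u z, P u (c z) = 0) (i j k : Fin n) :
    P (a i) (brAB c κ a b g j k) - P (a j) (brAB c κ a b g i k) + P (b k) (brAA c κ a i j) = 0 := by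
  have key : ∀ i j : Fin n, P (a i) (brAB c κ a b g j k)
      = κ ^ 2 / 4 * ((1 - sg i j) * (ev (a i) * ev (a j) * ev (b k))
        + (if i = k then ev (a j) * (ev (g i) + ev (g (i + 1))) else 0)
        + 2 * if j = k then ev (a i) * ((if (j : ℕ) ≤ i then 1 else 0) * ev (g j)
          + (if (j : ℕ) + 1 ≤ i then 1 else 0) * ev (g (j + 1))) else 0) := by
    intro i j
    have hD := hP.der_right (a i)
    have e : P (a i) (if j = k then c (κ / 2) * (g j + g (j + 1)) else 0) = if j = k then
        κ ^ 2 / 2 * (ev (a i) * ((if (j : ℕ) ≤ i then 1 else 0) * ev (g j)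
          + (if (j : ℕ) + 1 ≤ i then 1 else 0) * ev (g (j + 1)))) else 0 := by
      by_cases hjk : j = k
      · rw [if_pos hjk, if_pos hjk, hD.const_mul hc (hPc _), hD.add, hP.anti (a i),
          hP.anti (a i) (g (j + 1)), h.g_a hP i j j.2.le, h.g_a hP i (j + 1) j.2]
        ring
      · rw [if_neg hjk, if_neg hjk, hD.zero]
    unfold brAB
    rw [hD.add, e, hD.const_mul hc (hPc _), hD.mul, h.aa, h.ab]
    split_ifs <;> ring
  have key2 : P (b k) (brAA c κ a i j) = κ ^ 2 / 4 * (sg i j * (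
      2 * (ev (a i) * ev (a j) * ev (b k))
      + (if j = k then ev (a i) * (ev (g j) + ev (g (j + 1))) else 0)
      + (if i = k then ev (a j) * (ev (g i) + ev (g (i + 1))) else 0))) := by
    have hD := hP.der_right (b k)
    unfold brAA
    rw [hD.const_mul hc (hPc _), hD.mul, hP.anti (b k), hP.anti (b k) (a i), h.ab, h.ab]
    split_ifs <;> ring
  rw [key, key, key2, sg_anti j i]
  rcases lt_trichotomy i j with hij | rfl | hij
  · have h1 : (i : ℕ) + 1 ≤ j := hij
    have h2 : (i : ℕ) ≤ j := hij.le
    have h3 : ¬ (j : ℕ) ≤ i := not_le.2 hij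
    have h4 : ¬ (j : ℕ) + 1 ≤ i := by omega
    simp only [sg, hij, h1, h2, h3, h4, if_true, if_false]
    split_ifs <;> ring
  · rw [sg_self]; ring
  · have h1 : (j : ℕ) + 1 ≤ i := hij
    have h2 : (j : ℕ) ≤ i := hij.le
    have h3 : ¬ (i : ℕ) ≤ j := not_le.2 hij
    have h4 : ¬ (i : ℕ) + 1 ≤ j := by omega
    simp only [sg, hij, hij.not_gt, h1, h2, h3, h4, if_true, if_false]
    split_ifs <;> ring

end CopyRel

end Algebra

variable {n d : ℕ}

/-- With dual coordinates, `jacTerm` is the double bracket of the coordinate functions with indices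
k, p, q. -/
theorem jacTerm_eq {E : Type*} [NormedAddCommGroup E] [NormedSpace ℂ E] {ι : Type*} [Fintype ι]
    [DecidableEq ι] {e : ι → E} {Λ : ι → ι → E → ℂ} {co : ι → E →L[ℂ] ℂ}
    (hco : ∀ p q, co p (e q) = if q = p then 1 else 0) (x : E) (k p q : ι) :
    jacTerm e Λ x k p q = coordTensor e Λ x (fderiv ℂ (fun y => co k y) x) (fderiv ℂ (Λ p q) x) := by
  rw [coordTensor_eq, (co k).fderiv]
  unfold jacTerm
  exact Finset.sum_congr rfl fun l _ => by simp [hco]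

theorem isBider_analyticRing {E : Type*} [NormedAddCommGroup E] [NormedSpace ℂ E] {ι : Type*}
    [Fintype ι] {e : ι → E} {Λ : ι → ι → E → ℂ} (hanti : ∀ p q x, Λ p q x = -Λ q p x) (x : E) :
    IsBider ((Pi.evalRingHom (fun _ => ℂ) x).comp (analyticRing x).subtype)
      (fun u v : analyticRing x =>
        coordTensor e Λ x (fderiv ℂ (u : E → ℂ) x) (fderiv ℂ (v : E → ℂ) x)) where
  der_left w := by
    refine ⟨fun u v => ?_, fun u v => ?_⟩
    · rw [← coordTensor_add_left]
      congr 1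
      exact fderiv_add (analyticRing_diff u) (analyticRing_diff v)
    · have h := fderiv_mul' (analyticRing_diff u) (analyticRing_diff v)
      have e0 : fderiv ℂ ((u * v : analyticRing x) : E → ℂ) x = _ := h
      rw [e0, coordTensor_add_left, coordTensor_smul_left, coordTensor_smul_left]
      rfl
  anti _ _ := coordTensor_anti hanti _ _ _

/-- The relations between a, b and the G_j hold globally here, so `analyticRing` can be used without
passing to jets, and the components themselves can be bracketed again. -/
theorem compK_jacobi (κ : ℂ) (x : S n 1) (k p q : SIdx n 1) :
    jacTerm eS (compK κ n) x k p q + jacTerm eS (compK κ n) x p q k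
      + jacTerm eS (compK κ n) x q k p = 0 := by
  set ev : analyticRing x →+* ℂ :=
    (Pi.evalRingHom (fun _ => ℂ) x).comp (analyticRing x).subtype with hev
  set P : analyticRing x → analyticRing x → ℂ := fun u v =>
    coordTensor eS (compK κ n) x (fderiv ℂ (u : S n 1 → ℂ) x) (fderiv ℂ (v : S n 1 → ℂ) x) with hPdef
  have hP : IsBider ev P := isBider_analyticRing (compK_anti κ n) x
  set a : Fin n → analyticRing x := fun i => ⟨fun y => y.1 i 0, analyticAt_fst i 0 x⟩ with ha
  set b : Fin n → analyticRing x := fun i => ⟨fun y => y.2 0 i, analyticAt_snd i 0 x⟩ with hb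
  set g : ℕ → analyticRing x := fun j => ⟨G j, analyticAt_G j x⟩ with hg
  set c : ℂ → analyticRing x := fun z => ⟨fun _ => z, analyticAt_const⟩ with hcdef
  have hc : ∀ z, ev (c z) = z := fun _ => rfl
  have hPc : ∀ u z, P u (c z) = 0 := fun u z => by
    simp only [hPdef, hcdef]
    rw [fderiv_fun_const]
    simp [coordTensor]
  have pair : ∀ p q : SIdx n 1, coordTensor eS (compK κ n) x
      (fderiv ℂ (fun y => cS p y) x) (fderiv ℂ (fun y => cS q y) x) = compK κ n p q x := by
    intro p q
    rw [(cS p).fderiv, (cS q).fderiv]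
    exact coordTensor_dual (fun r => by rw [cS_eS]) (fun r => by rw [cS_eS])
  have h : CopyRel ev P κ a b g := by
    refine ⟨Subtype.ext (funext fun y => G_last y), fun i => Subtype.ext (funext fun y => G_step y i),
      fun i j => (pair (.inl (i, 0)) (.inl (j, 0))).trans ?_,
      fun i j => (pair (.inr (0, i)) (.inr (0, j))).trans ?_,
      fun i j => (pair (.inl (i, 0)) (.inr (0, j))).trans ?_⟩
    · rfl
    · rfl
    · rfl
  have jt : ∀ (k p q : SIdx n 1) (u v : analyticRing x), (∀ y, cS k y = (u : S n 1 → ℂ) y) →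
      (∀ y, compK κ n p q y = (v : S n 1 → ℂ) y) → jacTerm eS (compK κ n) x k p q = P u v := by
    intro k p q u v hu hv
    rw [jacTerm_eq cS_eS]
    simp only [hPdef]
    rw [funext hu, show compK κ n p q = _ from funext hv]
  have z : ∀ α : Fin 1, α = 0 := fun α => Subsingleton.elim _ _
  have eAA : ∀ (i j : Fin n) y, compK κ n (.inl (i, 0)) (.inl (j, 0)) y
      = ((brAA c κ a i j : analyticRing x) : S n 1 → ℂ) y := fun _ _ _ => rfl
  have eBB : ∀ (i j : Fin n) y, compK κ n (.inr (0, i)) (.inr (0, j)) y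
      = ((brAA c (-κ) b i j : analyticRing x) : S n 1 → ℂ) y := fun i j y => by
    show _ = - -κ / 2 * sg i j * (y.2 0 i * y.2 0 j)
    rw [neg_neg]; rfl
  have eAB : ∀ (i j : Fin n) y, compK κ n (.inl (i, 0)) (.inr (0, j)) y
      = ((brAB c κ a b g i j : analyticRing x) : S n 1 → ℂ) y := fun i j y => by
    unfold brAB
    split_ifs with hij <;> simp only [compK, hij, if_true, if_false] <;> rfl
  have eBA : ∀ (i j : Fin n) y, compK κ n (.inr (0, j)) (.inl (i, 0)) y
      = ((-brAB c κ a b g i j : analyticRing x) : S n 1 → ℂ) y := fun i j y => by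
    rw [compK_anti, eAB]; rfl
  -- The mixed components again, now as those of the swapped copy with -κ, which is the form needed
  -- for two b's and one a.
  have eBA' : ∀ (i j : Fin n) y, compK κ n (.inr (0, j)) (.inl (i, 0)) y
      = ((brAB c (-κ) b a g j i : analyticRing x) : S n 1 → ℂ) y := fun i j y => by
    rw [compK_anti, eAB]
    unfold brAB
    by_cases hij : i = j
    · subst hij
      simp only [if_true]
      show -(κ / 2 * (y.1 i 0 * y.2 0 i) + κ / 2 * (G i y + G (i + 1) y))
        = -κ / 2 * (y.2 0 i * y.1 i 0) + -κ / 2 * (G i y + G (i + 1) y)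
      ring
    · simp only [if_neg hij, if_neg (Ne.symm hij)]
      show -(κ / 2 * (y.1 i 0 * y.2 0 j) + 0) = -κ / 2 * (y.2 0 j * y.1 i 0) + 0
      ring
  have eAB' : ∀ (i j : Fin n) y, compK κ n (.inl (i, 0)) (.inr (0, j)) y
      = ((-brAB c (-κ) b a g j i : analyticRing x) : S n 1 → ℂ) y := fun i j y => by
    rw [compK_anti, eBA']; rfl
  have hs := h.swap hP
  have aab : ∀ i j k : Fin n, jacTerm eS (compK κ n) x (.inl (i, 0)) (.inl (j, 0)) (.inr (0, k))
      + jacTerm eS (compK κ n) x (.inl (j, 0)) (.inr (0, k)) (.inl (i, 0))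
      + jacTerm eS (compK κ n) x (.inr (0, k)) (.inl (i, 0)) (.inl (j, 0)) = 0 := fun i j k => by
    rw [jt _ _ _ (a i) _ (fun _ => rfl) (eAB j k), jt _ _ _ (a j) _ (fun _ => rfl) (eBA i k),
      jt _ _ _ (b k) _ (fun _ => rfl) (eAA i j), (hP.der_right _).neg]
    exact h.jacobi_aab hP hc hPc i j k
  have bba : ∀ i j k : Fin n, jacTerm eS (compK κ n) x (.inr (0, i)) (.inr (0, j)) (.inl (k, 0))
      + jacTerm eS (compK κ n) x (.inr (0, j)) (.inl (k, 0)) (.inr (0, i))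
      + jacTerm eS (compK κ n) x (.inl (k, 0)) (.inr (0, i)) (.inr (0, j)) = 0 := fun i j k => by
    rw [jt _ _ _ (b i) _ (fun _ => rfl) (eBA' k j), jt _ _ _ (b j) _ (fun _ => rfl) (eAB' k i),
      jt _ _ _ (a k) _ (fun _ => rfl) (eBB i j), (hP.der_right _).neg]
    exact hs.jacobi_aab hP hc hPc i j k
  -- Of the eight types of triples, the six mixed ones are cyclic rotations of `aab` and `bba`.
  rcases k with ⟨i, α⟩ | ⟨α, i⟩ <;> rcases p with ⟨j, β⟩ | ⟨β, j⟩ <;>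
    rcases q with ⟨k, γ⟩ | ⟨γ, k⟩ <;> rw [z α, z β, z γ]
  · rw [jt _ _ _ (a i) _ (fun _ => rfl) (eAA j k), jt _ _ _ (a j) _ (fun _ => rfl) (eAA k i),
      jt _ _ _ (a k) _ (fun _ => rfl) (eAA i j)]
    exact h.jacobi_aaa hP hc hPc i j k
  · exact aab i j k
  · linear_combination aab k i j
  · linear_combination bba j k i
  · linear_combination aab j k i
  · linear_combination bba k i j
  · exact bba i j k
  · rw [jt _ _ _ (b i) _ (fun _ => rfl) (eBB j k), jt _ _ _ (b j) _ (fun _ => rfl) (eBB k i),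
      jt _ _ _ (b k) _ (fun _ => rfl) (eBB i j)]
    exact hs.jacobi_aaa hP hc hPc i j k

theorem analyticAt_compK (κ : ℂ) (p q : SIdx n 1) (x : S n 1) : AnalyticAt ℂ (compK κ n p q) x := by
  have hAB : ∀ i j : Fin n, AnalyticAt ℂ (fun x : S n 1 => κ / 2 * (x.1 i 0 * x.2 0 j)
      + if i = j then κ / 2 * (G i x + G (i + 1) x) else 0) x := by
    intro i j
    refine (analyticAt_const.mul ((analyticAt_fst i 0 x).mul (analyticAt_snd j 0 x))).add ?_
    split_ifs
    · exact analyticAt_const.mul ((analyticAt_G _ x).add (analyticAt_G _ x))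
    · exact analyticAt_const
  rcases p with ⟨i, α⟩ | ⟨α, i⟩ <;> rcases q with ⟨j, β⟩ | ⟨β, j⟩
  · exact analyticAt_const.mul ((analyticAt_fst i 0 x).mul (analyticAt_fst j 0 x))
  · exact hAB i j
  · exact (hAB j i).neg
  · exact analyticAt_const.mul ((analyticAt_snd i 0 x).mul (analyticAt_snd j 0 x))

theorem analyticAt_compK' (κ : ℂ) (p q : SIdx n d) (x : S n d) :
    AnalyticAt ℂ (compK' κ n d p q) x := by
  have hAB : ∀ (i j : Fin n) (α β : Fin d), AnalyticAt ℂ (fun x : S n d => κ * (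
      -(if i = j then ∑ l, rho i l * (x.1 l α * x.2 β l) else 0)
      - (if α = β then ∑ γ, rho α γ * (x.1 i γ * x.2 γ j) else 0)
      + if i = j then if α = β then 1 else 0 else 0)) x := by
    intro i j α β
    refine analyticAt_const.mul ((AnalyticAt.sub (AnalyticAt.neg ?_) ?_).add analyticAt_const)
    · split_ifs
      · exact Finset.analyticAt_fun_sum _ fun l _ =>
          analyticAt_const.mul ((analyticAt_fst l α x).mul (analyticAt_snd l β x))
      · exact analyticAt_const
    · split_ifs
      · exact Finset.analyticAt_fun_sum _ fun γ _ =>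
          analyticAt_const.mul ((analyticAt_fst i γ x).mul (analyticAt_snd j γ x))
      · exact analyticAt_const
  rcases p with ⟨i, α⟩ | ⟨α, i⟩ <;> rcases q with ⟨j, β⟩ | ⟨β, j⟩
  · exact analyticAt_const.mul ((analyticAt_fst j α x).mul (analyticAt_fst i β x))
  · exact hAB i j α β
  · exact (hAB j i β α).neg
  · exact analyticAt_const.mul ((analyticAt_snd j α x).mul (analyticAt_snd i β x))

theorem analyticAt_compProd (κ : ℂ) (p q : Fin d × SIdx n 1) (x : Fin d → S n 1) :
    AnalyticAt ℂ (compProd κ n d p q) x := by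
  unfold compProd
  split_ifs
  · exact analyticAt_copy p.1 (analyticAt_compK κ p.2 q.2 (x p.1))
  · exact analyticAt_const

theorem compProd_jacTerm (κ : ℂ) (x : Fin d → S n 1) (α β γ : Fin d) (k p q : SIdx n 1) :
    jacTerm eProd (compProd κ n d) x (α, k) (β, p) (γ, q)
      = if α = β ∧ β = γ then jacTerm eS (compK κ n) (x α) k p q else 0 := by
  have hder : ∀ v, fderiv ℂ (compProd κ n d (β, p) (γ, q)) x v
      = if β = γ then fderiv ℂ (compK κ n p q) (x β) (v β) else 0 := by
    intro v
    unfold compProd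
    simp only
    split_ifs with hβγ
    · have h1 := ((analyticAt_compK κ p q (x β)).differentiableAt.hasFDerivAt).comp x
        (ContinuousLinearMap.proj (R := ℂ) (φ := fun _ : Fin d => S n 1) β).hasFDerivAt
      exact congrArg (fun φ => φ v) h1.fderiv
    · simp
  unfold jacTerm
  rw [Fintype.sum_prod_type, Finset.sum_eq_single α]
  · simp only [hder, compProd, if_true, eProd]
    by_cases h1 : α = β
    · subst h1
      simp
    · simp [h1]
  · intro δ _ hδ
    simp [compProd, Ne.symm hδ]
  · simp

theorem compProd_jacobi (κ : ℂ) (x : Fin d → S n 1) (k p q : Fin d × SIdx n 1) :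
    jacTerm eProd (compProd κ n d) x k p q + jacTerm eProd (compProd κ n d) x p q k
      + jacTerm eProd (compProd κ n d) x q k p = 0 := by
  obtain ⟨α, k⟩ := k
  obtain ⟨β, p⟩ := p
  obtain ⟨γ, q⟩ := q
  rw [compProd_jacTerm, compProd_jacTerm, compProd_jacTerm]
  by_cases h : α = β ∧ β = γ
  · obtain ⟨rfl, rfl⟩ := h
    simpa using compK_jacobi κ (x α) k p q
  · rw [if_neg h, if_neg (fun h' => h ⟨h'.2.symm.trans (h'.1.symm), h'.1⟩),
      if_neg (fun h' => h ⟨h'.2, h'.2.symm.trans h'.1.symm⟩)]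
    simp

theorem tensorK_isHolomorphicPoisson (κ : ℂ) (n : ℕ) : IsHolomorphicPoisson (tensorK κ n 1) := by
  rw [tensorK_eq]
  exact coordTensor_isHolomorphicPoisson (compK_anti κ n) (analyticAt_compK κ) (compK_jacobi κ)

theorem prodTensorK_isHolomorphicPoisson (κ : ℂ) (n d : ℕ) :
    IsHolomorphicPoisson (prodTensor d (tensorK κ n 1)) := by
  rw [prodTensorK_eq]
  exact coordTensor_isHolomorphicPoisson (compProd_anti κ n d) (analyticAt_compProd κ)
    (compProd_jacobi κ)

end Jacobi

end SpinPoisson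

end

noncomputable section

namespace SpinPoisson

open Filter Topology

section LocalDiffeo

variable {n d : ℕ}

/-! ### `F` is a local biholomorphism -/

theorem finrank_copies (n d : ℕ) :
    Module.finrank ℂ (Fin d → S n 1) = Module.finrank ℂ (S n d) := by
  simp [Module.finrank_pi_fintype, Module.finrank_prod]
  ring

/-- Equal dimensions turn injective derivatives into isomorphisms. Since this holds on all of Ω, the
local inverse restricted to Ω is analytic at every point of its target, not only at the image of x.
-/
theorem exists_biholomorphism {E E' : Type*} [NormedAddCommGroup E] [NormedSpace ℂ E]
    [NormedAddCommGroup E'] [NormedSpace ℂ E'] [FiniteDimensional ℂ E] [FiniteDimensional ℂ E']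
    (hrank : Module.finrank ℂ E = Module.finrank ℂ E') {Φ : E → E'} {Ω : Set E} (hΩ : IsOpen Ω)
    (hΦ : AnalyticOnNhd ℂ Φ Ω) (hinj : ∀ x ∈ Ω, Function.Injective (fderiv ℂ Φ x)) {x : E}
    (hx : x ∈ Ω) : ∃ e : OpenPartialHomeomorph E E', x ∈ e.source ∧ e.source ⊆ Ω ∧ ⇑e = Φ ∧
      IsBiholomorphism e := by
  have := FiniteDimensional.complete ℂ E
  have := FiniteDimensional.complete ℂ E'
  have equiv : ∀ x ∈ Ω, ∃ i : E ≃L[ℂ] E', fderiv ℂ Φ x = i := by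
    intro x hx
    refine ⟨(LinearEquiv.ofInjectiveOfFinrankEq (fderiv ℂ Φ x : E →ₗ[ℂ] E') (hinj x hx)
      hrank).toContinuousLinearEquiv, ?_⟩
    ext v
    exact congrArg (fun f : E →ₗ[ℂ] E' => f v)
      (LinearEquiv.coe_ofInjectiveOfFinrankEq (fderiv ℂ Φ x : E →ₗ[ℂ] E') (hinj x hx) hrank).symm
  obtain ⟨i, hi⟩ := equiv x hx
  have hs : HasStrictFDerivAt Φ (i : E →L[ℂ] E') x := hi ▸ (hΦ x hx).hasStrictFDerivAt
  refine ⟨(hs.toOpenPartialHomeomorph Φ).restrOpen Ω hΩ,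
    ⟨hs.mem_toOpenPartialHomeomorph_source, hx⟩, fun y hy => hy.2, rfl, fun y hy => hΦ y hy.2, ?_⟩
  intro y hy
  have hy' := OpenPartialHomeomorph.map_target _ hy
  obtain ⟨j, hj⟩ := equiv _ hy'.2
  exact OpenPartialHomeomorph.analyticAt_symm _ hy (hΦ _ hy'.2) hj

theorem mapF_isLocalPoissonDiffeoOn {U : Fin d → Set (S n 1)} {s : Fin d → ℕ → S n 1 → ℂ}
    (hU : BranchDomain U s) (κ : ℂ) :
    IsLocalPoissonDiffeoOn (prodTensor d (tensorK κ n 1)) (tensorK' κ n d) (mapF s)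
      (Set.univ.pi U) := by
  refine ⟨fun x hx => analyticAt_mapF hU hx, mapF_isPoissonMapOn hU κ, fun x hx => ?_⟩
  obtain ⟨e, h1, h2, h3, h4⟩ := exists_biholomorphism (finrank_copies n d) (isOpen_domain hU)
    (fun x hx => analyticAt_mapF hU hx) (fun x hx => mapF_fderiv_injective hU hx) hx
  exact ⟨e, h1, h2, fun y _ => congrFun h3 y, h4⟩

/-! ### The principal branches -/

/-- The points of `S(n,1)` at which all `G_j` have positive real part. -/
def posDomain (n : ℕ) : Set (S n 1) := {x | ∀ j ≤ n, 0 < (G j x).re}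

theorem isOpen_posDomain (n : ℕ) : IsOpen (posDomain n) := by
  have : posDomain n = ⋂ j ∈ Set.Iic n, {x | 0 < (G j x).re} := by
    ext x; simp [posDomain]
  rw [this]
  refine (Set.finite_Iic n).isOpen_biInter fun j _ => isOpen_lt continuous_const ?_
  exact Complex.continuous_re.comp
    (continuous_iff_continuousAt.2 fun x => (analyticAt_G j x).continuousAt)

theorem G_zero (j : ℕ) : G j (0 : S n 1) = 1 := by simp [G]

theorem zero_mem_posDomain (n : ℕ) : (0 : S n 1) ∈ posDomain n := fun j _ => by
  rw [G_zero]; exact one_pos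

theorem isRootBranch_principalRoot (n : ℕ) : IsRootBranch (posDomain n) principalRoot := by
  refine fun j hj => ⟨fun x hx => ContinuousAt.continuousWithinAt ?_, fun x hx => ?_⟩
  · exact (Complex.continuousAt_sqrt (Or.inl (hx j hj).le)).comp (analyticAt_G j x).continuousAt
  · have hsq : principalRoot j x ^ 2 = G j x := Complex.cpow_nat_inv_pow _ two_ne_zero
    refine ⟨fun h => ?_, hsq⟩
    have := hx j hj
    rw [← hsq, h] at this
    simp at this

theorem branchDomain_principalRoot (n d : ℕ) :
    BranchDomain (fun _ : Fin d => posDomain n) (fun _ => principalRoot) :=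
  fun _ => ⟨isOpen_posDomain n, isRootBranch_principalRoot n⟩

theorem zero_mem_pi_posDomain (n d : ℕ) :
    (0 : Fin d → S n 1) ∈ Set.univ.pi (fun _ : Fin d => posDomain n) :=
  fun _ _ => zero_mem_posDomain n

theorem mapF_zero (s : Fin d → ℕ → S n 1 → ℂ) : mapF s 0 = 0 := by
  refine Prod.ext ?_ ?_
  · funext i α
    simp [mapF, matA, Matrix.mul_apply]
  · funext α i
    simp [mapF, matB, Matrix.mul_apply]

/-! ### The Jacobi identity for `{ , }'_κ` -/

/-- The Jacobi identity for `{ , }'_κ` holds on the image of `F`. -/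
theorem compK'_jacobi_mapF {U : Fin d → Set (S n 1)} {s : Fin d → ℕ → S n 1 → ℂ}
    (hU : BranchDomain U s) (κ : ℂ) {x : Fin d → S n 1} (hx : x ∈ Set.univ.pi U)
    (k p q : SIdx n d) :
    jacTerm eS (compK' κ n d) (mapF s x) k p q + jacTerm eS (compK' κ n d) (mapF s x) p q k
      + jacTerm eS (compK' κ n d) (mapF s x) q k p = 0 := by
  -- Since F is Poisson near x, the component function { , }'_κ composed with F is itself a bracket
  -- of entries of F there, and so double brackets pull back as well.
  have transport : ∀ k p q, jacTerm eS (compK' κ n d) (mapF s x) k p q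
      = bracket (prodTensor d (tensorK κ n 1)) (fun y => cS k (mapF s y))
        (bracket (prodTensor d (tensorK κ n 1)) (fun y => cS p (mapF s y))
          (fun y => cS q (mapF s y))) x := by
    intro k p q
    rw [jacTerm_eq cS_eS, ← tensorK'_eq]
    have h := mapF_isPoissonMapOn hU κ Set.univ (fun y => cS k y) (compK' κ n d p q) isOpen_univ
      (fun y _ => (cS k).analyticAt y) (fun y _ => analyticAt_compK' κ p q y) x hx trivial
    refine h.symm.trans ?_
    unfold bracket
    refine congrArg _ (Filter.EventuallyEq.fderiv_eq ?_)
    filter_upwards [(isOpen_domain hU).mem_nhds hx] with y hy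
    rw [prodTensorK_eq]
    exact (mapF_components hU κ hy p q).symm
  rw [transport, transport, transport]
  exact (prodTensorK_isHolomorphicPoisson κ n d).jacobi (Set.univ.pi U) _ _ _ (isOpen_domain hU)
    (fun y hy => ((cS k).analyticAt _).comp (analyticAt_mapF hU hy))
    (fun y hy => ((cS p).analyticAt _).comp (analyticAt_mapF hU hy))
    (fun y hy => ((cS q).analyticAt _).comp (analyticAt_mapF hU hy)) x hx

theorem analyticAt_jacTerm {E : Type*} [NormedAddCommGroup E] [NormedSpace ℂ E] {ι : Type*}
    [Fintype ι] {e : ι → E} {Λ : ι → ι → E → ℂ} {x : E} (hΛ : ∀ p q, AnalyticAt ℂ (Λ p q) x)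
    (k p q : ι) : AnalyticAt ℂ (fun y => jacTerm e Λ y k p q) x :=
  Finset.analyticAt_fun_sum _ fun l _ => (hΛ k l).mul (AnalyticAt.dirDeriv (hΛ p q) (e l))

/-- By the identity theorem, since the image of `F` has interior points. -/
theorem compK'_jacobi (κ : ℂ) (y : S n d) (k p q : SIdx n d) :
    jacTerm eS (compK' κ n d) y k p q + jacTerm eS (compK' κ n d) y p q k
      + jacTerm eS (compK' κ n d) y q k p = 0 := by
  have hU := branchDomain_principalRoot n d
  obtain ⟨e, h1, h2, h3, -⟩ := exists_biholomorphism (finrank_copies n d) (isOpen_domain hU)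
    (fun x hx => analyticAt_mapF hU hx) (fun x hx => mapF_fderiv_injective hU hx)
    (zero_mem_pi_posDomain n d)
  have han : ∀ k p q, AnalyticOnNhd ℂ (fun y => jacTerm eS (compK' κ n d) y k p q) Set.univ :=
    fun k p q y _ => analyticAt_jacTerm (fun p q => analyticAt_compK' κ p q y) k p q
  have := AnalyticOnNhd.eq_of_eventuallyEq (((han k p q).add (han p q k)).add (han q k p))
    (g := fun _ => (0 : ℂ)) (fun _ _ => analyticAt_const) (z₀ := e 0) ?_
  · exact congrFun this y
  · filter_upwards [e.open_target.mem_nhds (e.map_source h1)] with z hz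
    have := compK'_jacobi_mapF hU κ (h2 (e.map_target hz)) k p q
    rw [← h3, e.right_inv hz] at this
    exact this

theorem tensorK'_isHolomorphicPoisson (κ : ℂ) (n d : ℕ) :
    IsHolomorphicPoisson (tensorK' κ n d) := by
  rw [tensorK'_eq]
  exact coordTensor_isHolomorphicPoisson (compK'_anti κ n d) (analyticAt_compK' κ)
    (compK'_jacobi κ)

end LocalDiffeo

end SpinPoisson

end

noncomputable section

namespace SpinPoisson

open Filter Topology

section Factorization

variable {n d : ℕ}

/-! ### Ordered products -/

theorem ascProd_succ (M : Fin d → Matrix (Fin n) (Fin n) ℂ) (α : Fin d) :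
    ascProd M α = M α * ascProd M (α + 1) := by
  have h : (List.finRange d).drop α = α :: (List.finRange d).drop (α + 1) := by
    rw [List.drop_eq_getElem_cons (by simp)]
    simp
  simp [ascProd, h]

theorem descProd_succ (M : Fin d → Matrix (Fin n) (Fin n) ℂ) (α : Fin d) :
    descProd M α = descProd M (α + 1) * M α := by
  have h : (List.finRange d).drop α = α :: (List.finRange d).drop (α + 1) := by
    rw [List.drop_eq_getElem_cons (by simp)]
    simp
  simp [descProd, h]

theorem ascProd_last (M : Fin d → Matrix (Fin n) (Fin n) ℂ) : ascProd M d = 1 := by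
  rw [ascProd, List.drop_eq_nil_of_le (by simp), List.map_nil, List.prod_nil]

theorem descProd_last (M : Fin d → Matrix (Fin n) (Fin n) ℂ) : descProd M d = 1 := by
  rw [descProd, List.drop_eq_nil_of_le (by simp), List.map_nil, List.reverse_nil, List.prod_nil]

theorem ascProd_congr {M N : Fin d → Matrix (Fin n) (Fin n) ℂ} {k : ℕ} (hk : k ≤ d)
    (h : ∀ β : Fin d, k ≤ β → M β = N β) : ascProd M k = ascProd N k := by
  induction hk using Nat.decreasingInduction with
  | self => rw [ascProd_last, ascProd_last]
  | of_succ k hk ih =>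
    rw [ascProd_succ M ⟨k, hk⟩, ascProd_succ N ⟨k, hk⟩, h ⟨k, hk⟩ le_rfl,
      ih fun β hβ => h β (Nat.le_of_succ_le hβ)]

theorem descProd_congr {M N : Fin d → Matrix (Fin n) (Fin n) ℂ} {k : ℕ} (hk : k ≤ d)
    (h : ∀ β : Fin d, k ≤ β → M β = N β) : descProd M k = descProd N k := by
  induction hk using Nat.decreasingInduction with
  | self => rw [descProd_last, descProd_last]
  | of_succ k hk ih =>
    rw [descProd_succ M ⟨k, hk⟩, descProd_succ N ⟨k, hk⟩, h ⟨k, hk⟩ le_rfl,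
      ih fun β hβ => h β (Nat.le_of_succ_le hβ)]

theorem ascProd_mul_descProd_inv {M : Fin d → Matrix (Fin n) (Fin n) ℂ}
    (hM : ∀ β, IsUnit (M β).det) {k : ℕ} (hk : k ≤ d) :
    ascProd M k * descProd (fun β => (M β)⁻¹) k = 1 := by
  induction hk using Nat.decreasingInduction with
  | self => rw [ascProd_last, descProd_last, one_mul]
  | of_succ k hk ih =>
    rw [ascProd_succ M ⟨k, hk⟩, descProd_succ _ ⟨k, hk⟩]
    calc _ = M ⟨k, hk⟩ * (ascProd M (k + 1) * descProd (fun β => (M β)⁻¹) (k + 1))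
          * (M ⟨k, hk⟩)⁻¹ := by simp only [mul_assoc]
      _ = 1 := by rw [ih, mul_one, Matrix.mul_nonsing_inv _ (hM _)]

/-! ### The group `GL(n)^*` -/

theorem isUnit_det_lower {M : Matrix (Fin n) (Fin n) ℂ} (hM : ∀ j k, j < k → M j k = 0)
    (hd : ∀ j, M j j ≠ 0) : IsUnit M.det := by
  rw [← Matrix.det_transpose]
  exact isUnit_det_upper (M := Mᵀ) (fun j k h => hM k j h) hd

namespace InDualGroup

variable {hp hm gp gm : Matrix (Fin n) (Fin n) ℂ}

theorem diag_ne_zero (h : InDualGroup hp hm) (j : Fin n) : hp j j ≠ 0 :=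
  right_ne_zero_of_mul (ne_of_eq_of_ne (h.2.2 j) one_ne_zero)

theorem diag_ne_zero' (h : InDualGroup hp hm) (j : Fin n) : hm j j ≠ 0 :=
  left_ne_zero_of_mul (ne_of_eq_of_ne (h.2.2 j) one_ne_zero)

theorem isUnit_det (h : InDualGroup hp hm) : IsUnit hp.det := isUnit_det_upper h.1 h.diag_ne_zero

theorem isUnit_det' (h : InDualGroup hp hm) : IsUnit hm.det :=
  isUnit_det_lower h.2.1 h.diag_ne_zero'

/-- The quotient of two factorizations of one matrix is both upper and lower triangular, hence
diagonal. The condition that the diagonals of the two factors are inverse to each other then forces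
g_jj / h_jj = h_jj / g_jj. -/
theorem quotient_eq (h : InDualGroup hp hm) (g : InDualGroup gp gm)
    (e : hp⁻¹ * hm = gp⁻¹ * gm) : gp * hp⁻¹ = gm * hm⁻¹ := by
  have : gp * (hp⁻¹ * hm) * hm⁻¹ = gp * (gp⁻¹ * gm) * hm⁻¹ := by rw [e]
  rwa [← mul_assoc, mul_assoc, Matrix.mul_nonsing_inv _ h.isUnit_det', mul_one, ← mul_assoc,
    Matrix.mul_nonsing_inv _ g.isUnit_det, one_mul] at this

theorem quotient_lower (h : InDualGroup hp hm) (g : InDualGroup gp gm)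
    (e : hp⁻¹ * hm = gp⁻¹ * gm) (j k : Fin n) (hjk : j < k) : (gp * hp⁻¹) j k = 0 := by
  rw [quotient_eq h g e, ← Matrix.transpose_apply (gm * hm⁻¹) k j, Matrix.transpose_mul,
    Matrix.transpose_nonsing_inv]
  exact upper_mul (upper_inv (M := hmᵀ) (fun j k h' => h.2.1 k j h') h.diag_ne_zero')
    (N := gmᵀ) (fun j k h' => g.2.1 k j h') k j hjk

theorem quotient_diag (h : InDualGroup hp hm) (g : InDualGroup gp gm)
    (e : hp⁻¹ * hm = gp⁻¹ * gm) (j : Fin n) : (gp * hp⁻¹) j j = hp j j / gp j j := by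
  rw [quotient_eq h g e, ← Matrix.transpose_apply (gm * hm⁻¹) j j, Matrix.transpose_mul,
    Matrix.transpose_nonsing_inv,
    diag_mul_upper (upper_inv (M := hmᵀ) (fun j k h' => h.2.1 k j h') h.diag_ne_zero')
      (N := gmᵀ) (fun j k h' => g.2.1 k j h') j,
    diag_inv_upper (M := hmᵀ) (fun j k h' => h.2.1 k j h') h.diag_ne_zero',
    Matrix.transpose_apply, Matrix.transpose_apply, eq_inv_of_mul_eq_one_left (h.2.2 j),
    eq_inv_of_mul_eq_one_left (g.2.2 j), inv_inv, div_eq_mul_inv]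

/-- The diagonals of two factorizations agree up to signs. -/
theorem diag_sq_eq (h : InDualGroup hp hm) (g : InDualGroup gp gm)
    (e : hp⁻¹ * hm = gp⁻¹ * gm) (j : Fin n) : hp j j ^ 2 = gp j j ^ 2 := by
  have h1 := quotient_diag h g e j
  rw [diag_mul_upper g.1 (upper_inv h.1 h.diag_ne_zero), diag_inv_upper h.1 h.diag_ne_zero] at h1
  have := h.diag_ne_zero j
  have := g.diag_ne_zero j
  field_simp at h1
  exact h1.symm

/-- Two factorizations with the same diagonal agree. -/
theorem factorization_unique (h : InDualGroup hp hm) (g : InDualGroup gp gm)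
    (e : hp⁻¹ * hm = gp⁻¹ * gm) (hd : ∀ j, hp j j = gp j j) : hp = gp ∧ hm = gm := by
  have h1 : gp * hp⁻¹ = 1 := by
    ext j k
    rcases lt_trichotomy j k with hjk | rfl | hjk
    · rw [quotient_lower h g e j k hjk, Matrix.one_apply_ne hjk.ne]
    · rw [quotient_diag h g e j, hd, div_self (g.diag_ne_zero j), Matrix.one_apply_eq]
    · rw [upper_mul g.1 (upper_inv h.1 h.diag_ne_zero) j k hjk, Matrix.one_apply_ne hjk.ne']
  have h2 : gm * hm⁻¹ = 1 := by rw [← quotient_eq h g e, h1]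
  constructor
  · have : gp * hp⁻¹ * hp = hp := by rw [h1, one_mul]
    rw [← this, mul_assoc, Matrix.nonsing_inv_mul _ h.isUnit_det, mul_one]
  · have : gm * hm⁻¹ * hm = hm := by rw [h2, one_mul]
    rw [← this, mul_assoc, Matrix.nonsing_inv_mul _ h.isUnit_det', mul_one]

end InDualGroup

theorem ContinuousOn.entry {X : Type*} [TopologicalSpace X] {W : Set X}
    {M : X → Matrix (Fin n) (Fin n) ℂ} (h : ContinuousOn M W) (j k : Fin n) :
    ContinuousOn (fun y => M y j k) W :=
  (continuous_id.matrix_elem j k).comp_continuousOn h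

theorem SolvesFactorization.mono {V W : Set (S n d)}
    {gp gm : Fin d → S n d → Matrix (Fin n) (Fin n) ℂ} (h : SolvesFactorization V gp gm)
    (hW : W ⊆ V) : SolvesFactorization W gp gm := fun α =>
  ⟨(h α).1.mono hW, (h α).2.1.mono hW, (h α).2.2.1, (h α).2.2.2.1,
    fun y hy => (h α).2.2.2.2 y (hW hy)⟩

/-- Continuous solutions of the iterated factorization problem on a preconnected set are unique. -/
theorem SolvesFactorization.unique {W : Set (S n d)}
    {gp gm hp hm : Fin d → S n d → Matrix (Fin n) (Fin n) ℂ} (h0 : 0 ∈ W) (hW : IsPreconnected W)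
    (hg : SolvesFactorization W gp gm) (hh : SolvesFactorization W hp hm) (α : Fin d) :
    ∀ y ∈ W, hp α y = gp α y ∧ hm α y = gm α y := by
  -- The equation for α involves only the factors with larger index, so the induction descends from
  -- the last copy.
  induction α using WellFoundedGT.induction with
  | ind α ih =>
    have e : ∀ y ∈ W, (hp α y)⁻¹ * hm α y = (gp α y)⁻¹ * gm α y := by
      intro y hy
      rw [← ((hg α).2.2.2.2 y hy).2, ← ((hh α).2.2.2.2 y hy).2,
        ascProd_congr α.2 fun β hβ => (ih β hβ y hy).1,
        descProd_congr (N := fun β => (gm β y)⁻¹) α.2 fun β hβ =>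
          congrArg (·⁻¹) (ih β hβ y hy).2]
    -- The diagonals have equal squares, do not vanish, and agree at 0; on a preconnected set the
    -- sign cannot change.
    have hdiag : ∀ j, Set.EqOn (fun y => hp α y j j) (fun y => gp α y j j) W := by
      intro j
      refine hW.eq_of_sq_eq (ContinuousOn.entry (hh α).1 j j) (ContinuousOn.entry (hg α).1 j j)
        (fun y hy => ?_) (fun {y} hy => ((hg α).2.2.2.2 y hy).1.diag_ne_zero j) h0 ?_
      · exact InDualGroup.diag_sq_eq ((hh α).2.2.2.2 y hy).1 ((hg α).2.2.2.2 y hy).1 (e y hy) j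
      · simp only [(hh α).2.2.1, (hg α).2.2.1]
    exact fun y hy => InDualGroup.factorization_unique ((hh α).2.2.2.2 y hy).1
      ((hg α).2.2.2.2 y hy).1 (e y hy) fun j => hdiag j hy

/-! ### `g_+` and `g_-` -/

namespace IsRootBranch

variable {U : Set (S n 1)} {s : ℕ → S n 1 → ℂ}

theorem inDualGroup (h : IsRootBranch U s) {x : S n 1} (hx : x ∈ U) :
    InDualGroup (gPlus s x) (gMinus s x) := by
  refine ⟨fun j k hjk => ?_, fun j k hjk => ?_, fun j => ?_⟩
  · simp [gPlus, hjk.ne', hjk.not_gt]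
  · rw [h.gMinus_eq hx, Matrix.transpose_apply, RootData.hMat_lower _ _ _ _ hjk]
  · rw [h.gMinus_eq hx, Matrix.transpose_apply, RootData.hMat_diag, gPlus_eq]
    have h1 := h.ne_zero hx j
    have h2 := h.ne_zero hx (j + 1)
    simp only [gMat, Matrix.of_apply, if_true]
    field_simp

theorem continuousOn_rootVal (h : IsRootBranch U s) (j : ℕ) :
    ContinuousOn (fun x => rootVal s x j) U := by
  unfold rootVal
  split_ifs with hj
  · exact (h j hj).1
  · exact continuousOn_const

theorem continuousOn_gPlus (h : IsRootBranch U s) : ContinuousOn (gPlus s) U := by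
  refine continuousOn_pi.2 fun j => continuousOn_pi.2 fun k => ?_
  have hj := (h j j.2.le).1
  have hj' := h (j + 1) j.2
  have hk := h k k.2.le
  have hk' := h (k + 1) k.2
  simp only [gPlus, Matrix.of_apply]
  split_ifs
  · exact hj.div hj'.1 fun x hx => (hj'.2 x hx).1
  · exact ContinuousOn.div (by fun_prop) (hk.1.mul hk'.1)
      fun x hx => mul_ne_zero (hk.2 x hx).1 (hk'.2 x hx).1
  · exact continuousOn_const

theorem continuousOn_gMinus (h : IsRootBranch U s) : ContinuousOn (gMinus s) U := by
  refine ContinuousOn.congr ?_ fun x hx => h.gMinus_eq hx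
  refine continuousOn_pi.2 fun j => continuousOn_pi.2 fun k => ?_
  have hr := h.continuousOn_rootVal
  have hi : ∀ j, ContinuousOn (fun x => (rootVal s x j)⁻¹) U := fun j =>
    (hr j).inv₀ fun x hx => h.ne_zero hx j
  have ha : ∀ i, ContinuousOn (fun x : S n 1 => vecA x i) U := fun i => by
    unfold vecA; fun_prop
  have hb : ∀ i, ContinuousOn (fun x : S n 1 => vecB x i) U := fun i => by
    unfold vecB; fun_prop
  simp only [Matrix.transpose_apply, hMat, hat, Matrix.of_apply]
  split_ifs
  · exact (hr _).mul (hi _)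
  · exact (((hb _).mul ((hi _).mul (hi _))).mul (ha _)).neg
  · exact continuousOn_const

/-- This is `one_sub_hat` in matrix form: the factorization solved by a single copy. -/
theorem one_sub_dressed (h : IsRootBranch U s) {x : S n 1} (hx : x ∈ U) :
    1 - (gPlus s x)⁻¹ * matA x * (matB x * gMinus s x) = (gPlus s x)⁻¹ * gMinus s x := by
  have hr := h.rootData hx
  rw [h.gPlus_inv hx, h.gMinus_eq hx]
  ext i j
  have h1 : (hMat (vecA x) (vecB x) (rootVal s x) (fun j => (rootVal s x j)⁻¹) * matA x) i 0
      = hat (vecA x) (fun j => (rootVal s x j)⁻¹) i := hr.hMat_mulVec i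
  have h2 : (matB x * (hMat (vecB x) (vecA x) (rootVal s x) (fun j => (rootVal s x j)⁻¹))ᵀ) 0 j
      = hat (vecB x) (fun j => (rootVal s x j)⁻¹) j := by
    rw [← hr.swap.hMat_mulVec j]
    rw [Matrix.mul_apply]
    exact Finset.sum_congr rfl fun p _ => mul_comm (vecB x p) _
  rw [Matrix.sub_apply, Matrix.mul_apply, Fin.sum_univ_one, h1, h2, Matrix.one_apply]
  exact (hr.one_sub_hat i j).symm

end IsRootBranch

/-! ### `F` solves the iterated factorization problem -/

section Solve

variable {U : Fin d → Set (S n 1)} {s : Fin d → ℕ → S n 1 → ℂ}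

theorem colA_mapF (s : Fin d → ℕ → S n 1 → ℂ) (x : Fin d → S n 1) (α : Fin d) :
    colA (mapF s x) α = descProd (fun β => (gPlus (s β) (x β))⁻¹) α * matA (x α) := by
  ext i j
  rw [Subsingleton.elim j 0]
  rfl

theorem rowB_mapF (s : Fin d → ℕ → S n 1 → ℂ) (x : Fin d → S n 1) (α : Fin d) :
    rowB (mapF s x) α = matB (x α) * ascProd (fun β => gMinus (s β) (x β)) α := by
  ext j i
  rw [Subsingleton.elim j 0]
  rfl

/-- The outer products of g_+ and g_-⁻¹ over the copies after α undo their dressing of the column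
and row α, which leaves the single-copy identity `one_sub_dressed`. -/
theorem mapF_factorization (hU : BranchDomain U s) {x : Fin d → S n 1}
    (hx : x ∈ Set.univ.pi U) (α : Fin d) :
    1 - ascProd (fun β => gPlus (s β) (x β)) (α + 1) * (colA (mapF s x) α * rowB (mapF s x) α) *
      descProd (fun β => (gMinus (s β) (x β))⁻¹) (α + 1)
      = (gPlus (s α) (x α))⁻¹ * gMinus (s α) (x α) := by
  have hd := fun β => (hU β).2.inDualGroup (hx β (Set.mem_univ _))
  have hp := ascProd_mul_descProd_inv (fun β => (hd β).isUnit_det) (k := α + 1) α.2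
  have hm := ascProd_mul_descProd_inv (fun β => (hd β).isUnit_det') (k := α + 1) α.2
  rw [← (hU α).2.one_sub_dressed (hx α (Set.mem_univ _)), colA_mapF, rowB_mapF, descProd_succ,
    ascProd_succ (fun β => gMinus (s β) (x β))]
  congr 1
  calc _ = (ascProd (fun β => gPlus (s β) (x β)) (α + 1) *
        descProd (fun β => (gPlus (s β) (x β))⁻¹) (α + 1)) *
        ((gPlus (s α) (x α))⁻¹ * matA (x α) * (matB (x α) * gMinus (s α) (x α))) *
        (ascProd (fun β => gMinus (s β) (x β)) (α + 1) *
          descProd (fun β => (gMinus (s β) (x β))⁻¹) (α + 1)) := by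
        simp only [Matrix.mul_assoc]
    _ = _ := by rw [hp, hm, Matrix.one_mul, Matrix.mul_one]

theorem reconstruct_mapF (hU : BranchDomain U s) {x : Fin d → S n 1} (hx : x ∈ Set.univ.pi U)
    {gp gm : Fin d → S n d → Matrix (Fin n) (Fin n) ℂ}
    (hgp : ∀ β, gp β (mapF s x) = gPlus (s β) (x β))
    (hgm : ∀ β, gm β (mapF s x) = gMinus (s β) (x β)) : reconstruct gp gm (mapF s x) = x := by
  have hd := fun β => (hU β).2.inDualGroup (hx β (Set.mem_univ _))
  funext α
  have hp := ascProd_mul_descProd_inv (fun β => (hd β).isUnit_det) α.2.le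
  have hm := ascProd_mul_descProd_inv (fun β => (hd β).isUnit_det') α.2.le
  simp only [reconstruct, hgp, hgm, colA_mapF, rowB_mapF]
  refine Prod.ext ?_ ?_
  · funext i j
    rw [Subsingleton.elim j 0, ← Matrix.mul_assoc, hp, Matrix.one_mul]
    rfl
  · funext j i
    rw [Subsingleton.elim j 0, Matrix.mul_assoc, hm, Matrix.mul_one]
    rfl

end Solve

theorem gPlus_principalRoot_zero (n : ℕ) : gPlus principalRoot (0 : S n 1) = 1 := by
  ext j k
  simp [gPlus, principalRoot, G_zero, Matrix.one_apply]

theorem gMinus_principalRoot_zero (n : ℕ) : gMinus principalRoot (0 : S n 1) = 1 := by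
  have : gMinusInv principalRoot (0 : S n 1) = 1 := by
    ext j k
    simp [gMinusInv, principalRoot, G_zero, Matrix.one_apply]
  rw [gMinus, this, inv_one]

/-- The restriction of a biholomorphism to the preimage of a ball. -/
theorem exists_connected_target {E E' : Type*} [NormedAddCommGroup E] [NormedSpace ℂ E]
    [NormedAddCommGroup E'] [NormedSpace ℂ E'] {e : OpenPartialHomeomorph E E'}
    (he : IsBiholomorphism e) {x : E} (hx : x ∈ e.source) :
    ∃ e' : OpenPartialHomeomorph E E', x ∈ e'.source ∧ e'.source ⊆ e.source ∧ ⇑e' = e ∧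
      IsConnected e'.target ∧ IsBiholomorphism e' := by
  obtain ⟨r, hr, hB⟩ := Metric.isOpen_iff.1 e.open_target _ (e.map_source hx)
  -- The inverse is restricted to a ball inside the target, so that the new target is convex and
  -- therefore connected.
  refine ⟨(e.symm.restrOpen (Metric.ball (e x) r) Metric.isOpen_ball).symm, ?_, ?_, rfl, ?_, ?_, ?_⟩
  · exact (e.symm.restrOpen _ Metric.isOpen_ball).symm.map_target (x := e x)
      ⟨e.map_source hx, Metric.mem_ball_self hr⟩ |> fun h => by simpa [hx] using h
  · exact fun y hy => hy.1
  · have : (e.symm.restrOpen (Metric.ball (e x) r) Metric.isOpen_ball).symm.target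
        = Metric.ball (e x) r := Set.inter_eq_right.2 hB
    rw [this]
    let _ : NormedSpace ℝ E' := NormedSpace.restrictScalars ℝ ℂ E'
    exact ⟨⟨_, Metric.mem_ball_self hr⟩, (convex_ball (e x) r).isPreconnected⟩
  · exact fun y hy => he.1 y hy.1
  · exact fun y hy => he.2 y hy.1

end Factorization

end SpinPoisson

end

/-! ### Assembly of the theorem -/

theorem theorem2 (n d : ℕ) (κ : ℂ) (hκ : κ ≠ 0) :
    -- the brackets are holomorphic Poisson structures
    IsHolomorphicPoisson (tensorK κ n 1) ∧
    IsHolomorphicPoisson (prodTensor d (tensorK κ n 1)) ∧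
    IsHolomorphicPoisson (tensorK' κ n d) ∧
    -- wherever `g_±` are defined on the copies of `S(n,1)`, with any branches of the square roots,
    -- `F` is a local Poisson diffeomorphism
    (∀ (U : Fin d → Set (S n 1)) (s : Fin d → ℕ → S n 1 → ℂ),
      (∀ α, IsOpen (U α) ∧ IsRootBranch (U α) (s α)) →
      IsLocalPoissonDiffeoOn (prodTensor d (tensorK κ n 1)) (tensorK' κ n d)
        (mapF s) (Set.univ.pi U)) ∧
    -- near zero, with the principal branches, the local inverse of `F` is obtained by solving the
    -- iterated factorization problems
    (∃ e : OpenPartialHomeomorph (Fin d → S n 1) (S n d),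
      0 ∈ e.source ∧ e 0 = 0 ∧ IsConnected e.target ∧
      (∀ x ∈ e.source, ∀ α : Fin d, ∀ j ≤ n, 0 < (G j (x α)).re) ∧
      Set.EqOn e (mapF fun _ => principalRoot) e.source ∧
      IsBiholomorphism e ∧
      IsPoissonMapOn (prodTensor d (tensorK κ n 1)) (tensorK' κ n d) e e.source ∧
      ∃ gp gm : Fin d → S n d → Matrix (Fin n) (Fin n) ℂ,
        SolvesFactorization e.target gp gm ∧
        (∀ (W : Set (S n d)) (hp hm : Fin d → S n d → Matrix (Fin n) (Fin n) ℂ),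
          W ⊆ e.target → 0 ∈ W → IsPreconnected W → SolvesFactorization W hp hm →
          ∀ α, ∀ y ∈ W, hp α y = gp α y ∧ hm α y = gm α y) ∧
        ∀ y ∈ e.target, e.symm y = reconstruct gp gm y) := by
  have hU := branchDomain_principalRoot n d
  refine ⟨tensorK_isHolomorphicPoisson κ n, prodTensorK_isHolomorphicPoisson κ n d,
    tensorK'_isHolomorphicPoisson κ n d, fun U s hU => mapF_isLocalPoissonDiffeoOn hU κ, ?_⟩
  obtain ⟨e₀, h0, hsub, heq, hbi⟩ := exists_biholomorphism (finrank_copies n d) (isOpen_domain hU)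
    (fun x hx => analyticAt_mapF hU hx) (fun x hx => mapF_fderiv_injective hU hx)
    (zero_mem_pi_posDomain n d)
  obtain ⟨e, h0', hsub', heq', hconn, hbi'⟩ := exists_connected_target hbi h0
  have he : ⇑e = mapF fun _ => principalRoot := heq'.trans heq
  have hdom : e.source ⊆ Set.univ.pi fun _ : Fin d => posDomain n := hsub'.trans hsub
  have he0 : e 0 = 0 := by rw [he, mapF_zero]
  have hsymm0 : e.symm 0 = 0 := by
    have := e.left_inv h0'
    rwa [he0] at this
  have hpos : ∀ y ∈ e.target, ∀ α, e.symm y α ∈ posDomain n :=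
    fun y hy α => hdom (e.map_target hy) α (Set.mem_univ _)
  have hbr := isRootBranch_principalRoot n
  have hcont : ∀ α, ContinuousOn (fun y => e.symm y α) e.target := fun α =>
    (continuous_apply α).comp_continuousOn e.continuousOn_symm
  -- The solution is g_± of the copies, transported to the target by the inverse of F; no
  -- factorization has to be constructed.
  have hsolve : SolvesFactorization e.target (fun α y => gPlus principalRoot (e.symm y α))
      (fun α y => gMinus principalRoot (e.symm y α)) := by
    refine fun α => ⟨hbr.continuousOn_gPlus.comp (hcont α) fun y hy => hpos y hy α,
      hbr.continuousOn_gMinus.comp (hcont α) fun y hy => hpos y hy α, ?_, ?_, fun y hy =>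
      ⟨hbr.inDualGroup (hpos y hy α), ?_⟩⟩
    · simp only [hsymm0]
      exact gPlus_principalRoot_zero n
    · simp only [hsymm0]
      exact gMinus_principalRoot_zero n
    · have := mapF_factorization hU (hdom (e.map_target hy)) α
      rwa [← he, e.right_inv hy] at this
  refine ⟨e, h0', he0, hconn, fun x hx α j hj => hdom hx α (Set.mem_univ _) j hj,
    fun x _ => congrFun he x, hbi', ?_, _, _, hsolve, ?_, ?_⟩
  · intro O f g hO hf hg x hx hxO
    rw [he] at hxO ⊢
    exact mapF_isPoissonMapOn hU κ O f g hO hf hg x (hdom hx) hxO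
  · intro W hp hm hW h0W hWc hh α
    refine SolvesFactorization.unique h0W hWc (hsolve.mono hW) hh α
  · intro y hy
    have := reconstruct_mapF hU (hdom (e.map_target hy))
      (gp := fun α y => gPlus principalRoot (e.symm y α))
      (gm := fun α y => gMinus principalRoot (e.symm y α)) ?_ ?_
    · rw [← he, e.right_inv hy] at this
      exact this.symm
    · intro β
      simp only [← he, e.right_inv hy]
    · intro β
      simp only [← he, e.right_inv hy]
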